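/- Let $(\Omega,\mathcal A,\mathbb P)$ be a probability space, $(E,\mathcal F)$ a measurable space, $Y$ and $Y_n$ ($n\in\mathbb N$) random variables on $\Omega$ with values in $E$, $\mathbb P_Y$ the law of $Y$ and $\mathbb E_Y$ the expectation under $\mathbb P_Y$, and $(\alpha_n)$ a sequence of positive numbers. Let $\mathcal D$ be an algebra of bounded measurable functions from $E$ into $\mathbb K=\mathbb R$ or $\mathbb C$, containing the constants, dense in $L^2(E,\mathcal F,\mathbb P_Y;\mathbb K)$ and, when $\mathbb K=\mathbb C$, stable under complex conjugation. Assume (H3) for every $\varphi\in\mathcal D$ there is $\widetilde A[\varphi]\in L^2(\mathbb P_Y;\mathbb K)$ such that for every $\chi\in\mathcal D$ $$\lim_n\alpha_n\mathbb E[(\varphi(Y_n)-\varphi(Y))(\chi(Y_n)-\chi(Y))]=-2\,\mathbb E_Y[\widetilde A[\varphi]\chi].$$ Then: a) the limit $\widetilde{\mathcal E}[\varphi,\chi]=\lim_n\frac{\alpha_n}{2}\mathbb E[(\varphi(Y_n)-\varphi(Y))(\chi(Y_n)-\chi(Y))]$, $\varphi,\chi\in\mathcal D$, depends only on the $\mathbb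 P_Y$-classes of $\varphi$ and $\chi$ and defines a nonnegative symmetric bilinear form on the image of $\mathcal D$ in $L^2(\mathbb P_Y;\mathbb K)$, which is closable. It has a smallest closed extension, denoted $(\mathcal E,\mathbb D)$. b) $(\mathcal E,\mathbb D)$ is a Dirichlet form: $\mathbb D$ is dense in $L^2(\mathbb P_Y;\mathbb K)$, $\mathcal E$ is closed, and for every real-valued $u\in\mathbb D$ the function $v=\min(\max(u,0),1)$ belongs to $\mathbb D$ and $\mathcal E[v,v]\le\mathcal E[u,u]$. c) $(\mathcal E,\mathbb D)$ admits a square field operator (carré du champ) $\Gamma$, i.e. a symmetric, positive, continuous bilinear map $\mathbb D\times\mathbb D\to L^1(\mathbb P_Y;\mathbb K)$ such that $\mathbb D\cap L^\infty$ is stable under products and $$\mathcal E[uw,v]+\mathcal E[vw,u]-\mathcal E[w,uv]=\mathbb E_Y[w\,\Gamma[u,v]]\qquad\text{for all }u,v,w\in\mathbb D\cap L^\infty .$$ Writing $\Gamma[\varphi]=\Gamma[\varphi,\varphi]$, it satisfies for all $\varphi,\chi\in\mathcal D$ $$\Gamma[\varphi]=\widetilde A[\varphi^2]-2\varphi\widetilde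 A[\varphi]\quad \mathbb P_Y\text{-a.e.},$$ $$\mathbb E_Y[\Gamma[\varphi]\chi]=\lim_n\alpha_n\mathbb E\big[(\varphi(Y_n)-\varphi(Y))^2\,(\chi(Y_n)+\chi(Y))/2\big].$$ d) $(\mathcal E,\mathbb D)$ is local if and only if $\lim_n\alpha_n\mathbb E[(\varphi(Y_n)-\varphi(Y))^4]=0$ for every $\varphi\in\mathcal D$. Here local means: for every real-valued $u\in\mathbb D$ and all $F,G\in C_c^\infty(\mathbb R)$ with disjoint supports, $F(u)-F(0)$ and $G(u)-G(0)$ belong to $\mathbb D$ and $\mathcal E[F(u)-F(0),\,G(u)-G(0)]=0$. When $\mathbb K=\mathbb C$, the forms and $\Gamma$ are complex bilinear and commute with conjugation, their domains are stable under conjugation, and positivity means $\mathcal E[u,\bar u]\ge 0$ and $\Gamma[u,\bar u]\ge 0$; closedness and closability refer to the seminorm $\mathcal E[u,\bar u]^{1/2}$. -/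

import Mathlib

open MeasureTheory Filter Topology

/-- A nonnegative symmetric bilinear form on a linear subspace `domain` of `L²(μ; 𝕜)`, `𝕜 = ℝ` or
`ℂ`. In the complex case the domain is stable under conjugation, the form is real
(`form ū v̄` is the conjugate of `form u v`), and nonnegativity means `form u ū ≥ 0`; so the form is
the complexification of a nonnegative symmetric form on real functions. For `𝕜 = ℝ` the conjugation
is trivial. -/
structure SymmForm (𝕜 : Type*) [RCLike 𝕜] {E : Type*} [MeasurableSpace E] (μ : Measure E) where
  domain : Submodule 𝕜 (Lp 𝕜 2 μ)
  star_mem : ∀ u : Lp 𝕜 2 μ, u ∈ domain → star u ∈ domain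
  form : domain →ₗ[𝕜] domain →ₗ[𝕜] 𝕜
  symm : ∀ u v : domain, form u v = form v u
  real : ∀ u v : domain,
    form ⟨star (u : Lp 𝕜 2 μ), star_mem u u.2⟩ ⟨star (v : Lp 𝕜 2 μ), star_mem v v.2⟩
      = star (form u v)
  nonneg : ∀ u : domain, 0 ≤ RCLike.re (form u ⟨star (u : Lp 𝕜 2 μ), star_mem u u.2⟩)

namespace SymmForm

variable {𝕜 : Type*} [RCLike 𝕜] {E : Type*} [MeasurableSpace E] {μ : Measure E}

/-- Complex conjugation on the domain. -/
noncomputable def conj (S : SymmForm 𝕜 μ) (u : S.domain) : S.domain :=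
  ⟨star (u : Lp 𝕜 2 μ), S.star_mem u u.2⟩

/-- The energy `ℰ(u, ū)`, a nonnegative real number. -/
noncomputable def energy (S : SymmForm 𝕜 μ) (u : S.domain) : ℝ :=
  RCLike.re (S.form u (S.conj u))

/-- The sequence `u` is Cauchy for the energy seminorm. -/
def EnergyCauchy (S : SymmForm 𝕜 μ) (u : ℕ → S.domain) : Prop :=
  ∀ ε : ℝ, 0 < ε → ∃ N : ℕ, ∀ m ≥ N, ∀ n ≥ N, S.energy (u m - u n) < ε

/-- Closability: an energy-Cauchy sequence that tends to `0` in `L²` tends to `0` in energy. -/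
def Closable (S : SymmForm 𝕜 μ) : Prop :=
  ∀ u : ℕ → S.domain, S.EnergyCauchy u →
    Tendsto (fun n => (u n : Lp 𝕜 2 μ)) atTop (𝓝 0) →
    Tendsto (fun n => S.energy (u n)) atTop (𝓝 0)

/-- Closedness: the domain is complete for the norm `(‖u‖² + ℰ(u, ū))^{1/2}`. -/
def Closed (S : SymmForm 𝕜 μ) : Prop :=
  ∀ (u : ℕ → S.domain) (f : Lp 𝕜 2 μ), S.EnergyCauchy u →
    Tendsto (fun n => (u n : Lp 𝕜 2 μ)) atTop (𝓝 f) →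
    ∃ hf : f ∈ S.domain, Tendsto (fun n => S.energy (u n - ⟨f, hf⟩)) atTop (𝓝 0)

/-- `T` extends `S`. -/
def Extends (T S : SymmForm 𝕜 μ) : Prop :=
  ∃ h : S.domain ≤ T.domain, ∀ u v : S.domain,
    T.form (Submodule.inclusion h u) (Submodule.inclusion h v) = S.form u v

/-- `T` is the smallest closed extension of `S`. -/
def IsSmallestClosedExtension (T S : SymmForm 𝕜 μ) : Prop :=
  T.Closed ∧ T.Extends S ∧ ∀ T' : SymmForm 𝕜 μ, T'.Closed → T'.Extends S → T'.Extends T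

/-- A (symmetric) Dirichlet form: densely defined, closed, and the unit contraction
`u ↦ min (max u 0) 1` operates on the real-valued elements of the domain and does not increase the
energy. -/
def IsDirichletForm (S : SymmForm 𝕜 μ) : Prop :=
  Dense (S.domain : Set (Lp 𝕜 2 μ)) ∧ S.Closed ∧
    ∀ u : S.domain, star (u : Lp 𝕜 2 μ) = u →
      ∃ v : S.domain,
        ((v : Lp 𝕜 2 μ) : E → 𝕜)
          =ᵐ[μ] (fun x => ((min (max (RCLike.re ((u : Lp 𝕜 2 μ) x)) 0) 1 : ℝ) : 𝕜)) ∧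
        S.energy v ≤ S.energy u

/-- `u` belongs to `L^∞`. -/
def IsBdd (S : SymmForm 𝕜 μ) (u : S.domain) : Prop :=
  ∃ C : ℝ, ∀ᵐ x ∂μ, ‖(u : Lp 𝕜 2 μ) x‖ ≤ C

/-- `Γ` is the square field operator (carré du champ) of the form `ℰ` with domain `𝔻`: a symmetric,
positive, continuous bilinear map `𝔻 × 𝔻 → L¹(μ)` such that
`ℰ(u w, v) + ℰ(v w, u) - ℰ(w, u v) = ∫ w Γ(u, v) dμ` for all `u, v, w ∈ 𝔻 ∩ L^∞`
(where the products belong to `𝔻`). -/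
structure IsSquareField (S : SymmForm 𝕜 μ)
    (Γ : S.domain →ₗ[𝕜] S.domain →ₗ[𝕜] Lp 𝕜 1 μ) : Prop where
  symm : ∀ u v : S.domain, Γ u v = Γ v u
  real : ∀ u v : S.domain, Γ (S.conj u) (S.conj v) = star (Γ u v)
  nonneg : ∀ u : S.domain, ∀ᵐ x ∂μ, 0 ≤ RCLike.re (Γ u (S.conj u) x)
  continuous : ∃ C : ℝ, ∀ u v : S.domain,
    ‖Γ u v‖ ≤ C * √(‖(u : Lp 𝕜 2 μ)‖ ^ 2 + S.energy u) * √(‖(v : Lp 𝕜 2 μ)‖ ^ 2 + S.energy v)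
  identity : ∀ u v w : S.domain, S.IsBdd u → S.IsBdd v → S.IsBdd w →
    ∃ uw vw uv : S.domain,
      ((uw : Lp 𝕜 2 μ) : E → 𝕜) =ᵐ[μ] (fun x => (u : Lp 𝕜 2 μ) x * (w : Lp 𝕜 2 μ) x) ∧
      ((vw : Lp 𝕜 2 μ) : E → 𝕜) =ᵐ[μ] (fun x => (v : Lp 𝕜 2 μ) x * (w : Lp 𝕜 2 μ) x) ∧
      ((uv : Lp 𝕜 2 μ) : E → 𝕜) =ᵐ[μ] (fun x => (u : Lp 𝕜 2 μ) x * (v : Lp 𝕜 2 μ) x) ∧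
      S.form uw v + S.form vw u - S.form w uv = ∫ x, (w : Lp 𝕜 2 μ) x * Γ u v x ∂μ

/-- Locality of a Dirichlet form on a measure space: `ℰ(F(u) - F(0), G(u) - G(0)) = 0` for every
real-valued `u` in the domain and all `F, G ∈ C_c^∞(ℝ)` with disjoint supports. -/
def IsLocal (S : SymmForm 𝕜 μ) : Prop :=
  ∀ u : S.domain, star (u : Lp 𝕜 2 μ) = u →
    ∀ F G : ℝ → ℝ, ContDiff ℝ (⊤ : ℕ∞) F → ContDiff ℝ (⊤ : ℕ∞) G →
      HasCompactSupport F → HasCompactSupport G → Disjoint (tsupport F) (tsupport G) →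
      ∃ v w : S.domain,
        ((v : Lp 𝕜 2 μ) : E → 𝕜)
          =ᵐ[μ] (fun x => ((F (RCLike.re ((u : Lp 𝕜 2 μ) x)) - F 0 : ℝ) : 𝕜)) ∧
        ((w : Lp 𝕜 2 μ) : E → 𝕜)
          =ᵐ[μ] (fun x => ((G (RCLike.re ((u : Lp 𝕜 2 μ) x)) - G 0 : ℝ) : 𝕜)) ∧
        S.form v w = 0

end SymmForm

/-- `A : 𝒟 → L²(ℙ_Y)` is the symmetric bias operator of the approximation `Yₙ` of `Y`:
`αₙ 𝔼[(φ(Yₙ) - φ(Y)) (χ(Yₙ) - χ(Y))] → -2 𝔼_Y[A[φ] χ]` for all `φ, χ ∈ 𝒟`. -/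
def IsSymmetricBiasOperator {𝕜 : Type*} [RCLike 𝕜] {Ω E : Type*} [MeasurableSpace Ω]
    [MeasurableSpace E] (P : Measure Ω) (Y : Ω → E) (Yn : ℕ → Ω → E) (α : ℕ → ℝ)
    (D : StarSubalgebra 𝕜 (E → 𝕜)) (A : D → Lp 𝕜 2 (P.map Y)) : Prop :=
  ∀ φ χ : D, Tendsto
    (fun n => (α n : 𝕜) *
      ∫ ω, (φ.1 (Yn n ω) - φ.1 (Y ω)) * (χ.1 (Yn n ω) - χ.1 (Y ω)) ∂P)
    atTop (𝓝 (-2 * ∫ y, A φ y * χ.1 y ∂(P.map Y)))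

/-! Before the limit, `αₙ 𝔼[Φ(Y, Yₙ)]` integrates a function of a jump from `Y` to `Yₙ`. Pointwise
identities and inequalities between increments of functions therefore survive in the limit, and (H3)
adds that the limit form is `-∫ A[φ] χ`, hence L²-continuous in `χ` for fixed `φ`.

Closability (`form_closable`) comes from this continuity: in `ℰ(uₙ, uₙ) = ℰ(uₙ, uₙ - uₘ) + ℰ(uₙ,
uₘ)` the first term is small by Cauchy–Schwarz, and the second tends to `0` as `uₘ → 0` in L². The
closure is built from L²-limits of energy-Cauchy sequences.

For the contraction property, the algebra is not stable under a Lipschitz map `F`, but it is stable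
under polynomials. A polynomial close to `F` with derivative at most `K + ε` on the range of `a` has
increments along `a` at most `(K + ε)` times those of `a` (`exists_comp_near`), and lower
semicontinuity of a closed form (`Closed.exists_energy_le`) yields `compLp_mem`.

The square field is `Γ[φ, ψ] = A[φψ] - φ A[ψ] - ψ A[φ]` on the algebra. An identity between
increments shows that `∫ χ Γ[φ, ψ]` is the limit of the jump means of `Δφ Δψ` times the average of
`χ` at the two endpoints (`tendsto_sqFieldAlg`). This gives positivity and a bound of the L¹ norm by
the energies, so `Γ` extends to the closure. The defining identity passes to bounded elements
through uniformly bounded approximations.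

For locality, vanishing fourth moments force vanishing third moments, since second moments converge.
Taylor expansion then gives the chain rule `ℰ[F(u), G(v)] = ½ ∫ F'(u) G'(v) Γ[u, v]`
(`form_lipComp`), which is zero for `v = u` when the supports of `F` and `G` are disjoint.
Conversely, locality applied to two bump functions with disjoint supports shows that jumps between
two separated small intervals are negligible. By compactness all jumps of size at least `δ` are
negligible, and the smaller ones contribute at most `δ²` times the second moment. -/

namespace SymmForm

/-! ### Conjugation on `Lp`. -/

section LpStar

variable {𝕜 : Type*} [RCLike 𝕜] {E : Type*} [MeasurableSpace E] {μ : Measure E} {p : ENNReal}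

lemma lp_star_add (f g : Lp 𝕜 p μ) : star (f + g) = star f + star g := by
  apply Lp.ext
  filter_upwards [Lp.coeFn_star (f + g), Lp.coeFn_add f g, Lp.coeFn_star f, Lp.coeFn_star g,
    Lp.coeFn_add (star f) (star g)] with x h1 h2 h3 h4 h5
  rw [h1, h5, Pi.star_apply, h2, Pi.add_apply, Pi.add_apply, h3, h4]
  simp

lemma lp_star_smul (c : 𝕜) (f : Lp 𝕜 p μ) : star (c • f) = star c • star f := by
  apply Lp.ext
  filter_upwards [Lp.coeFn_star (c • f), Lp.coeFn_smul c f, Lp.coeFn_star f,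
    Lp.coeFn_smul (star c) (star f)] with x h1 h2 h3 h5
  rw [h1, h5]
  simp [h2, h3]

lemma lp_star_neg (f : Lp 𝕜 p μ) : star (-f) = -star f := by
  simpa using lp_star_smul (-1 : 𝕜) f

lemma lp_star_sub (f g : Lp 𝕜 p μ) : star (f - g) = star f - star g := by
  rw [sub_eq_add_neg, lp_star_add, lp_star_neg, ← sub_eq_add_neg]

lemma lp_norm_star (f : Lp 𝕜 p μ) : ‖star f‖ = ‖f‖ := by
  refine le_antisymm (Lp.norm_le_norm_of_ae_le ?_) (Lp.norm_le_norm_of_ae_le ?_) <;>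
  · filter_upwards [Lp.coeFn_star f] with x h1
    simp [h1]

lemma continuous_lp_star [Fact (1 ≤ p)] : Continuous (fun f : Lp 𝕜 p μ => star f) := by
  refine LipschitzWith.continuous (K := 1) (LipschitzWith.of_dist_le_mul fun f g => ?_)
  rw [dist_eq_norm, dist_eq_norm, ← lp_star_sub, lp_norm_star]
  simp

end LpStar

/-! ### Semi-inner product, energy and energy-Cauchy sequences. -/

variable {𝕜 : Type*} [RCLike 𝕜] {E : Type*} [MeasurableSpace E] {μ : Measure E}
variable (S : SymmForm 𝕜 μ)

@[simp] lemma coe_conj (u : S.domain) : (S.conj u : Lp 𝕜 2 μ) = star (u : Lp 𝕜 2 μ) := rfl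

@[simp] lemma conj_conj (u : S.domain) : S.conj (S.conj u) = u := Subtype.ext (by simp)

lemma conj_add (u v : S.domain) : S.conj (u + v) = S.conj u + S.conj v :=
  Subtype.ext (by simp [lp_star_add])

lemma conj_smul (c : 𝕜) (u : S.domain) : S.conj (c • u) = star c • S.conj u :=
  Subtype.ext (by simp [lp_star_smul])

lemma conj_sub (u v : S.domain) : S.conj (u - v) = S.conj u - S.conj v :=
  Subtype.ext (by simp [lp_star_sub])

lemma form_conj_conj (u v : S.domain) : S.form (S.conj u) (S.conj v) = star (S.form u v) :=
  S.real u v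

/-- The semi-inner product `⟨u, v⟩ = ℰ(ū, v)`. -/
noncomputable abbrev core : PreInnerProductSpace.Core 𝕜 S.domain where
  inner u v := S.form (S.conj u) v
  conj_inner_symm u v := by
    rw [S.symm (S.conj u) v, ← S.conj_conj v, starRingEnd_apply, ← S.form_conj_conj]
    simp
  re_inner_nonneg u := by rw [S.symm]; exact S.nonneg u
  add_left u v w := by simp [conj_add]
  smul_left u v r := by simp [conj_smul]

lemma energy_eq_re (u : S.domain) : S.energy u = RCLike.re (S.form (S.conj u) u) := by
  rw [energy, S.symm]

lemma energy_nonneg (u : S.domain) : 0 ≤ S.energy u := S.nonneg u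

@[simp] lemma energy_conj (u : S.domain) : S.energy (S.conj u) = S.energy u := by
  rw [energy_eq_re, conj_conj, energy]

lemma energy_smul (c : 𝕜) (u : S.domain) : S.energy (c • u) = ‖c‖ ^ 2 * S.energy u := by
  have : S.form (c • u) (S.conj (c • u)) = ((‖c‖ ^ 2 : ℝ) : 𝕜) * S.form u (S.conj u) := by
    rw [conj_smul, map_smul, map_smul, LinearMap.smul_apply, smul_eq_mul, smul_eq_mul, ← mul_assoc,
      mul_comm (star c), ← starRingEnd_apply, RCLike.mul_conj]
    norm_num
  rw [energy, this, RCLike.re_ofReal_mul, energy]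

@[simp] lemma energy_neg (u : S.domain) : S.energy (-u) = S.energy u := by
  simpa using S.energy_smul (-1) u

@[simp] lemma energy_zero : S.energy 0 = 0 := by simpa using S.energy_smul 0 0

lemma energy_sub_comm (u v : S.domain) : S.energy (u - v) = S.energy (v - u) := by
  rw [← energy_neg, neg_sub]

/-- Cauchy–Schwarz for `core`; conjugating the first argument turns the bilinear form into the
sesquilinear one without changing its energy. -/
lemma norm_form_le (u v : S.domain) : ‖S.form u v‖ ≤ √(S.energy u) * √(S.energy v) := by
  let _ := InnerProductSpace.Core.toSeminormedAddCommGroup (c := S.core)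
  have h := InnerProductSpace.Core.norm_inner_le_norm (c := S.core) (S.conj u) v
  rw [← energy_conj, S.energy_eq_re (S.conj u), S.energy_eq_re v]
  calc ‖S.form u v‖ = ‖S.form (S.conj (S.conj u)) v‖ := by rw [conj_conj]
    _ ≤ _ := h

lemma energy_parallelogram (u v : S.domain) :
    S.energy (u + v) + S.energy (u - v) = 2 * (S.energy u + S.energy v) := by
  simp only [energy, conj_add, conj_sub, map_add, map_sub, LinearMap.add_apply,
    LinearMap.sub_apply]
  ring

lemma energy_add_le (u v : S.domain) : S.energy (u + v) ≤ 2 * (S.energy u + S.energy v) := by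
  have := S.energy_parallelogram u v
  linarith [S.energy_nonneg (u - v)]

lemma energy_sub_le (u v : S.domain) : S.energy (u - v) ≤ 2 * (S.energy u + S.energy v) := by
  have := S.energy_parallelogram u v
  linarith [S.energy_nonneg (u + v)]

/-- The norm `(‖u‖² + ℰ(u, ū))^{1/2}` of the form domain. -/
noncomputable def formNorm (u : S.domain) : ℝ := √(‖(u : Lp 𝕜 2 μ)‖ ^ 2 + S.energy u)

lemma sqrt_energy_le_formNorm (u : S.domain) : √(S.energy u) ≤ S.formNorm u :=
  Real.sqrt_le_sqrt (by nlinarith [norm_nonneg (u : Lp 𝕜 2 μ)])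

variable {S}

lemma EnergyCauchy.add {u v : ℕ → S.domain} (hu : S.EnergyCauchy u) (hv : S.EnergyCauchy v) :
    S.EnergyCauchy (fun n => u n + v n) := by
  intro ε hε
  obtain ⟨N, hN⟩ := hu (ε / 4) (by positivity)
  obtain ⟨M, hM⟩ := hv (ε / 4) (by positivity)
  refine ⟨max N M, fun m hm n hn => ?_⟩
  have h1 := hN m (le_of_max_le_left hm) n (le_of_max_le_left hn)
  have h2 := hM m (le_of_max_le_right hm) n (le_of_max_le_right hn)
  have := S.energy_add_le (u m - u n) (v m - v n)
  rw [show u m + v m - (u n + v n) = u m - u n + (v m - v n) by abel]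
  linarith

lemma EnergyCauchy.smul {u : ℕ → S.domain} (hu : S.EnergyCauchy u) (c : 𝕜) :
    S.EnergyCauchy (fun n => c • u n) := by
  intro ε hε
  obtain ⟨N, hN⟩ := hu (ε / (‖c‖ ^ 2 + 1)) (by positivity)
  refine ⟨N, fun m hm n hn => ?_⟩
  have h1 := hN m hm n hn
  rw [← smul_sub, energy_smul]
  rw [lt_div_iff₀ (by positivity)] at h1
  nlinarith [S.energy_nonneg (u m - u n)]

lemma EnergyCauchy.conj {u : ℕ → S.domain} (hu : S.EnergyCauchy u) :
    S.EnergyCauchy (fun n => S.conj (u n)) := by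
  intro ε hε
  obtain ⟨N, hN⟩ := hu ε hε
  refine ⟨N, fun m hm n hn => ?_⟩
  rw [← conj_sub, energy_conj]
  exact hN m hm n hn

lemma EnergyCauchy.const (u : S.domain) : S.EnergyCauchy (fun _ => u) :=
  fun ε hε => ⟨0, fun m _ n _ => by simpa using hε⟩

lemma EnergyCauchy.of_tendsto {u : ℕ → S.domain} {f : S.domain}
    (h : Tendsto (fun n => S.energy (u n - f)) atTop (𝓝 0)) : S.EnergyCauchy u := by
  intro ε hε
  obtain ⟨N, hN⟩ := (h.eventually (gt_mem_nhds (show 0 < ε / 4 by positivity))).exists_forall_of_atTop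
  refine ⟨N, fun m hm n hn => ?_⟩
  have := S.energy_sub_le (u m - f) (u n - f)
  rw [sub_sub_sub_cancel_right] at this
  linarith [hN m hm, hN n hn]

lemma EnergyCauchy.bounded {u : ℕ → S.domain} (hu : S.EnergyCauchy u) :
    ∃ M, ∀ᶠ n in atTop, S.energy (u n) ≤ M := by
  obtain ⟨N, hN⟩ := hu 1 one_pos
  refine ⟨2 * (1 + S.energy (u N)), eventually_atTop.2 ⟨N, fun n hn => ?_⟩⟩
  have := S.energy_add_le (u n - u N) (u N)
  rw [sub_add_cancel] at this
  linarith [hN n hn N le_rfl]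

/-- `u` is energy-Cauchy and tends to `f` in `L²`. -/
def Approximates (u : ℕ → S.domain) (f : Lp 𝕜 2 μ) : Prop :=
  S.EnergyCauchy u ∧ Tendsto (fun n => (u n : Lp 𝕜 2 μ)) atTop (𝓝 f)

lemma Approximates.add {u v : ℕ → S.domain} {f g : Lp 𝕜 2 μ} (hu : Approximates u f)
    (hv : Approximates v g) : Approximates (fun n => u n + v n) (f + g) :=
  ⟨hu.1.add hv.1, hu.2.add hv.2⟩

lemma Approximates.smul {u : ℕ → S.domain} {f : Lp 𝕜 2 μ} (hu : Approximates u f) (c : 𝕜) :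
    Approximates (fun n => c • u n) (c • f) :=
  ⟨hu.1.smul c, hu.2.const_smul c⟩

lemma Approximates.sub {u v : ℕ → S.domain} {f g : Lp 𝕜 2 μ} (hu : Approximates u f)
    (hv : Approximates v g) : Approximates (fun n => u n - v n) (f - g) := by
  simpa [sub_eq_add_neg] using hu.add (hv.smul (-1))

lemma Approximates.conj {u : ℕ → S.domain} {f : Lp 𝕜 2 μ} (hu : Approximates u f) :
    Approximates (fun n => S.conj (u n)) (star f) :=
  ⟨hu.1.conj, (continuous_lp_star.tendsto f).comp hu.2⟩

lemma Approximates.const (u : S.domain) : Approximates (fun _ => u) (u : Lp 𝕜 2 μ) :=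
  ⟨.const u, tendsto_const_nhds⟩

end SymmForm

/-! ### Closure of a closable form and lower semicontinuity. -/

namespace SymmForm

variable {𝕜 : Type*} [RCLike 𝕜] {E : Type*} [MeasurableSpace E] {μ : Measure E}
variable {S : SymmForm 𝕜 μ}

lemma tendsto_sqrt_zero {ι : Type*} {l : Filter ι} {f : ι → ℝ} (h : Tendsto f l (𝓝 0)) :
    Tendsto (fun n => √(f n)) l (𝓝 0) := by
  have h' := (Real.continuous_sqrt.tendsto 0).comp h
  rwa [Real.sqrt_zero] at h'

/-- The map `j` lets one estimate serve twice: for the form itself, with `j` the identity, and for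
the square field, which is first defined on functions and not on their classes. -/
lemma norm_bilin_sub_le {V F : Type*} [AddCommGroup V] [Module 𝕜 V] [NormedAddCommGroup F]
    [NormedSpace 𝕜 F] (j : V →ₗ[𝕜] S.domain) (B : V →ₗ[𝕜] V →ₗ[𝕜] F) {C : ℝ}
    (hB : ∀ u v, ‖B u v‖ ≤ C * √(S.energy (j u)) * √(S.energy (j v))) (a b a' b' : V) :
    ‖B a b - B a' b'‖ ≤ C * √(S.energy (j a - j a')) * √(S.energy (j b))
      + C * √(S.energy (j a')) * √(S.energy (j b - j b')) := by
  have : B a b - B a' b' = B (a - a') b + B a' (b - b') := by simp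
  rw [this, ← map_sub, ← map_sub]
  exact (norm_add_le _ _).trans (add_le_add (hB _ _) (hB _ _))

lemma EnergyCauchy.bounded_sqrt {u : ℕ → S.domain} (hu : S.EnergyCauchy u) :
    ∃ M, ∀ᶠ n in atTop, √(S.energy (u n)) ≤ M := by
  obtain ⟨M, hM⟩ := hu.bounded
  exact ⟨√M, hM.mono fun n hn => Real.sqrt_le_sqrt hn⟩

lemma tendsto_bilin_sub {V F : Type*} [AddCommGroup V] [Module 𝕜 V] [NormedAddCommGroup F]
    [NormedSpace 𝕜 F] (j : V →ₗ[𝕜] S.domain) (B : V →ₗ[𝕜] V →ₗ[𝕜] F) {C : ℝ}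
    (hB : ∀ u v, ‖B u v‖ ≤ C * √(S.energy (j u)) * √(S.energy (j v))) {a b a' b' : ℕ → V}
    (hb : S.EnergyCauchy fun n => j (b n)) (ha' : S.EnergyCauchy fun n => j (a' n))
    (h1 : Tendsto (fun n => S.energy (j (a n) - j (a' n))) atTop (𝓝 0))
    (h2 : Tendsto (fun n => S.energy (j (b n) - j (b' n))) atTop (𝓝 0)) :
    Tendsto (fun n => B (a n) (b n) - B (a' n) (b' n)) atTop (𝓝 0) := by
  obtain ⟨M, hM⟩ := hb.bounded_sqrt
  obtain ⟨M', hM'⟩ := ha'.bounded_sqrt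
  have h3 := ((tendsto_sqrt_zero h1).const_mul |C|).mul_const M
  have h4 := ((tendsto_sqrt_zero h2).const_mul (|C| * M'))
  refine squeeze_zero_norm' ?_ (by simpa using h3.add h4)
  filter_upwards [hM, hM'] with n hn hn'
  refine (norm_bilin_sub_le j B hB _ _ _ _).trans (add_le_add ?_ ?_)
  · refine mul_le_mul (mul_le_mul_of_nonneg_right (le_abs_self C) (Real.sqrt_nonneg _)) hn
      (Real.sqrt_nonneg _) (by positivity)
  · refine mul_le_mul_of_nonneg_right ?_ (Real.sqrt_nonneg _)
    exact mul_le_mul (le_abs_self C) hn' (Real.sqrt_nonneg _) (abs_nonneg C)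

lemma tendsto_form {u v : ℕ → S.domain} {f g : S.domain}
    (hu : Tendsto (fun n => S.energy (u n - f)) atTop (𝓝 0))
    (hv : Tendsto (fun n => S.energy (v n - g)) atTop (𝓝 0)) :
    Tendsto (fun n => S.form (u n) (v n)) atTop (𝓝 (S.form f g)) := by
  have h := tendsto_bilin_sub (S := S) LinearMap.id S.form (C := 1)
    (by simpa using S.norm_form_le) (a := u) (b := v) (a' := fun _ => f) (b' := fun _ => g)
    (EnergyCauchy.of_tendsto hv) (EnergyCauchy.const f) hu hv
  simpa using h.add_const (S.form f g)

lemma tendsto_energy {u : ℕ → S.domain} {f : S.domain}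
    (hu : Tendsto (fun n => S.energy (u n - f)) atTop (𝓝 0)) :
    Tendsto (fun n => S.energy (u n)) atTop (𝓝 (S.energy f)) := by
  have h := tendsto_form hu (v := fun n => S.conj (u n)) (g := S.conj f)
    (by simpa only [← conj_sub, energy_conj] using hu)
  exact (RCLike.continuous_re.tendsto _).comp h

variable (S) in
/-- The domain of the closure: the `L²`-limits of energy-Cauchy sequences. -/
def closureDomain : Submodule 𝕜 (Lp 𝕜 2 μ) where
  carrier := {f | ∃ u : ℕ → S.domain, Approximates u f}
  add_mem' := fun ⟨_, hu⟩ ⟨_, hv⟩ => ⟨_, hu.add hv⟩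
  zero_mem' := ⟨_, Approximates.const 0⟩
  smul_mem' := fun c _ ⟨_, hu⟩ => ⟨_, hu.smul c⟩

/-- Two approximations of one `f` differ by an energy-Cauchy sequence tending to `0` in L².
Closability thus makes limits along approximations independent of the approximation. -/
lemma Closable.tendsto_energy_sub (hS : S.Closable) {u v : ℕ → S.domain} {f : Lp 𝕜 2 μ}
    (hu : Approximates u f) (hv : Approximates v f) :
    Tendsto (fun n => S.energy (u n - v n)) atTop (𝓝 0) := by
  have h := hu.sub hv
  rw [sub_self] at h
  exact hS _ h.1 h.2

/-- An energy-bounded bilinear map on a space mapping onto the domain of a closable form extends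
to the domain of the closure. -/
lemma Closable.exists_extension (hS : S.Closable) {V F : Type*} [AddCommGroup V] [Module 𝕜 V]
    [NormedAddCommGroup F] [NormedSpace 𝕜 F] [CompleteSpace F] (j : V →ₗ[𝕜] S.domain)
    (hj : Function.Surjective j) (B : V →ₗ[𝕜] V →ₗ[𝕜] F) (C : ℝ)
    (hB : ∀ u v, ‖B u v‖ ≤ C * √(S.energy (j u)) * √(S.energy (j v))) :
    ∃ B' : S.closureDomain →ₗ[𝕜] S.closureDomain →ₗ[𝕜] F,
      ∀ (a b : ℕ → V) (f g : S.closureDomain), Approximates (fun n => j (a n)) (f : Lp 𝕜 2 μ) →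
        Approximates (fun n => j (b n)) (g : Lp 𝕜 2 μ) →
        Tendsto (fun n => B (a n) (b n)) atTop (𝓝 (B' f g)) := by
  have hex : ∀ f : S.closureDomain, ∃ a : ℕ → V, Approximates (fun n => j (a n)) (f : Lp 𝕜 2 μ) := by
    rintro ⟨f, u, hu⟩
    choose a ha using fun n => hj (u n)
    exact ⟨a, by simpa [ha] using hu⟩
  choose a ha using hex
  have hlim : ∀ f g, ∃ L, Tendsto (fun n => B (a f n) (a g n)) atTop (𝓝 L) := by
    intro f g
    refine cauchySeq_tendsto_of_complete (Metric.cauchySeq_iff'.2 fun ε hε => ?_)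
    obtain ⟨M, hM⟩ := (ha f).1.bounded_sqrt
    obtain ⟨M', hM'⟩ := (ha g).1.bounded_sqrt
    obtain ⟨N₀, hN₀⟩ := eventually_atTop.1 (hM.and hM')
    set R := |C| * (|M| + |M'|) + 1 with hR
    have hR0 : 0 < R := by positivity
    obtain ⟨N₁, hN₁⟩ := (ha f).1 ((ε / (2 * R)) ^ 2) (by positivity)
    obtain ⟨N₂, hN₂⟩ := (ha g).1 ((ε / (2 * R)) ^ 2) (by positivity)
    refine ⟨max N₀ (max N₁ N₂), fun n hn => ?_⟩
    set N := max N₀ (max N₁ N₂)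
    have hN0 : N₀ ≤ N := le_max_left _ _
    have hN1 : N₁ ≤ N := (le_max_left _ _).trans (le_max_right _ _)
    have hN2 : N₂ ≤ N := (le_max_right _ _).trans (le_max_right _ _)
    have h1 := Real.sqrt_le_sqrt (hN₁ n (hN1.trans hn) N hN1).le
    have h2 := Real.sqrt_le_sqrt (hN₂ n (hN2.trans hn) N hN2).le
    rw [Real.sqrt_sq (by positivity)] at h1 h2
    have h3 : √(S.energy (j (a g n))) ≤ |M'| := ((hN₀ n (hN0.trans hn)).2).trans (le_abs_self _)
    have h4 : √(S.energy (j (a f N))) ≤ |M| := ((hN₀ N hN0).1).trans (le_abs_self _)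
    rw [dist_eq_norm]
    refine (norm_bilin_sub_le j B hB _ _ _ _).trans_lt ?_
    set δ := ε / (2 * R) with hδ
    have hδ0 : 0 < δ := by positivity
    calc _ ≤ |C| * δ * |M'| + |C| * |M| * δ := by
          refine add_le_add ?_ ?_
          · refine mul_le_mul ?_ h3 (Real.sqrt_nonneg _) (by positivity)
            exact mul_le_mul (le_abs_self C) h1 (Real.sqrt_nonneg _) (abs_nonneg C)
          · refine mul_le_mul ?_ h2 (Real.sqrt_nonneg _) (by positivity)
            exact mul_le_mul (le_abs_self C) h4 (Real.sqrt_nonneg _) (abs_nonneg C)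
      _ < R * δ := by nlinarith
      _ = ε / 2 := by rw [hδ]; field_simp
      _ < ε := by linarith
  choose L hL using hlim
  -- The limit `L` was defined by chosen approximations; any others give the same value. Bilinearity
  -- follows by approximating sums and multiples by sums and multiples.
  have key : ∀ (x y : ℕ → V) (f g : S.closureDomain),
      Approximates (fun n => j (x n)) (f : Lp 𝕜 2 μ) →
      Approximates (fun n => j (y n)) (g : Lp 𝕜 2 μ) →
      Tendsto (fun n => B (x n) (y n)) atTop (𝓝 (L f g)) := by
    intro x y f g hx hy
    have h := tendsto_bilin_sub j B hB (b := y) (a' := a f) hy.1 (ha f).1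
      (hS.tendsto_energy_sub hx (ha f)) (hS.tendsto_energy_sub hy (ha g))
    simpa using h.add (hL f g)
  refine ⟨LinearMap.mk₂ 𝕜 L ?_ ?_ ?_ ?_, key⟩
  · intro f f' g
    refine tendsto_nhds_unique (key (fun n => a f n + a f' n) (a g) _ _ ?_ (ha g)) ?_
    · simpa using (ha f).add (ha f')
    · simpa using (hL f g).add (hL f' g)
  · intro c f g
    refine tendsto_nhds_unique (key (fun n => c • a f n) (a g) _ _ ?_ (ha g)) ?_
    · simpa using (ha f).smul c
    · simpa using (hL f g).const_smul c
  · intro f g g'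
    refine tendsto_nhds_unique (key (a f) (fun n => a g n + a g' n) _ _ (ha f) ?_) ?_
    · simpa using (ha g).add (ha g')
    · simpa using (hL f g).add (hL f g')
  · intro c f g
    refine tendsto_nhds_unique (key (a f) (fun n => c • a g n) _ _ (ha f) ?_) ?_
    · simpa using (ha g).smul c
    · simpa using (hL f g).const_smul c

lemma Closable.exists_closure_form (hS : S.Closable) :
    ∃ B : S.closureDomain →ₗ[𝕜] S.closureDomain →ₗ[𝕜] 𝕜,
      ∀ (u v : ℕ → S.domain) (f g : S.closureDomain), Approximates u (f : Lp 𝕜 2 μ) →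
        Approximates v (g : Lp 𝕜 2 μ) →
        Tendsto (fun n => S.form (u n) (v n)) atTop (𝓝 (B f g)) :=
  hS.exists_extension LinearMap.id Function.surjective_id S.form 1 (by simpa using S.norm_form_le)

/-- The closure of a closable form. -/
noncomputable def closure (S : SymmForm 𝕜 μ) (hS : S.Closable) : SymmForm 𝕜 μ where
  domain := S.closureDomain
  star_mem := fun _ ⟨_, hu⟩ => ⟨_, hu.conj⟩
  form := hS.exists_closure_form.choose
  symm := by
    rintro ⟨f, u, hu⟩ ⟨g, v, hv⟩
    refine tendsto_nhds_unique (hS.exists_closure_form.choose_spec u v _ _ hu hv) ?_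
    simpa only [S.symm] using hS.exists_closure_form.choose_spec v u _ _ hv hu
  real := by
    rintro ⟨f, u, hu⟩ ⟨g, v, hv⟩
    refine tendsto_nhds_unique (hS.exists_closure_form.choose_spec _ _ _ _ hu.conj hv.conj) ?_
    simp only [form_conj_conj]
    exact (continuous_star.tendsto _).comp (hS.exists_closure_form.choose_spec u v _ _ hu hv)
  nonneg := by
    rintro ⟨f, u, hu⟩
    have h := hS.exists_closure_form.choose_spec _ _ ⟨f, u, hu⟩ ⟨_, _, hu.conj⟩ hu hu.conj
    exact ge_of_tendsto' ((RCLike.continuous_re.tendsto _).comp h) fun n => S.nonneg (u n)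

lemma closure_form_tendsto (hS : S.Closable) {u v : ℕ → S.domain} {f g : (S.closure hS).domain}
    (hu : Approximates u (f : Lp 𝕜 2 μ)) (hv : Approximates v (g : Lp 𝕜 2 μ)) :
    Tendsto (fun n => S.form (u n) (v n)) atTop (𝓝 ((S.closure hS).form f g)) :=
  hS.exists_closure_form.choose_spec u v f g hu hv

lemma domain_le_closure (hS : S.Closable) : S.domain ≤ (S.closure hS).domain :=
  fun f hf => ⟨_, Approximates.const (⟨f, hf⟩ : S.domain)⟩

/-- The inclusion of the domain of a form in the domain of its closure. -/
noncomputable def toClosure (hS : S.Closable) : S.domain →ₗ[𝕜] (S.closure hS).domain :=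
  Submodule.inclusion (domain_le_closure hS)

lemma conj_toClosure (hS : S.Closable) (u : S.domain) :
    (S.closure hS).conj (toClosure hS u) = toClosure hS (S.conj u) := rfl

@[simp] lemma closure_form_toClosure (hS : S.Closable) (u v : S.domain) :
    (S.closure hS).form (toClosure hS u) (toClosure hS v) = S.form u v :=
  tendsto_nhds_unique (closure_form_tendsto hS (Approximates.const u) (Approximates.const v))
    tendsto_const_nhds

@[simp] lemma closure_energy_toClosure (hS : S.Closable) (u : S.domain) :
    (S.closure hS).energy (toClosure hS u) = S.energy u := by
  rw [energy, conj_toClosure, closure_form_toClosure, energy]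

lemma closure_extends (hS : S.Closable) : (S.closure hS).Extends S :=
  ⟨domain_le_closure hS, closure_form_toClosure hS⟩

lemma Approximates.tendsto_energy (hS : S.Closable) {u : ℕ → S.domain}
    {f : (S.closure hS).domain} (hu : Approximates u (f : Lp 𝕜 2 μ)) :
    Tendsto (fun n => S.energy (u n)) atTop (𝓝 ((S.closure hS).energy f)) :=
  (RCLike.continuous_re.tendsto _).comp
    (closure_form_tendsto hS (g := (S.closure hS).conj f) hu hu.conj)

/-- For fixed `n`, the energy of `u n - f` is the limit over `m` of the energies of `u n - u m`,
which the Cauchy property makes small. -/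
lemma Approximates.tendsto_energy_sub (hS : S.Closable) {u : ℕ → S.domain}
    {f : (S.closure hS).domain} (hu : Approximates u (f : Lp 𝕜 2 μ)) :
    Tendsto (fun n => (S.closure hS).energy (toClosure hS (u n) - f)) atTop (𝓝 0) := by
  refine Metric.tendsto_atTop.2 fun ε hε => ?_
  obtain ⟨N, hN⟩ := hu.1 (ε / 2) (by positivity)
  refine ⟨N, fun n hn => ?_⟩
  have h : Tendsto (fun m => S.energy (u n - u m)) atTop
      (𝓝 ((S.closure hS).energy (toClosure hS (u n) - f))) :=
    Approximates.tendsto_energy hS (f := toClosure hS (u n) - f)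
      ((Approximates.const (u n)).sub hu)
  have h2 := le_of_tendsto h (eventually_atTop.2 ⟨N, fun m hm => (hN n hn m hm).le⟩)
  rw [Real.dist_eq, sub_zero, abs_of_nonneg (energy_nonneg _ _)]
  linarith

/-- Diagonal argument: each `u n` is replaced by an element of the original domain within `1 / (n +
1)` in L² norm and in energy. The new sequence approximates the same limit. -/
lemma closure_closed (hS : S.Closable) : (S.closure hS).Closed := by
  intro u f hu hf
  have hex : ∀ n, ∃ v : S.domain, (S.closure hS).energy (toClosure hS v - u n) < 1 / ((n : ℝ) + 1) ∧
      ‖(v : Lp 𝕜 2 μ) - u n‖ < 1 / ((n : ℝ) + 1) := by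
    intro n
    obtain ⟨w, hw⟩ := (u n).2
    have hpos : (0 : ℝ) < 1 / ((n : ℝ) + 1) := by positivity
    have h1 := (Approximates.tendsto_energy_sub hS hw).eventually (gt_mem_nhds hpos)
    have h2 := (tendsto_iff_norm_sub_tendsto_zero.1 hw.2).eventually (gt_mem_nhds hpos)
    obtain ⟨m, hm1, hm2⟩ := (h1.and h2).exists
    exact ⟨w m, hm1, hm2⟩
  choose v hv1 hv2 using hex
  have hlim := tendsto_one_div_add_atTop_nhds_zero_nat (𝕜 := ℝ)
  have e1 : Tendsto (fun n => (S.closure hS).energy (toClosure hS (v n) - u n)) atTop (𝓝 0) :=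
    squeeze_zero (fun n => energy_nonneg _ _) (fun n => (hv1 n).le) hlim
  have e2 : Tendsto (fun n => (v n : Lp 𝕜 2 μ) - u n) atTop (𝓝 0) :=
    squeeze_zero_norm (fun n => (hv2 n).le) hlim
  have hva : Approximates v f := by
    refine ⟨fun ε hε => ?_, by simpa using e2.add hf⟩
    have c1 : (S.closure hS).EnergyCauchy (fun n => toClosure hS (v n) - u n) :=
      EnergyCauchy.of_tendsto (f := 0) (by simpa using e1)
    obtain ⟨N, hN⟩ := (c1.add hu) ε hε
    refine ⟨N, fun m hm n hn => ?_⟩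
    have := hN m hm n hn
    simp only [sub_add_cancel] at this
    rwa [← map_sub, closure_energy_toClosure] at this
  have hfm : f ∈ (S.closure hS).domain := ⟨v, hva⟩
  refine ⟨hfm, ?_⟩
  have e3 := Approximates.tendsto_energy_sub hS (f := ⟨f, hfm⟩) hva
  refine squeeze_zero (fun n => energy_nonneg _ _) (fun n => ?_)
    (by simpa using (e1.add e3).const_mul 2)
  have e4 := (S.closure hS).energy_sub_le (toClosure hS (v n) - ⟨f, hfm⟩)
    (toClosure hS (v n) - u n)
  rw [sub_sub_sub_cancel_left] at e4
  linarith

/-- In a closed extension every approximating sequence of `S` must converge in energy to its L²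
limit, so the limit lies in that domain and the form there is the same limit. -/
lemma closure_isSmallestClosedExtension (hS : S.Closable) :
    (S.closure hS).IsSmallestClosedExtension S := by
  refine ⟨closure_closed hS, closure_extends hS, fun T' hT' ⟨hle, hform⟩ => ?_⟩
  have key : ∀ (u : ℕ → S.domain) (f : Lp 𝕜 2 μ), Approximates u f → ∃ hf : f ∈ T'.domain,
      Tendsto (fun n => T'.energy (Submodule.inclusion hle (u n) - ⟨f, hf⟩)) atTop (𝓝 0) := by
    intro u f hu
    refine hT' (fun n => Submodule.inclusion hle (u n)) f (fun ε hε => ?_) hu.2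
    obtain ⟨N, hN⟩ := hu.1 ε hε
    refine ⟨N, fun m hm n hn => ?_⟩
    have := hN m hm n hn
    rw [← map_sub]
    rwa [energy, show T'.conj (Submodule.inclusion hle (u m - u n))
      = Submodule.inclusion hle (S.conj (u m - u n)) from rfl, hform]
  refine ⟨fun f ⟨u, hu⟩ => (key u f hu).1, ?_⟩
  rintro ⟨f, u, hu⟩ ⟨g, v, hv⟩
  obtain ⟨hf, h1⟩ := key u f hu
  obtain ⟨hg, h2⟩ := key v g hv
  refine tendsto_nhds_unique (tendsto_form h1 h2) ?_
  simp only [hform]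
  exact closure_form_tendsto hS (f := ⟨f, u, hu⟩) (g := ⟨g, v, hv⟩) hu hv

/-- Energy-bounded elements of a midpoint-convex set that come `L²`-close to `f` can be
replaced by an energy-Cauchy sequence in that set. -/
lemma exists_approximates_of_bounded (K : Set S.domain)
    (hK : ∀ x ∈ K, ∀ y ∈ K, (1 / 2 : 𝕜) • (x + y) ∈ K) (f : Lp 𝕜 2 μ) (M : ℝ)
    (h : ∀ r > 0, ∃ v ∈ K, ‖(v : Lp 𝕜 2 μ) - f‖ ≤ r ∧ S.energy v ≤ M) :
    ∃ v : ℕ → S.domain, (∀ n, v n ∈ K) ∧ Approximates v f := by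
  let C : ℕ → Set S.domain := fun k => {v | v ∈ K ∧ ‖(v : Lp 𝕜 2 μ) - f‖ ≤ 1 / ((k : ℝ) + 1)}
  have hC : ∀ k l, k ≤ l → C l ⊆ C k := fun k l hkl v hv =>
    ⟨hv.1, hv.2.trans (one_div_le_one_div_of_le (by positivity) (by gcongr))⟩
  have hne : ∀ k, ∃ v ∈ C k, S.energy v ≤ M := fun k => by
    obtain ⟨v, hv, h1, h2⟩ := h (1 / ((k : ℝ) + 1)) (by positivity)
    exact ⟨v, ⟨hv, h1⟩, h2⟩
  -- The sets `C k` shrink, so the infima `m k` increase, and they stay below `M`. Near-minimisers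
  -- are energy-Cauchy: their midpoint lies in some `C N`, so its energy is at least `m N`, and the
  -- parallelogram identity bounds the energy of the difference.
  let m : ℕ → ℝ := fun k => sInf (S.energy '' C k)
  have hbdd : ∀ k, BddBelow (S.energy '' C k) := fun k =>
    ⟨0, by rintro _ ⟨v, -, rfl⟩; exact energy_nonneg _ _⟩
  have hm : ∀ k, ∀ v ∈ C k, m k ≤ S.energy v := fun k v hv =>
    csInf_le (hbdd k) (Set.mem_image_of_mem _ hv)
  have hmono : Monotone m := fun k l hkl => by
    obtain ⟨v, hv, -⟩ := hne l
    exact csInf_le_csInf (hbdd k) ⟨_, Set.mem_image_of_mem _ hv⟩ (Set.image_mono (hC k l hkl))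
  have hmM : ∀ k, m k ≤ M := fun k => by
    obtain ⟨v, hv, h1⟩ := hne k
    exact (hm k v hv).trans h1
  have hv : ∀ k, ∃ v ∈ C k, S.energy v < m k + 1 / ((k : ℝ) + 1) := fun k => by
    obtain ⟨w, hw, -⟩ := hne k
    obtain ⟨_, ⟨v, hv, rfl⟩, h1⟩ := exists_lt_of_csInf_lt (s := S.energy '' C k)
      ⟨_, Set.mem_image_of_mem _ hw⟩ (show m k < m k + 1 / ((k : ℝ) + 1) by
        have : (0 : ℝ) < 1 / ((k : ℝ) + 1) := by positivity
        linarith)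
    exact ⟨v, hv, h1⟩
  choose v hvC hvm using hv
  have hlim := tendsto_one_div_add_atTop_nhds_zero_nat (𝕜 := ℝ)
  refine ⟨v, fun n => (hvC n).1, fun ε hε => ?_, ?_⟩
  · obtain ⟨l, hl⟩ : ∃ l, Tendsto m atTop (𝓝 l) :=
      ⟨_, tendsto_atTop_ciSup hmono ⟨M, by rintro _ ⟨k, rfl⟩; exact hmM k⟩⟩
    have hle : ∀ k, m k ≤ l := fun k => hmono.ge_of_tendsto hl k
    -- The energies of `v a`, `v b` are below `l + ε / 8` and that of the midpoint exceeds `l - ε /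
    -- 8`; in the parallelogram identity these errors sum to `ε`.
    obtain ⟨N, hN⟩ := ((hl.eventually (lt_mem_nhds (show l - ε / 8 < l by linarith))).and
      (hlim.eventually (gt_mem_nhds (show 0 < ε / 8 by positivity)))).exists_forall_of_atTop
    refine ⟨N, fun a ha b hb => ?_⟩
    have hmid : (1 / 2 : 𝕜) • (v a + v b) ∈ C N := by
      refine ⟨hK _ (hvC a).1 _ (hvC b).1, ?_⟩
      have e : (((1 / 2 : 𝕜) • (v a + v b) : S.domain) : Lp 𝕜 2 μ) - f
          = (1 / 2 : 𝕜) • ((v a : Lp 𝕜 2 μ) - f) + (1 / 2 : 𝕜) • ((v b : Lp 𝕜 2 μ) - f) := by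
        push_cast
        module
      rw [e]
      have hn : ‖(1 / 2 : 𝕜)‖ = 1 / 2 := by simp
      have h1 := (hC N a ha (hvC a)).2
      have h2 := (hC N b hb (hvC b)).2
      refine (norm_add_le _ _).trans ?_
      rw [norm_smul, norm_smul, hn]
      linarith
    have h1 := hm N _ hmid
    rw [energy_smul] at h1
    have hn : ‖(1 / 2 : 𝕜)‖ ^ 2 = 1 / 4 := by simp; norm_num
    rw [hn] at h1
    have h2 := S.energy_parallelogram (v a) (v b)
    have h3 := hvm a
    have h4 := hvm b
    have h5 := (hN a ha).2
    have h6 := (hN b hb).2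
    have h7 := (hN N le_rfl).1
    linarith [hle a, hle b]
  · rw [tendsto_iff_norm_sub_tendsto_zero]
    exact squeeze_zero (fun n => norm_nonneg _) (fun n => (hvC n).2) hlim

/-- Lower semicontinuity of the energy of a closed form. -/
lemma Closed.exists_energy_le (hS : S.Closed) (f : Lp 𝕜 2 μ) (M : ℝ)
    (h : ∀ r > 0, ∃ v : S.domain, ‖(v : Lp 𝕜 2 μ) - f‖ ≤ r ∧ S.energy v ≤ M) :
    ∃ hf : f ∈ S.domain, S.energy ⟨f, hf⟩ ≤ M := by
  obtain ⟨v, hv, hva⟩ := exists_approximates_of_bounded {v : S.domain | S.energy v ≤ M} (by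
    intro x hx y hy
    change S.energy x ≤ M at hx
    change S.energy y ≤ M at hy
    change S.energy _ ≤ M
    have hn : ‖(1 / 2 : 𝕜)‖ ^ 2 = 1 / 4 := by simp; norm_num
    rw [energy_smul, hn]
    linarith [S.energy_add_le x y]) f M (fun r hr => by
      obtain ⟨v, h1, h2⟩ := h r hr
      exact ⟨v, h2, h1, h2⟩)
  obtain ⟨hf, h1⟩ := hS v f hva.1 hva.2
  exact ⟨hf, le_of_tendsto' (SymmForm.tendsto_energy h1) hv⟩

end SymmForm

/-! ### Polynomial approximation with control of the derivative. -/

namespace Polynomial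

lemma exists_derivative_eq (p : Polynomial ℝ) : ∃ q : Polynomial ℝ, derivative q = p := by
  induction p using Polynomial.induction_on' with
  | add p q hp hq =>
    obtain ⟨p', hp⟩ := hp
    obtain ⟨q', hq⟩ := hq
    exact ⟨p' + q', by simp [hp, hq]⟩
  | monomial n a =>
    refine ⟨monomial (n + 1) (a / (n + 1)), ?_⟩
    rw [derivative_monomial]
    congr 1
    push_cast
    field_simp

lemma abs_eval_sub_le_of_derivative {p : Polynomial ℝ} {C L : ℝ}
    (hL : ∀ x ∈ Set.Icc (-C) C, |(derivative p).eval x| ≤ L) {x y : ℝ}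
    (hx : x ∈ Set.Icc (-C) C) (hy : y ∈ Set.Icc (-C) C) :
    |p.eval x - p.eval y| ≤ L * |x - y| := by
  have := (convex_Icc (-C) C).norm_image_sub_le_of_norm_hasDerivWithin_le
    (fun z _ => (p.hasDerivAt z).hasDerivWithinAt) hL hy hx
  simpa using this

/-- Weierstrass approximation is applied to `F'` and the polynomial is then integrated, with the
constant matched at `0`. The denominator `|C| + 1` absorbs the distance to `0` over which the error
accumulates. -/
lemma exists_near_of_hasDerivAt {F F' : ℝ → ℝ} (hF : ∀ x, HasDerivAt F (F' x) x)
    (hF' : Continuous F') (C : ℝ) {ε : ℝ} (hε : 0 < ε) :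
    ∃ p : Polynomial ℝ, ∀ x ∈ Set.Icc (-C) C,
      |p.eval x - F x| ≤ ε ∧ |(derivative p).eval x - F' x| ≤ ε := by
  set δ := ε / (|C| + 1) with hδ
  have hδ0 : 0 < δ := by positivity
  have hδε : δ * (|C| + 1) = ε := by rw [hδ]; field_simp
  obtain ⟨q, hq⟩ := exists_polynomial_near_of_continuousOn (-C) C F' hF'.continuousOn δ hδ0
  obtain ⟨p₀, hp₀⟩ := exists_derivative_eq q
  refine ⟨p₀ + Polynomial.C (F 0 - p₀.eval 0), fun x hx => ?_⟩
  have hC : 0 ≤ C := by have := hx.1.trans hx.2; linarith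
  rw [abs_of_nonneg hC] at hδε
  refine ⟨?_, ?_⟩
  · have h0 : (0 : ℝ) ∈ Set.Icc (-C) C := ⟨by linarith, hC⟩
    have := (convex_Icc (-C) C).norm_image_sub_le_of_norm_hasDerivWithin_le
      (f := fun z => p₀.eval z - F z) (f' := fun z => q.eval z - F' z)
      (fun z _ => by
        have := (p₀.hasDerivAt z).sub (hF z)
        rw [hp₀] at this
        exact this.hasDerivWithinAt) (C := δ) (fun z hz => (hq z hz).le) h0 hx
    simp only [Real.norm_eq_abs, sub_zero] at this
    rw [eval_add, eval_C]
    have hxC : |x| ≤ C := abs_le.2 hx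
    calc _ = |p₀.eval x - F x - (p₀.eval 0 - F 0)| := by congr 1; ring
      _ ≤ δ * |x| := this
      _ ≤ δ * (C + 1) := by gcongr; linarith
      _ = ε := hδε
  · rw [derivative_add, derivative_C, add_zero, hp₀]
    refine (hq x hx).le.trans ?_
    nlinarith

/-- The moving average of `F` over `[x, x + h]` is continuously differentiable; its derivative is a
difference quotient of `F`, hence bounded by `K`, and it differs from `F` by at most `K h ≤ ε / 2`.
The previous approximation applies to it. -/
lemma exists_near_of_lipschitzWith {F : ℝ → ℝ} {K : NNReal} (hF : LipschitzWith K F) (C : ℝ)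
    {ε : ℝ} (hε : 0 < ε) :
    ∃ p : Polynomial ℝ, ∀ x ∈ Set.Icc (-C) C,
      |p.eval x - F x| ≤ ε ∧ |(derivative p).eval x| ≤ K + ε := by
  set h := ε / (2 * (K + 1)) with hh
  have hh0 : 0 < h := by positivity
  have hK : (K : ℝ) * h ≤ ε / 2 := by
    have : (K + 1) * h = ε / 2 := by rw [hh]; field_simp
    nlinarith
  let Φ : ℝ → ℝ := fun x => ∫ t in (0 : ℝ)..x, F t
  have hΦ : ∀ x, HasDerivAt Φ (F x) x := fun x =>
    intervalIntegral.integral_hasDerivAt_right (hF.continuous.intervalIntegrable _ _)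
      (hF.continuous.stronglyMeasurableAtFilter _ _) hF.continuous.continuousAt
  have hG : ∀ x, HasDerivAt (fun x => (Φ (x + h) - Φ x) / h) ((F (x + h) - F x) / h) x := fun x =>
    (((hΦ (x + h)).comp_add_const x h).sub (hΦ x)).div_const h
  obtain ⟨p, hp⟩ := exists_near_of_hasDerivAt hG
    (by have := hF.continuous; fun_prop) C (half_pos hε)
  refine ⟨p, fun x hx => ⟨?_, ?_⟩⟩
  · obtain ⟨ξ, hξ, hslope⟩ := exists_hasDerivAt_eq_slope Φ F (lt_add_of_pos_right x hh0)
      (fun z _ => (hΦ z).continuousAt.continuousWithinAt) (fun z _ => hΦ z)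
    rw [add_sub_cancel_left] at hslope
    have h1 := (hp x hx).1
    rw [← hslope] at h1
    have h2 := hF.dist_le_mul ξ x
    rw [Real.dist_eq, Real.dist_eq, abs_of_pos (a := ξ - x) (by linarith [hξ.1])] at h2
    have h3 : (K : ℝ) * (ξ - x) ≤ K * h := by gcongr; linarith [hξ.2]
    calc |p.eval x - F x| ≤ |p.eval x - F ξ| + |F ξ - F x| := abs_sub_le _ _ _
      _ ≤ ε := by linarith
  · have h1 := (hp x hx).2
    have h2 := hF.dist_le_mul (x + h) x
    rw [Real.dist_eq, Real.dist_eq, add_sub_cancel_left, abs_of_pos hh0] at h2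
    have h3 : |(F (x + h) - F x) / h| ≤ K := by
      rw [abs_div, abs_of_pos hh0, div_le_iff₀ hh0]; exact h2
    have h4 := abs_sub_abs_le_abs_sub ((derivative p).eval x) ((F (x + h) - F x) / h)
    linarith

lemma exists_bound_derivative (p : Polynomial ℝ) (C : ℝ) :
    ∃ L, 0 ≤ L ∧ ∀ x ∈ Set.Icc (-C) C, |(derivative p).eval x| ≤ L := by
  obtain ⟨L, hL⟩ := (isCompact_Icc (a := -C) (b := C)).exists_bound_of_continuousOn
    (derivative p).continuous.continuousOn
  exact ⟨|L|, abs_nonneg L, fun x hx => (hL x hx).trans (le_abs_self L)⟩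

/-- Mean value inequality for `z ↦ p(z) - p'(y) z` between `y` and `x`, where the derivative `p'(z)
- p'(y)` is at most `L |x - y|`. -/
lemma exists_taylor_bound (p : Polynomial ℝ) (C : ℝ) :
    ∃ L, 0 ≤ L ∧ ∀ x ∈ Set.Icc (-C) C, ∀ y ∈ Set.Icc (-C) C,
      |p.eval x - p.eval y - (derivative p).eval y * (x - y)| ≤ L * (x - y) ^ 2 := by
  obtain ⟨L, hL0, hL⟩ := (derivative p).exists_bound_derivative C
  refine ⟨L, hL0, fun x hx y hy => ?_⟩
  have := (convex_uIcc y x).norm_image_sub_le_of_norm_hasDerivWithin_le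
    (f := fun z => p.eval z - (derivative p).eval y * z)
    (f' := fun z => (derivative p).eval z - (derivative p).eval y) (C := L * |x - y|)
    (fun z _ => by
      have := (p.hasDerivAt z).sub ((hasDerivAt_id z).const_mul ((derivative p).eval y))
      rw [mul_one] at this
      exact this.hasDerivWithinAt)
    (fun z hz => by
      have hz' : z ∈ Set.Icc (-C) C := (Set.uIcc_subset_Icc hy hx) hz
      refine (abs_eval_sub_le_of_derivative hL hz' hy).trans ?_
      have := Set.abs_sub_left_of_mem_uIcc hz
      gcongr) Set.left_mem_uIcc Set.right_mem_uIcc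
  rw [Real.norm_eq_abs, Real.norm_eq_abs] at this
  calc _ = |p.eval x - (derivative p).eval y * x - (p.eval y - (derivative p).eval y * y)| := by
        congr 1; ring
    _ ≤ L * |x - y| * |x - y| := this
    _ = L * (x - y) ^ 2 := by rw [mul_assoc, ← sq, sq_abs]

end Polynomial

/-! ### Products and bilinear pairing in L²; bounded measurable functions. -/

section Pairing

variable {𝕜 : Type*} [RCLike 𝕜] {E : Type*} [MeasurableSpace E] (μ : Measure E)

/-- The product of two square integrable functions. -/
noncomputable def lpMul : Lp 𝕜 2 μ →L[𝕜] Lp 𝕜 2 μ →L[𝕜] Lp 𝕜 1 μ :=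
  (ContinuousLinearMap.mul 𝕜 𝕜).holderL μ 2 2 1

/-- The bilinear pairing `∫ f g dμ` on `L²`. -/
noncomputable def lpPair : Lp 𝕜 2 μ →L[𝕜] Lp 𝕜 2 μ →L[𝕜] 𝕜 :=
  (ContinuousLinearMap.mul 𝕜 𝕜).lpPairing μ 2 2

variable {μ}

lemma coeFn_lpMul (f g : Lp 𝕜 2 μ) : lpMul μ f g =ᵐ[μ] fun x => f x * g x :=
  (ContinuousLinearMap.mul 𝕜 𝕜).coeFn_holder f g

lemma lpPair_eq_integral (f g : Lp 𝕜 2 μ) : lpPair μ f g = ∫ x, f x * g x ∂μ :=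
  (ContinuousLinearMap.mul 𝕜 𝕜).lpPairing_eq_integral f g

lemma lpPair_eq_inner (f g : Lp 𝕜 2 μ) : lpPair μ f g = inner 𝕜 (star f) g := by
  rw [lpPair_eq_integral, L2.inner_def]
  refine integral_congr_ae ?_
  filter_upwards [Lp.coeFn_star f] with x h1
  rw [h1]
  simp [mul_comm]

lemma lpPair_star_star (f g : Lp 𝕜 2 μ) : lpPair μ (star f) (star g) = star (lpPair μ f g) := by
  rw [lpPair_eq_integral, lpPair_eq_integral, ← starRingEnd_apply, ← integral_conj]
  refine integral_congr_ae ?_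
  filter_upwards [Lp.coeFn_star f, Lp.coeFn_star g] with x h1 h2
  simp [h1, h2]

lemma norm_lpPair_le (f g : Lp 𝕜 2 μ) : ‖lpPair μ f g‖ ≤ ‖f‖ * ‖g‖ := by
  rw [lpPair_eq_inner, ← SymmForm.lp_norm_star f]
  exact norm_inner_le_norm _ _

lemma eq_of_lpPair_eq {s : Set (Lp 𝕜 2 μ)} (hs : Dense s) {f f' : Lp 𝕜 2 μ}
    (h : ∀ g ∈ s, lpPair μ f g = lpPair μ f' g) : f = f' := by
  have h1 : ∀ g, lpPair μ (f - f') g = 0 := by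
    have : (fun g => lpPair μ (f - f') g) = fun _ => 0 := by
      refine Continuous.ext_on hs (ContinuousLinearMap.continuous _) continuous_const fun g hg => ?_
      simp [h g hg]
    exact congrFun this
  have h2 := h1 (star (f - f'))
  rw [lpPair_eq_inner, inner_self_eq_zero] at h2
  rw [← sub_eq_zero, ← norm_eq_zero, ← SymmForm.lp_norm_star, h2, norm_zero]

end Pairing

/-- A bounded measurable function. -/
structure BddMeas {X 𝕂 : Type*} [MeasurableSpace X] [RCLike 𝕂] (f : X → 𝕂) : Prop where
  measurable : Measurable f
  bounded : ∃ C : ℝ, ∀ x, ‖f x‖ ≤ C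

namespace BddMeas

variable {X Z 𝕂 : Type*} [MeasurableSpace X] [MeasurableSpace Z] [RCLike 𝕂] {f g : X → 𝕂}

lemma const (c : 𝕂) : BddMeas (fun _ : X => c) := ⟨measurable_const, ‖c‖, fun _ => le_rfl⟩

lemma add (hf : BddMeas f) (hg : BddMeas g) : BddMeas (fun x => f x + g x) := by
  obtain ⟨C, hC⟩ := hf.bounded
  obtain ⟨C', hC'⟩ := hg.bounded
  exact ⟨hf.measurable.add hg.measurable, C + C',
    fun x => (norm_add_le _ _).trans (add_le_add (hC x) (hC' x))⟩

lemma mul (hf : BddMeas f) (hg : BddMeas g) : BddMeas (fun x => f x * g x) := by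
  obtain ⟨C, hC⟩ := hf.bounded
  obtain ⟨C', hC'⟩ := hg.bounded
  refine ⟨hf.measurable.mul hg.measurable, C * C', fun x => ?_⟩
  rw [norm_mul]
  exact mul_le_mul (hC x) (hC' x) (norm_nonneg _) ((norm_nonneg _).trans (hC x))

lemma sub (hf : BddMeas f) (hg : BddMeas g) : BddMeas (fun x => f x - g x) := by
  simpa [sub_eq_add_neg] using hf.add ((const (-1)).mul hg)

lemma pow (hf : BddMeas f) (k : ℕ) : BddMeas (fun x => f x ^ k) := by
  induction k with
  | zero => simpa using const (X := X) (1 : 𝕂)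
  | succ k ih => simpa only [pow_succ] using ih.mul hf

lemma comp (hf : BddMeas f) {u : Z → X} (hu : Measurable u) : BddMeas (fun z => f (u z)) :=
  ⟨hf.measurable.comp hu, hf.bounded.imp fun _ h z => h (u z)⟩

lemma norm (hf : BddMeas f) : BddMeas (fun x => ‖f x‖) :=
  ⟨hf.measurable.norm, hf.bounded.imp fun _ h x => by simpa using h x⟩

lemma ofReal {f : X → ℝ} (hf : BddMeas f) : BddMeas (fun x => (f x : 𝕂)) :=
  ⟨RCLike.continuous_ofReal.measurable.comp hf.measurable,
    hf.bounded.imp fun _ h x => by simpa using h x⟩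

lemma integrable (hf : BddMeas f) {μ : Measure X} [IsFiniteMeasure μ] : Integrable f μ := by
  obtain ⟨C, hC⟩ := hf.bounded
  exact Integrable.of_bound hf.measurable.aestronglyMeasurable C (.of_forall hC)

lemma memLp (hf : BddMeas f) {μ : Measure X} [IsFiniteMeasure μ] (p : ENNReal) : MemLp f p μ := by
  obtain ⟨C, hC⟩ := hf.bounded
  exact MemLp.of_bound hf.measurable.aestronglyMeasurable C (.of_forall hC)

end BddMeas

/-- The increment `f(y) - f(x)` as a function of `(x, y)`. -/
def increment {E 𝕂 : Type*} [Sub 𝕂] (f : E → 𝕂) (z : E × E) : 𝕂 := f z.2 - f z.1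

lemma BddMeas.increment {E 𝕂 : Type*} [MeasurableSpace E] [RCLike 𝕂] {f : E → 𝕂}
    (hf : BddMeas f) : BddMeas (increment f) :=
  (hf.comp measurable_snd).sub (hf.comp measurable_fst)

/-! ### Rescaled jump expectations and the standing hypotheses. -/

section Jump

variable {𝕂 Ω E : Type*} [RCLike 𝕂] [MeasurableSpace Ω] [MeasurableSpace E]

/-- The rescaled expectation `αₙ 𝔼[Φ(Y, Yₙ)]`. -/
noncomputable def jumpMean (P : Measure Ω) (Y : Ω → E) (Yn : ℕ → Ω → E) (α : ℕ → ℝ)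
    (Φ : E × E → 𝕂) (n : ℕ) : 𝕂 :=
  (α n : 𝕂) * ∫ ω, Φ (Y ω, Yn n ω) ∂P

end Jump

/-- Unital star algebras of functions on `E` with values in `𝕜`. -/
abbrev FunctionStarAlgebra (𝕜 : Type*) [RCLike 𝕜] (E : Type*) := StarSubalgebra 𝕜 (E → 𝕜)

/-- An approximation `Yₙ` of `Y` that has a symmetric bias operator `A` on a dense algebra `D` of
bounded measurable functions. -/
structure SymmetricBias {𝕜 : Type*} [RCLike 𝕜] {Ω E : Type*} [MeasurableSpace Ω]
    [MeasurableSpace E] (P : Measure Ω) (Y : Ω → E) (Yn : ℕ → Ω → E) (α : ℕ → ℝ)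
    (D : FunctionStarAlgebra 𝕜 E) (A : D → Lp 𝕜 2 (P.map Y)) : Prop where
  measurable_Y : Measurable Y
  measurable_Yn : ∀ n, Measurable (Yn n)
  α_pos : ∀ n, 0 < α n
  bddMeas : ∀ φ : D, BddMeas φ.1
  dense : Dense {f : Lp 𝕜 2 (P.map Y) | ∃ φ : D, (f : E → 𝕜) =ᵐ[P.map Y] φ.1}
  bias : IsSymmetricBiasOperator P Y Yn α D A

/-! ### The limit form on the algebra, its closability and its closure. -/

namespace SymmetricBias

variable {𝕜 : Type*} [RCLike 𝕜] {Ω E : Type*} [MeasurableSpace Ω] [MeasurableSpace E]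
  {P : Measure Ω} [IsProbabilityMeasure P] {Y : Ω → E} {Yn : ℕ → Ω → E} {α : ℕ → ℝ}
  {D : FunctionStarAlgebra 𝕜 E} {A : D → Lp 𝕜 2 (P.map Y)} {𝕂 : Type*} [RCLike 𝕂]

variable (h : SymmetricBias P Y Yn α D A)

section
include h

lemma isProbabilityMeasure : IsProbabilityMeasure (P.map Y) :=
  Measure.isProbabilityMeasure_map h.measurable_Y.aemeasurable

omit [IsProbabilityMeasure P] in
lemma bddMeas_comp {Φ : E × E → 𝕂} (hΦ : BddMeas Φ) (n : ℕ) :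
    BddMeas (fun ω => Φ (Y ω, Yn n ω)) :=
  hΦ.comp (h.measurable_Y.prodMk (h.measurable_Yn n))

lemma jumpMean_add {Φ Ψ : E × E → 𝕂} (hΦ : BddMeas Φ) (hΨ : BddMeas Ψ) (n : ℕ) :
    jumpMean P Y Yn α (fun z => Φ z + Ψ z) n
      = jumpMean P Y Yn α Φ n + jumpMean P Y Yn α Ψ n := by
  rw [jumpMean, integral_add (h.bddMeas_comp hΦ n).integrable (h.bddMeas_comp hΨ n).integrable,
    mul_add, jumpMean, jumpMean]

lemma jumpMean_sub {Φ Ψ : E × E → 𝕂} (hΦ : BddMeas Φ) (hΨ : BddMeas Ψ) (n : ℕ) :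
    jumpMean P Y Yn α (fun z => Φ z - Ψ z) n
      = jumpMean P Y Yn α Φ n - jumpMean P Y Yn α Ψ n := by
  rw [jumpMean, integral_sub (h.bddMeas_comp hΦ n).integrable (h.bddMeas_comp hΨ n).integrable,
    mul_sub, jumpMean, jumpMean]

lemma jumpMean_mono {Φ Ψ : E × E → ℝ} (hΦ : BddMeas Φ) (hΨ : BddMeas Ψ) (hle : ∀ z, Φ z ≤ Ψ z)
    (n : ℕ) : jumpMean P Y Yn α Φ n ≤ jumpMean P Y Yn α Ψ n :=
  mul_le_mul_of_nonneg_left (integral_mono (h.bddMeas_comp hΦ n).integrable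
    (h.bddMeas_comp hΨ n).integrable fun _ => hle _) (h.α_pos n).le

lemma norm_jumpMean_le {Φ : E × E → 𝕂} {Ψ : E × E → ℝ} (hΦ : BddMeas Φ) (hΨ : BddMeas Ψ)
    (hle : ∀ z, ‖Φ z‖ ≤ Ψ z) (n : ℕ) : ‖jumpMean P Y Yn α Φ n‖ ≤ jumpMean P Y Yn α Ψ n := by
  refine le_trans ?_ (h.jumpMean_mono hΦ.norm hΨ hle n)
  rw [jumpMean, jumpMean, norm_mul, RCLike.norm_ofReal, abs_of_pos (h.α_pos n)]
  exact mul_le_mul_of_nonneg_left (norm_integral_le_integral_norm _) (h.α_pos n).le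

omit [IsProbabilityMeasure P] in
lemma jumpMean_nonneg {Φ : E × E → ℝ} (hle : ∀ z, 0 ≤ Φ z) (n : ℕ) :
    0 ≤ jumpMean P Y Yn α Φ n :=
  mul_nonneg (h.α_pos n).le (integral_nonneg fun _ => hle _)

end

omit [IsProbabilityMeasure P] [MeasurableSpace E] in
lemma jumpMean_const_mul (c : 𝕂) (Φ : E × E → 𝕂) (n : ℕ) :
    jumpMean P Y Yn α (fun z => c * Φ z) n = c * jumpMean P Y Yn α Φ n := by
  rw [jumpMean, integral_const_mul, jumpMean]; ring

omit [IsProbabilityMeasure P] [MeasurableSpace E] in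
lemma jumpMean_ofReal (Φ : E × E → ℝ) (n : ℕ) :
    jumpMean P Y Yn α (fun z => (Φ z : 𝕂)) n = ((jumpMean P Y Yn α Φ n : ℝ) : 𝕂) := by
  rw [jumpMean, jumpMean, integral_ofReal]
  push_cast
  rfl

omit [IsProbabilityMeasure P] [MeasurableSpace E] in
lemma jumpMean_star (Φ : E × E → 𝕂) (n : ℕ) :
    jumpMean P Y Yn α (fun z => star (Φ z)) n = star (jumpMean P Y Yn α Φ n) := by
  rw [jumpMean, jumpMean, star_mul', ← starRingEnd_apply (∫ _, _ ∂P), ← integral_conj]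
  simp

include h

/-- The class in `L²` of an element of the algebra. -/
noncomputable def cls : D →ₗ[𝕜] Lp 𝕜 2 (P.map Y) :=
  haveI := h.isProbabilityMeasure
  { toFun := fun φ => ((h.bddMeas φ).memLp 2).toLp
    map_add' := fun _ _ => rfl
    map_smul' := fun _ _ => rfl }

lemma coeFn_cls (φ : D) : h.cls φ =ᵐ[P.map Y] φ.1 :=
  haveI := h.isProbabilityMeasure
  ((h.bddMeas φ).memLp 2).coeFn_toLp

lemma cls_eq_iff {φ : D} {f : Lp 𝕜 2 (P.map Y)} : h.cls φ = f ↔ (f : E → 𝕜) =ᵐ[P.map Y] φ.1 :=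
  ⟨fun H => H ▸ h.coeFn_cls φ, fun H => Lp.ext ((h.coeFn_cls φ).trans H.symm)⟩

lemma mem_range_cls {f : Lp 𝕜 2 (P.map Y)} :
    f ∈ LinearMap.range h.cls ↔ ∃ φ : D, (f : E → 𝕜) =ᵐ[P.map Y] φ.1 := by
  simp only [LinearMap.mem_range, h.cls_eq_iff]

lemma dense_cls : Dense (LinearMap.range h.cls : Set (Lp 𝕜 2 (P.map Y))) := by
  have h1 := h.dense
  convert h1 using 1
  ext f
  exact h.mem_range_cls

lemma star_cls (φ : D) : star (h.cls φ) = h.cls (star φ) := by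
  symm
  rw [h.cls_eq_iff]
  filter_upwards [Lp.coeFn_star (h.cls φ), h.coeFn_cls φ] with x h1 h2
  rw [h1, Pi.star_apply, h2]
  rfl

lemma tendsto_jumpMean (φ χ : D) :
    Tendsto (jumpMean P Y Yn α fun z => increment φ.1 z * increment χ.1 z) atTop
      (𝓝 (-2 * lpPair _ (A φ) (h.cls χ))) := by
  have h1 := h.bias φ χ
  rw [lpPair_eq_integral]
  have h2 : ∫ y, A φ y * h.cls χ y ∂(P.map Y) = ∫ y, A φ y * χ.1 y ∂(P.map Y) := by
    refine integral_congr_ae ?_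
    filter_upwards [h.coeFn_cls χ] with x hx
    rw [hx]
  rw [h2]
  exact h1

/-- The product of increments is symmetric before the limit. Since `A` is only assumed to be a
function, this symmetry, with density of the algebra, is what yields its linearity and its
independence of representatives. -/
lemma lpPair_bias_comm (φ χ : D) :
    lpPair _ (A φ) (h.cls χ) = lpPair _ (A χ) (h.cls φ) := by
  have h1 := h.tendsto_jumpMean φ χ
  have h2 := h.tendsto_jumpMean χ φ
  simp only [mul_comm (increment χ.1 _)] at h2
  have := tendsto_nhds_unique h1 h2
  simpa using this

lemma eq_of_lpPair_cls {f g : Lp 𝕜 2 (P.map Y)}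
    (H : ∀ χ : D, lpPair _ f (h.cls χ) = lpPair _ g (h.cls χ)) : f = g := by
  refine eq_of_lpPair_eq h.dense_cls ?_
  rintro _ ⟨χ, rfl⟩
  exact H χ

/-- The bias operator as a linear map. -/
noncomputable def biasₗ : D →ₗ[𝕜] Lp 𝕜 2 (P.map Y) where
  toFun := A
  map_add' φ ψ := h.eq_of_lpPair_cls fun χ => by
    simp only [map_add, _root_.add_apply, h.lpPair_bias_comm _ χ]
  map_smul' c φ := h.eq_of_lpPair_cls fun χ => by
    simp only [map_smul, _root_.smul_apply, h.lpPair_bias_comm _ χ, RingHom.id_apply]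

/-- By symmetry, the pairing of `A φ` with the class of `χ` depends on `φ` only through its class.
-/
lemma bias_congr {φ ψ : D} (H : h.cls φ = h.cls ψ) : A φ = A ψ :=
  h.eq_of_lpPair_cls fun χ => by rw [h.lpPair_bias_comm, H, h.lpPair_bias_comm]

lemma bias_star (φ : D) : A (star φ) = star (A φ) := by
  refine h.eq_of_lpPair_cls fun χ => ?_
  have h1 := h.tendsto_jumpMean (star φ) χ
  have h2 := (continuous_star.tendsto _).comp (h.tendsto_jumpMean φ (star χ))
  have h3 : (jumpMean P Y Yn α fun z => increment (star φ).1 z * increment χ.1 z)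
      = star ∘ (jumpMean P Y Yn α fun z => increment φ.1 z * increment (star χ).1 z) := by
    funext n
    rw [Function.comp_apply, ← jumpMean_star]
    congr 1
    funext z
    simp [increment]
  rw [h3] at h1
  have h4 := tendsto_nhds_unique h1 h2
  rw [← h.star_cls, star_mul', ← lpPair_star_star, star_star] at h4
  simpa using h4

/-- A linear section of the map from functions to their classes. -/
lemma exists_section : ∃ s : LinearMap.range h.cls →ₗ[𝕜] D, ∀ u, h.cls (s u) = u := by
  obtain ⟨s, hs⟩ := h.cls.rangeRestrict.exists_rightInverse_of_surjective
    (LinearMap.range_rangeRestrict _)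
  exact ⟨s, fun u => congrArg Subtype.val (LinearMap.congr_fun hs u)⟩

/-- A representative in the algebra. -/
noncomputable def rep : LinearMap.range h.cls →ₗ[𝕜] D := h.exists_section.choose

lemma cls_rep (u : LinearMap.range h.cls) : h.cls (h.rep u) = u := h.exists_section.choose_spec u

lemma tendsto_half_jumpMean (φ χ : D) :
    Tendsto (fun n => (2⁻¹ : 𝕜) * jumpMean P Y Yn α (fun z => increment φ.1 z * increment χ.1 z) n)
      atTop (𝓝 (-lpPair _ (A φ) (h.cls χ))) := by
  have := (h.tendsto_jumpMean φ χ).const_mul (2⁻¹ : 𝕜)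
  simpa using this

/-- The increment of `star φ` is the conjugate of that of `φ`, so the quantity before the limit is a
mean of `‖Δφ‖²`. -/
lemma re_lpPair_bias_star_nonneg (φ : D) : 0 ≤ RCLike.re (-lpPair _ (A φ) (h.cls (star φ))) := by
  have h1 := h.tendsto_half_jumpMean φ (star φ)
  refine ge_of_tendsto' ((RCLike.continuous_re.tendsto _).comp h1) fun n => ?_
  have h3 : (fun z => increment φ.1 z * increment (star φ).1 z)
      = fun z => ((‖increment φ.1 z‖ ^ 2 : ℝ) : 𝕜) := by
    funext z
    have : increment (star φ).1 z = star (increment φ.1 z) := by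
      simp [increment]
    rw [this, ← starRingEnd_apply, RCLike.mul_conj]
    norm_cast
  rw [Function.comp_apply, h3, jumpMean_ofReal]
  have h4 := h.jumpMean_nonneg (Φ := fun z => ‖increment φ.1 z‖ ^ 2) (fun z => by positivity) n
  have h5 : (2⁻¹ : 𝕜) = ((2⁻¹ : ℝ) : 𝕜) := by rw [RCLike.ofReal_inv, RCLike.ofReal_ofNat]
  rw [h5, ← RCLike.ofReal_mul, RCLike.ofReal_re]
  exact mul_nonneg (by norm_num) h4

/-- The bilinear map `-∫ A[u] v` on the classes of elements of the algebra. -/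
noncomputable def bilin : LinearMap.range h.cls →ₗ[𝕜] LinearMap.range h.cls →ₗ[𝕜] 𝕜 :=
  LinearMap.mk₂ 𝕜 (fun u v => -lpPair _ (h.biasₗ (h.rep u)) (v : Lp 𝕜 2 (P.map Y)))
    (fun u u' v => by rw [map_add, map_add, map_add, _root_.add_apply, neg_add])
    (fun c u v => by rw [map_smul, map_smul, map_smul, _root_.smul_apply, smul_neg])
    (fun u v v' => by rw [Submodule.coe_add, map_add, neg_add])
    (fun c u v => by rw [Submodule.coe_smul, map_smul, smul_neg])

lemma bilin_apply {φ : D} {u : LinearMap.range h.cls} (hu : h.cls φ = u)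
    (v : LinearMap.range h.cls) : h.bilin u v = -lpPair _ (A φ) (v : Lp 𝕜 2 (P.map Y)) := by
  change -lpPair _ (A (h.rep u)) _ = _
  rw [h.bias_congr (ψ := φ)]
  rw [h.cls_rep, hu]

/-- The limit form on the classes of elements of the algebra. -/
noncomputable def form : SymmForm 𝕜 (P.map Y) where
  domain := LinearMap.range h.cls
  star_mem := by
    rintro _ ⟨φ, rfl⟩
    exact ⟨star φ, (h.star_cls φ).symm⟩
  form := h.bilin
  symm := by
    rintro ⟨_, φ, rfl⟩ ⟨_, ψ, rfl⟩
    rw [h.bilin_apply (φ := φ) rfl, h.bilin_apply (φ := ψ) rfl, h.lpPair_bias_comm]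
  real := by
    rintro ⟨_, φ, rfl⟩ ⟨_, ψ, rfl⟩
    refine (h.bilin_apply (φ := star φ) (h.star_cls φ).symm _).trans ?_
    rw [h.bias_star, h.bilin_apply (φ := φ) rfl, star_neg, ← lpPair_star_star]
  nonneg := by
    rintro ⟨_, φ, rfl⟩
    have h1 := h.re_lpPair_bias_star_nonneg φ
    rw [← h.star_cls] at h1
    rwa [h.bilin_apply (φ := φ) rfl]

/-- The class of an element of the algebra, as an element of the domain. -/
noncomputable def toDomain : D →ₗ[𝕜] h.form.domain := h.cls.rangeRestrict

lemma toDomain_surjective : Function.Surjective h.toDomain := LinearMap.surjective_rangeRestrict _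

lemma conj_toDomain (φ : D) : h.form.conj (h.toDomain φ) = h.toDomain (star φ) :=
  Subtype.ext (h.star_cls φ)

lemma form_toDomain_left (φ : D) (v : h.form.domain) :
    h.form.form (h.toDomain φ) v = -lpPair _ (A φ) (v : Lp 𝕜 2 (P.map Y)) := by
  exact h.bilin_apply rfl v

/-- With `u n` the class of `φ`, `ℰ(u n, conj (u m)) = -∫ A[φ] conj (u m)` tends to `0` in `m`,
because `A[φ]` is in L². The rest, `ℰ(u n, conj (u n - u m))`, is controlled by Cauchy–Schwarz and
the bound on the energies. -/
lemma form_closable : h.form.Closable := by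
  intro u hu h0
  obtain ⟨M, hM⟩ := hu.bounded_sqrt
  refine Metric.tendsto_atTop.2 fun ε hε => ?_
  obtain ⟨N₀, hN₀⟩ := eventually_atTop.1 hM
  obtain ⟨N₁, hN₁⟩ := hu ((ε / (2 * (|M| + 1))) ^ 2) (by positivity)
  refine ⟨max N₀ N₁, fun n hn => ?_⟩
  rw [Real.dist_eq, sub_zero, abs_of_nonneg (SymmForm.energy_nonneg _ _)]
  obtain ⟨φ, hφ⟩ := h.toDomain_surjective (u n)
  have key : ∀ m ≥ N₁, h.form.energy (u n) ≤ ε / 2 + ‖A φ‖ * ‖(u m : Lp 𝕜 2 (P.map Y))‖ := by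
    intro m hm
    have e1 : h.form.energy (u n) = RCLike.re (h.form.form (u n) (h.form.conj (u n - u m)))
        + RCLike.re (h.form.form (u n) (h.form.conj (u m))) := by
      rw [← map_add, ← map_add, ← SymmForm.conj_add, sub_add_cancel]; rfl
    have e2 := h.form.norm_form_le (u n) (h.form.conj (u n - u m))
    rw [SymmForm.energy_conj] at e2
    have e3 := Real.sqrt_le_sqrt (hN₁ n (le_of_max_le_right hn) m hm).le
    rw [Real.sqrt_sq (by positivity)] at e3
    have e4 : √(h.form.energy (u n)) ≤ |M| + 1 := by
      linarith [hN₀ n (le_of_max_le_left hn), le_abs_self M]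
    have e5 : ‖h.form.form (u n) (h.form.conj (u m))‖ ≤ ‖A φ‖ * ‖(u m : Lp 𝕜 2 (P.map Y))‖ := by
      rw [← hφ, h.form_toDomain_left, norm_neg]
      refine (norm_lpPair_le _ _).trans ?_
      rw [SymmForm.coe_conj, SymmForm.lp_norm_star]
    have e6 : √(h.form.energy (u n)) * √(h.form.energy (u n - u m))
        ≤ (|M| + 1) * (ε / (2 * (|M| + 1))) := by gcongr
    have e7 : (|M| + 1) * (ε / (2 * (|M| + 1))) = ε / 2 := by field_simp
    have e8 := RCLike.re_le_norm (h.form.form (u n) (h.form.conj (u n - u m)))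
    have e9 := RCLike.re_le_norm (h.form.form (u n) (h.form.conj (u m)))
    linarith
  have hlim : Tendsto (fun m => ε / 2 + ‖A φ‖ * ‖(u m : Lp 𝕜 2 (P.map Y))‖) atTop (𝓝 (ε / 2)) := by
    simpa using (h0.norm.const_mul ‖A φ‖).const_add (ε / 2)
  have := ge_of_tendsto hlim (eventually_atTop.2 ⟨N₁, key⟩)
  linarith

/-- The closure of the limit form. -/
noncomputable def closedForm : SymmForm 𝕜 (P.map Y) := h.form.closure h.form_closable

lemma closedForm_closed : h.closedForm.Closed := SymmForm.closure_closed _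

/-- The class of an element of the algebra, as an element of the domain of the closure. -/
noncomputable def emb : D →ₗ[𝕜] h.closedForm.domain :=
  (SymmForm.toClosure h.form_closable).comp h.toDomain

@[simp] lemma coe_emb (φ : D) : (h.emb φ : Lp 𝕜 2 (P.map Y)) = h.cls φ := rfl

lemma conj_emb (φ : D) : h.closedForm.conj (h.emb φ) = h.emb (star φ) :=
  Subtype.ext (h.star_cls φ)

lemma energy_toDomain (φ : D) : h.form.energy (h.toDomain φ) = h.closedForm.energy (h.emb φ) :=
  (SymmForm.closure_energy_toClosure _ _).symm

/-- The algebra is a core of the closure. -/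
lemma exists_seq_emb (f : h.closedForm.domain) : ∃ φ : ℕ → D,
    SymmForm.Approximates (fun n => h.toDomain (φ n)) (f : Lp 𝕜 2 (P.map Y)) := by
  obtain ⟨u, hu⟩ := f.2
  choose φ hφ using fun n => h.toDomain_surjective (u n)
  exact ⟨φ, by simpa only [hφ] using hu⟩

lemma tendsto_energy_emb_sub {f : h.closedForm.domain} {φ : ℕ → D}
    (hφ : SymmForm.Approximates (fun n => h.toDomain (φ n)) (f : Lp 𝕜 2 (P.map Y))) :
    Tendsto (fun n => h.closedForm.energy (h.emb (φ n) - f)) atTop (𝓝 0) :=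
  SymmForm.Approximates.tendsto_energy_sub h.form_closable hφ

/-- Elements of the algebra lie in the domain of the generator: against them the closed form is
L²-continuous in the other argument. -/
lemma closedForm_emb_left (φ : D) (f : h.closedForm.domain) :
    h.closedForm.form (h.emb φ) f = -lpPair _ (A φ) (f : Lp 𝕜 2 (P.map Y)) := by
  obtain ⟨ψ, hψ⟩ := h.exists_seq_emb f
  have h1 := SymmForm.closure_form_tendsto h.form_closable (f := h.emb φ) (g := f)
    (SymmForm.Approximates.const (h.toDomain φ)) hψ
  refine tendsto_nhds_unique h1 ?_
  simp only [h.form_toDomain_left]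
  exact (((lpPair _ (A φ)).continuous.tendsto _).comp hψ.2).neg

lemma tendsto_form_emb (φ χ : D) :
    Tendsto (fun n => (2⁻¹ : 𝕜) * jumpMean P Y Yn α (fun z => increment φ.1 z * increment χ.1 z) n)
      atTop (𝓝 (h.closedForm.form (h.emb φ) (h.emb χ))) := by
  rw [h.closedForm_emb_left]
  exact h.tendsto_half_jumpMean φ χ

lemma exists_emb_near (f : h.closedForm.domain) {ε : ℝ} (hε : 0 < ε) :
    ∃ φ : D, h.closedForm.energy (h.emb φ - f) < ε ∧ ‖h.cls φ - f‖ < ε := by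
  obtain ⟨φ, hφ⟩ := h.exists_seq_emb f
  have h1 := (h.tendsto_energy_emb_sub hφ).eventually (gt_mem_nhds hε)
  have h2 := (tendsto_iff_norm_sub_tendsto_zero.1 hφ.2).eventually (gt_mem_nhds hε)
  obtain ⟨n, hn⟩ := (h1.and h2).exists
  exact ⟨φ n, hn⟩

/-- A sequence that converges in `L²` with bounded energies converges weakly for the form. -/
lemma tendsto_form_of_bounded {f : ℕ → h.closedForm.domain} {f₀ : h.closedForm.domain} {M : ℝ}
    (hM : ∀ k, h.closedForm.energy (f k) ≤ M)
    (hf : Tendsto (fun k => (f k : Lp 𝕜 2 (P.map Y))) atTop (𝓝 f₀)) (g : h.closedForm.domain) :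
    Tendsto (fun k => h.closedForm.form (f k) g) atTop (𝓝 (h.closedForm.form f₀ g)) := by
  set R := √(2 * (M + h.closedForm.energy f₀)) + 1 with hR
  have hR0 : 0 < R := by positivity
  rw [tendsto_iff_norm_sub_tendsto_zero]
  refine Metric.tendsto_atTop.2 fun ε hε => ?_
  -- Replacing `g` by an algebra element makes L² convergence sufficient; the replacement costs at
  -- most `R` times `ε / (2 * R)` by Cauchy–Schwarz.
  obtain ⟨φ, hφ, -⟩ := h.exists_emb_near g (ε := (ε / (2 * R)) ^ 2) (by positivity)
  have h2 : Tendsto (fun k => ‖lpPair _ (A φ) ((f k : Lp 𝕜 2 (P.map Y)) - f₀)‖) atTop (𝓝 0) := by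
    have h3 := ((lpPair _ (A φ)).continuous.tendsto _).comp
      (tendsto_sub_nhds_zero_iff.2 hf)
    simpa using h3.norm
  obtain ⟨N, hN⟩ := eventually_atTop.1 (h2.eventually (gt_mem_nhds (half_pos hε)))
  refine ⟨N, fun k hk => ?_⟩
  rw [Real.dist_eq, sub_zero, abs_norm]
  have e1 : h.closedForm.form (f k) g - h.closedForm.form f₀ g
      = h.closedForm.form (f k - f₀) (g - h.emb φ) - lpPair _ (A φ) ((f k : Lp 𝕜 2 (P.map Y)) - f₀) := by
    have : h.closedForm.form (f k - f₀) (h.emb φ)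
        = - lpPair _ (A φ) ((f k : Lp 𝕜 2 (P.map Y)) - f₀) := by
      rw [h.closedForm.symm, h.closedForm_emb_left]; rfl
    rw [sub_eq_add_neg (h.closedForm.form (f k - f₀) (g - h.emb φ)), ← this]
    simp only [map_sub, LinearMap.sub_apply]
    ring
  have e2 := h.closedForm.norm_form_le (f k - f₀) (g - h.emb φ)
  have e3 : √(h.closedForm.energy (f k - f₀)) ≤ R := by
    have := Real.sqrt_le_sqrt ((h.closedForm.energy_sub_le (f k) f₀).trans
      (show _ ≤ 2 * (M + h.closedForm.energy f₀) by linarith [hM k]))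
    linarith
  have e4 : √(h.closedForm.energy (g - h.emb φ)) ≤ ε / (2 * R) := by
    rw [SymmForm.energy_sub_comm]
    have := Real.sqrt_le_sqrt hφ.le
    rwa [Real.sqrt_sq (by positivity)] at this
  have e5 : √(h.closedForm.energy (f k - f₀)) * √(h.closedForm.energy (g - h.emb φ))
      ≤ R * (ε / (2 * R)) := by gcongr
  have e6 : R * (ε / (2 * R)) = ε / 2 := by field_simp
  rw [e1]
  refine (norm_sub_le _ _).trans_lt ?_
  linarith [hN k hk]

end SymmetricBias

/-! ### The real-valued elements of the algebra and their polynomial calculus. -/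

section RealPart

variable {𝕜 : Type*} [RCLike 𝕜] {E : Type*}

/-- The real algebra of the real-valued elements of a star algebra of functions. -/
def realAlgebra (D : FunctionStarAlgebra 𝕜 E) : Subalgebra ℝ (E → ℝ) where
  carrier := {a | (fun y => (a y : 𝕜)) ∈ D}
  mul_mem' {a b} ha hb := by
    have h : (fun y => (a y : 𝕜)) * (fun y => (b y : 𝕜)) ∈ D := mul_mem ha hb
    change (fun y => ((a y * b y : ℝ) : 𝕜)) ∈ D
    simp only [RCLike.ofReal_mul]
    exact h
  add_mem' {a b} ha hb := by
    have h : (fun y => (a y : 𝕜)) + (fun y => (b y : 𝕜)) ∈ D := add_mem ha hb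
    change (fun y => ((a y + b y : ℝ) : 𝕜)) ∈ D
    simp only [RCLike.ofReal_add]
    exact h
  algebraMap_mem' r := (algebraMap_mem D (r : 𝕜) : algebraMap 𝕜 (E → 𝕜) (r : 𝕜) ∈ D)

variable {D : FunctionStarAlgebra 𝕜 E}

/-- A real-valued element of a star algebra of functions, with values in `𝕜`. -/
def toAlg (a : realAlgebra D) : D := ⟨fun y => (a.1 y : 𝕜), a.2⟩

@[simp] lemma toAlg_apply (a : realAlgebra D) (y : E) :
    (toAlg a).1 y = (a.1 y : 𝕜) := rfl

@[simp] lemma star_toAlg (a : realAlgebra D) : star (toAlg a) = (toAlg a) :=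
  Subtype.ext (funext fun y => RCLike.conj_ofReal (a.1 y))

@[simp] lemma increment_toAlg (a : realAlgebra D) (z : E × E) :
    increment (toAlg a).1 z = ((increment a.1 z : ℝ) : 𝕜) := by
  simp [increment]

lemma toAlg_mul (a b : realAlgebra D) : (toAlg (a * b)) = (toAlg a) * (toAlg b) :=
  Subtype.ext (funext fun y => by
    change ((a.1 y * b.1 y : ℝ) : 𝕜) = (a.1 y : 𝕜) * (b.1 y : 𝕜)
    push_cast; rfl)

/-- The real part of an element of a star algebra of functions. -/
noncomputable def algRealPart (φ : D) : realAlgebra D :=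
  ⟨fun y => RCLike.re (φ.1 y), by
    have h : (2⁻¹ : 𝕜) • (φ.1 + star φ.1) ∈ D := D.smul_mem (add_mem φ.2 (star_mem φ.2)) _
    have h' : (2⁻¹ : 𝕜) • (φ.1 + star φ.1) = fun y => ((RCLike.re (φ.1 y) : ℝ) : 𝕜) := by
      funext y
      simp only [Pi.smul_apply, Pi.add_apply, Pi.star_apply, smul_eq_mul, RCLike.star_def]
      rw [RCLike.add_conj]
      simp
    rw [h'] at h
    exact h⟩

lemma algRealPart_apply (φ : D) (y : E) : (algRealPart φ).1 y = RCLike.re (φ.1 y) := rfl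

lemma toAlg_algRealPart (φ : D) : (toAlg (algRealPart φ)) = (2⁻¹ : 𝕜) • (φ + star φ) := by
  refine Subtype.ext (funext fun y => ?_)
  change ((RCLike.re (φ.1 y) : ℝ) : 𝕜) = (2⁻¹ : 𝕜) * (φ.1 y + starRingEnd 𝕜 (φ.1 y))
  rw [RCLike.add_conj]
  simp

/-- The composition of a polynomial with a real-valued element of the algebra. -/
noncomputable def polyComp (p : Polynomial ℝ) (a : realAlgebra D) : realAlgebra D :=
  Polynomial.aeval a p

@[simp] lemma polyComp_apply (p : Polynomial ℝ) (a : realAlgebra D) (y : E) :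
    (polyComp p a).1 y = p.eval (a.1 y) := by
  have h := Polynomial.aeval_algHom_apply ((Pi.evalAlgHom ℝ (fun _ : E => ℝ) y).comp
    (realAlgebra D).val) a p
  rw [Polynomial.coe_aeval_eq_eval] at h
  exact h.symm

end RealPart

lemma LipschitzWith.realComp {𝕜 : Type*} [RCLike 𝕜] {F : ℝ → ℝ} {K : NNReal}
    (hF : LipschitzWith K F) : LipschitzWith K (fun z : 𝕜 => (F (RCLike.re z) : 𝕜)) := by
  refine LipschitzWith.of_dist_le_mul fun z w => ?_
  rw [dist_eq_norm, ← RCLike.ofReal_sub, RCLike.norm_ofReal, dist_eq_norm]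
  refine (hF.dist_le_mul _ _).trans ?_
  rw [Real.dist_eq, ← map_sub]
  gcongr
  exact RCLike.abs_re_le_norm _

lemma lipschitzWith_clamp (a b : ℝ) : LipschitzWith 1 (fun x : ℝ => min (max x a) b) := by
  simpa using (LipschitzWith.id.max_const a).min_const b

/-- Recombines real and imaginary parts uniformly in `𝕜`. In the real case `I = 0` and conjugation
is trivial, so the first term alone is `f`; otherwise `I * (-I / 2) = 1 / 2`. -/
lemma add_I_smul_eq {𝕜 E : Type*} [RCLike 𝕜] [MeasurableSpace E] {μ : Measure E}
    {f g : Lp 𝕜 2 μ} (hg : g = star f) :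
    (2⁻¹ : 𝕜) • (f + g) + (RCLike.I : 𝕜) • ((-RCLike.I / 2 : 𝕜) • (f - g)) = f := by
  rcases RCLike.I_mul_I_ax (K := 𝕜) with hI | hI
  · have : g = f := by
      rw [hg]
      apply Lp.ext
      filter_upwards [Lp.coeFn_star f] with x hx
      rw [hx, Pi.star_apply, RCLike.star_def, RCLike.conj_eq_iff_real]
      refine ⟨RCLike.re (f x), ?_⟩
      conv_lhs => rw [← RCLike.re_add_im (f x), hI, mul_zero, add_zero]
    rw [this, hI]
    module
  · have : (RCLike.I : 𝕜) * (-RCLike.I / 2 : 𝕜) = 2⁻¹ := by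
      rw [mul_div_assoc', mul_neg, hI]; norm_num
    rw [smul_smul, this]
    module

/-! ### The contraction property and bounded approximations. -/

namespace SymmetricBias

variable {𝕜 : Type*} [RCLike 𝕜] {Ω E : Type*} [MeasurableSpace Ω] [MeasurableSpace E]
  {P : Measure Ω} [IsProbabilityMeasure P] {Y : Ω → E} {Yn : ℕ → Ω → E} {α : ℕ → ℝ}
  {D : FunctionStarAlgebra 𝕜 E} {A : D → Lp 𝕜 2 (P.map Y)}

variable (h : SymmetricBias P Y Yn α D A)

include h

omit [IsProbabilityMeasure P] in
lemma bddMeas_real (a : realAlgebra D) : BddMeas a.1 := by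
  have h1 := h.bddMeas (toAlg a)
  refine ⟨?_, h1.bounded.imp fun C hC y => by simpa using hC y⟩
  have h2 := RCLike.continuous_re.measurable.comp h1.measurable
  have h3 : RCLike.re ∘ (toAlg a).1 = a.1 := funext fun y => by simp
  rwa [h3] at h2

lemma tendsto_form_real (a b : realAlgebra D) :
    Tendsto (fun n => ((2⁻¹ * jumpMean P Y Yn α (fun z => increment a.1 z * increment b.1 z) n : ℝ)
      : 𝕜)) atTop (𝓝 (h.closedForm.form (h.emb (toAlg a)) (h.emb (toAlg b)))) := by
  have h1 := h.tendsto_form_emb (toAlg a) (toAlg b)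
  simp only [increment_toAlg, ← RCLike.ofReal_mul, jumpMean_ofReal] at h1
  simpa only [RCLike.ofReal_mul, RCLike.ofReal_inv, RCLike.ofReal_ofNat] using h1

lemma tendsto_energy_real (a : realAlgebra D) :
    Tendsto (fun n => 2⁻¹ * jumpMean P Y Yn α (fun z => increment a.1 z ^ 2) n) atTop
      (𝓝 (h.closedForm.energy (h.emb (toAlg a)))) := by
  have h1 := (RCLike.continuous_re.tendsto _).comp (h.tendsto_form_real a a)
  rw [SymmForm.energy, h.conj_emb, star_toAlg]
  simpa only [Function.comp_def, RCLike.ofReal_re, sq] using h1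

/-- The source of all contraction estimates: a pointwise comparison of increments is squared,
integrated and passed to the limit. -/
lemma energy_le_of_increment_le {a b : realAlgebra D} {L : ℝ}
    (H : ∀ z, |increment b.1 z| ≤ L * |increment a.1 z|) :
    h.closedForm.energy (h.emb (toAlg b)) ≤ L ^ 2 * h.closedForm.energy (h.emb (toAlg a)) := by
  refine le_of_tendsto_of_tendsto' (h.tendsto_energy_real b)
    ((h.tendsto_energy_real a).const_mul (L ^ 2)) fun n => ?_
  have h1 := h.jumpMean_mono ((h.bddMeas_real b).increment.pow 2)
    ((BddMeas.const (L ^ 2)).mul ((h.bddMeas_real a).increment.pow 2)) (fun z => by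
      rw [← sq_abs, ← sq_abs (increment a.1 z), ← mul_pow]
      exact pow_le_pow_left₀ (abs_nonneg _) (H z) 2) n
  rw [jumpMean_const_mul] at h1
  linarith

lemma emb_realPart (φ : D) : h.emb (toAlg (algRealPart φ))
    = (2⁻¹ : 𝕜) • (h.emb φ + h.closedForm.conj (h.emb φ)) := by
  rw [toAlg_algRealPart, h.conj_emb, map_smul, map_add]

lemma cls_realPart (φ : D) : h.cls (toAlg (algRealPart φ))
    = (2⁻¹ : 𝕜) • (h.cls φ + star (h.cls φ)) := by
  rw [toAlg_algRealPart, h.star_cls, map_smul, map_add]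

lemma norm_cls_realPart_sub_le {f : Lp 𝕜 2 (P.map Y)} (hf : star f = f) (φ : D) :
    ‖h.cls (toAlg (algRealPart φ)) - f‖ ≤ ‖h.cls φ - f‖ := by
  have h1 : h.cls (toAlg (algRealPart φ)) - f
      = (2⁻¹ : 𝕜) • ((h.cls φ - f) + star (h.cls φ - f)) := by
    rw [h.cls_realPart, SymmForm.lp_star_sub, hf]
    module
  rw [h1, norm_smul]
  have h2 := norm_add_le (h.cls φ - f) (star (h.cls φ - f))
  rw [SymmForm.lp_norm_star] at h2
  have h3 : ‖(2⁻¹ : 𝕜)‖ = 2⁻¹ := by simp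
  rw [h3]
  linarith

lemma energy_emb_realPart_sub_le {u : h.closedForm.domain} (hu : star (u : Lp 𝕜 2 (P.map Y)) = u)
    (φ : D) : h.closedForm.energy (h.emb (toAlg (algRealPart φ)) - u)
      ≤ h.closedForm.energy (h.emb φ - u) := by
  have hu' : h.closedForm.conj u = u := Subtype.ext hu
  have h1 : h.emb (toAlg (algRealPart φ)) - u
      = (2⁻¹ : 𝕜) • ((h.emb φ - u) + h.closedForm.conj (h.emb φ - u)) := by
    rw [h.emb_realPart, SymmForm.conj_sub, hu']
    module
  rw [h1, SymmForm.energy_smul]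
  have h2 := h.closedForm.energy_add_le (h.emb φ - u) (h.closedForm.conj (h.emb φ - u))
  rw [SymmForm.energy_conj] at h2
  have h3 : ‖(2⁻¹ : 𝕜)‖ ^ 2 = 4⁻¹ := by simp; norm_num
  rw [h3]
  linarith

lemma exists_seq_real {u : h.closedForm.domain} (hu : star (u : Lp 𝕜 2 (P.map Y)) = u) :
    ∃ a : ℕ → realAlgebra D,
      Tendsto (fun n => h.closedForm.energy (h.emb (toAlg (a n)) - u)) atTop (𝓝 0) ∧
      Tendsto (fun n => h.cls (toAlg (a n))) atTop (𝓝 (u : Lp 𝕜 2 (P.map Y))) := by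
  obtain ⟨φ, hφ⟩ := h.exists_seq_emb u
  refine ⟨fun n => algRealPart (φ n), ?_, ?_⟩
  · exact squeeze_zero (fun n => SymmForm.energy_nonneg _ _)
      (fun n => h.energy_emb_realPart_sub_le hu (φ n)) (h.tendsto_energy_emb_sub hφ)
  · rw [tendsto_iff_norm_sub_tendsto_zero]
    exact squeeze_zero (fun n => norm_nonneg _) (fun n => h.norm_cls_realPart_sub_le hu (φ n))
      (tendsto_iff_norm_sub_tendsto_zero.1 hφ.2)

lemma exists_real_near {f : Lp 𝕜 2 (P.map Y)} (hf : star f = f) {ε : ℝ} (hε : 0 < ε) :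
    ∃ a : realAlgebra D, ‖h.cls (toAlg a) - f‖ < ε := by
  obtain ⟨_, ⟨φ, rfl⟩, hφ⟩ := Metric.mem_closure_iff.1 (h.dense_cls f) ε hε
  rw [dist_comm, dist_eq_norm] at hφ
  exact ⟨algRealPart φ, (h.norm_cls_realPart_sub_le hf φ).trans_lt hφ⟩

omit [IsProbabilityMeasure P] in
lemma exists_bound_real (a : realAlgebra D) : ∃ C, ∀ y, a.1 y ∈ Set.Icc (-C) C := by
  obtain ⟨C, hC⟩ := (h.bddMeas_real a).bounded
  exact ⟨C, fun y => abs_le.1 (hC y)⟩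

-- Since `F ∘ a` need not belong to the algebra, a polynomial in `a` stands in for it; the bound on
-- the derivative over the range of `a` becomes a bound on increments.
omit [IsProbabilityMeasure P] in
lemma exists_comp_near {F : ℝ → ℝ} {K : NNReal} (hF : LipschitzWith K F) (a : realAlgebra D)
    {r : ℝ} (hr : 0 < r) : ∃ b : realAlgebra D, (∀ y, |b.1 y - F (a.1 y)| ≤ r) ∧
      ∀ z, |increment b.1 z| ≤ (K + r) * |increment a.1 z| := by
  obtain ⟨C, hC⟩ := h.exists_bound_real a
  obtain ⟨p, hp⟩ := Polynomial.exists_near_of_lipschitzWith hF C hr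
  refine ⟨polyComp p a, fun y => by simpa using (hp _ (hC y)).1, fun z => ?_⟩
  simp only [increment, polyComp_apply]
  exact Polynomial.abs_eval_sub_le_of_derivative (fun x hx => (hp x hx).2) (hC _) (hC _)

lemma norm_cls_sub_compLp_le {F : ℝ → ℝ} {K : NNReal} (hF : LipschitzWith K F) (F0 : F 0 = 0)
    {a b : realAlgebra D} {r : ℝ} (hr : 0 ≤ r) (hb : ∀ y, |b.1 y - F (a.1 y)| ≤ r)
    (f : Lp 𝕜 2 (P.map Y)) :
    ‖h.cls (toAlg b) - (hF.realComp (𝕜 := 𝕜)).compLp (by simp [F0]) f‖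
      ≤ r + K * ‖h.cls (toAlg a) - f‖ := by
  have := h.isProbabilityMeasure
  set G := (hF.realComp (𝕜 := 𝕜)).compLp (p := 2) (μ := P.map Y) (by simp [F0])
  have h1 : ‖h.cls (toAlg b) - G (h.cls (toAlg a))‖ ≤ r := by
    have := Lp.norm_le_of_ae_bound (f := h.cls (toAlg b) - G (h.cls (toAlg a))) hr (by
      filter_upwards [Lp.coeFn_sub (h.cls (toAlg b)) (G (h.cls (toAlg a))), h.coeFn_cls (toAlg b),
        h.coeFn_cls (toAlg a), (hF.realComp (𝕜 := 𝕜)).coeFn_compLp (p := 2) (μ := P.map Y)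
          (by simp [F0]) (h.cls (toAlg a))] with y h1 h2 h3 h4
      rw [h1, Pi.sub_apply, h2, h4, Function.comp_apply, h3]
      simp only [toAlg_apply, RCLike.ofReal_re]
      rw [← RCLike.ofReal_sub, RCLike.norm_ofReal]
      exact hb y)
    simpa [measureUnivNNReal] using this
  have h2 := (hF.realComp (𝕜 := 𝕜)).norm_compLp_sub_le (p := 2) (μ := P.map Y) (by simp [F0])
    (h.cls (toAlg a)) f
  calc _ ≤ ‖h.cls (toAlg b) - G (h.cls (toAlg a))‖ + ‖G (h.cls (toAlg a)) - G f‖ :=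
        norm_sub_le_norm_sub_add_norm_sub _ _ _
    _ ≤ _ := add_le_add h1 h2

/-- Supplies the competitors for lower semicontinuity: L²-close to `F ∘ u` with almost the
contracted energy. The function `a` is kept because closeness of `b` to `F ∘ a` gives a uniform
bound on `b` when `F` is bounded. -/
lemma exists_real_near_comp {F : ℝ → ℝ} {K : NNReal} (hF : LipschitzWith K F) (F0 : F 0 = 0)
    {u : h.closedForm.domain} (hu : star (u : Lp 𝕜 2 (P.map Y)) = u) {δ r : ℝ} (hδ : 0 < δ)
    (hr : 0 < r) : ∃ a b : realAlgebra D, (∀ y, |b.1 y - F (a.1 y)| ≤ r) ∧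
      ‖h.cls (toAlg b) - (hF.realComp (𝕜 := 𝕜)).compLp (by simp [F0]) (u : Lp 𝕜 2 (P.map Y))‖ ≤ r ∧
      h.closedForm.energy (h.emb (toAlg b)) ≤ (K + δ) ^ 2 * (h.closedForm.energy u + δ) := by
  obtain ⟨a, ha1, ha2⟩ := h.exists_seq_real hu
  have e1 := (SymmForm.tendsto_energy ha1).eventually
    (gt_mem_nhds (show h.closedForm.energy u < h.closedForm.energy u + δ by linarith))
  have e2 := (tendsto_iff_norm_sub_tendsto_zero.1 ha2).eventually
    (gt_mem_nhds (show 0 < r / (2 * (K + 1)) by positivity))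
  obtain ⟨n, hn1, hn2⟩ := (e1.and e2).exists
  obtain ⟨b, hb1, hb2⟩ := h.exists_comp_near hF (a n) (r := min (r / 2) δ) (by positivity)
  refine ⟨a n, b, fun y => (hb1 y).trans ((min_le_left _ _).trans (by linarith)), ?_, ?_⟩
  · refine (h.norm_cls_sub_compLp_le hF F0 (by positivity) hb1 _).trans ?_
    have h1 : (K : ℝ) * ‖h.cls (toAlg (a n)) - u‖ ≤ (K + 1) * (r / (2 * (K + 1))) := by
      gcongr
      linarith
    have h2 : ((K : ℝ) + 1) * (r / (2 * (K + 1))) = r / 2 := by field_simp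
    linarith [min_le_left (r / 2) δ]
  · refine (h.energy_le_of_increment_le hb2).trans ?_
    have := h.closedForm.energy_nonneg (h.emb (toAlg (a n)))
    gcongr
    exact min_le_right _ _

/-- Lipschitz functions that vanish at `0` operate on the real elements of the domain. -/
lemma compLp_mem {F : ℝ → ℝ} {K : NNReal} (hF : LipschitzWith K F) (F0 : F 0 = 0)
    {u : h.closedForm.domain} (hu : star (u : Lp 𝕜 2 (P.map Y)) = u) :
    ∃ hm : (hF.realComp (𝕜 := 𝕜)).compLp (by simp [F0]) (u : Lp 𝕜 2 (P.map Y))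
        ∈ h.closedForm.domain,
      h.closedForm.energy ⟨_, hm⟩ ≤ K ^ 2 * h.closedForm.energy u := by
  -- The element `F ∘ u` does not depend on `δ`, so its energy bound can be improved afterwards by
  -- letting `δ → 0`.
  have key : ∀ δ > 0, ∃ hm : (hF.realComp (𝕜 := 𝕜)).compLp (by simp [F0]) (u : Lp 𝕜 2 (P.map Y))
        ∈ h.closedForm.domain,
      h.closedForm.energy ⟨_, hm⟩ ≤ (K + δ) ^ 2 * (h.closedForm.energy u + δ) := fun δ hδ =>
    h.closedForm_closed.exists_energy_le _ _ fun r hr => by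
      obtain ⟨a, b, -, h2, h3⟩ := h.exists_real_near_comp hF F0 hu hδ hr
      exact ⟨h.emb (toAlg b), h2, h3⟩
  obtain ⟨hm, -⟩ := key 1 one_pos
  refine ⟨hm, ?_⟩
  have hlim : Tendsto (fun δ : ℝ => (K + δ) ^ 2 * (h.closedForm.energy u + δ)) (𝓝[>] 0)
      (𝓝 (K ^ 2 * h.closedForm.energy u)) := by
    have : Continuous fun δ : ℝ => (K + δ) ^ 2 * (h.closedForm.energy u + δ) := by fun_prop
    simpa using (this.tendsto 0).mono_left nhdsWithin_le_nhds
  refine ge_of_tendsto hlim ?_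
  filter_upwards [self_mem_nhdsWithin] with δ hδ
  exact (key δ hδ).2

lemma closedForm_dense : Dense (h.closedForm.domain : Set (Lp 𝕜 2 (P.map Y))) :=
  h.dense_cls.mono (SymmForm.domain_le_closure h.form_closable)

lemma closedForm_isDirichletForm : h.closedForm.IsDirichletForm := by
  refine ⟨h.closedForm_dense, h.closedForm_closed, fun u hu => ?_⟩
  obtain ⟨hm, hle⟩ := h.compLp_mem (lipschitzWith_clamp 0 1) (by norm_num) hu
  refine ⟨⟨_, hm⟩, ?_, by simpa using hle⟩
  exact (lipschitzWith_clamp 0 1).realComp.coeFn_compLp (by simp) (u : Lp 𝕜 2 (P.map Y))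

/-- Bounded real elements of the domain have uniformly bounded approximations. -/
lemma exists_bounded_seq_real {u : h.closedForm.domain}
    (hu : star (u : Lp 𝕜 2 (P.map Y)) = u) {C : ℝ} (hC : 0 ≤ C)
    (huC : ∀ᵐ x ∂P.map Y, ‖(u : Lp 𝕜 2 (P.map Y)) x‖ ≤ C) :
    ∃ a : ℕ → realAlgebra D, (∀ n y, |(a n).1 y| ≤ C + 1) ∧
      SymmForm.Approximates (fun n => h.toDomain (toAlg (a n))) (u : Lp 𝕜 2 (P.map Y)) := by
  have hF := lipschitzWith_clamp (-C) C
  have F0 : min (max (0 : ℝ) (-C)) C = 0 := by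
    rw [max_eq_left (by linarith), min_eq_left hC]
  -- Truncation at `±C` leaves `u` unchanged, so the truncated approximations still tend to `u`.
  have hFu : (hF.realComp (𝕜 := 𝕜)).compLp (by simp [F0]) (u : Lp 𝕜 2 (P.map Y)) = u := by
    apply Lp.ext
    filter_upwards [(hF.realComp (𝕜 := 𝕜)).coeFn_compLp (p := 2) (μ := P.map Y) (by simp [F0])
      (u : Lp 𝕜 2 (P.map Y)), huC, Lp.coeFn_star (u : Lp 𝕜 2 (P.map Y))] with x h1 h2 h3
    rw [h1, Function.comp_apply]
    rw [hu, Pi.star_apply, RCLike.star_def] at h3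
    have h4 := RCLike.conj_eq_iff_re.1 h3.symm
    have h5 := abs_le.1 ((RCLike.abs_re_le_norm _).trans h2)
    rw [max_eq_left h5.1, min_eq_left h5.2, h4]
  -- The functions bounded by `C + 1` form a midpoint-convex set; bounded energies can thus be
  -- upgraded to an energy-Cauchy sequence without losing the uniform bound.
  obtain ⟨v, hvK, hv⟩ := SymmForm.exists_approximates_of_bounded (S := h.form)
    {v | ∃ a : realAlgebra D, (∀ y, |a.1 y| ≤ C + 1) ∧ v = h.toDomain (toAlg a)} (by
      rintro _ ⟨a, ha, rfl⟩ _ ⟨b, hb, rfl⟩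
      refine ⟨(1 / 2 : ℝ) • (a + b), fun y => ?_, ?_⟩
      · change |(1 / 2 : ℝ) * (a.1 y + b.1 y)| ≤ C + 1
        rw [abs_mul, abs_of_pos (by norm_num : (0 : ℝ) < 1 / 2)]
        linarith [abs_add_le (a.1 y) (b.1 y), ha y, hb y]
      · rw [← map_add, ← map_smul]
        congr 1
        refine Subtype.ext (funext fun y => ?_)
        change (1 / 2 : 𝕜) * ((a.1 y : 𝕜) + (b.1 y : 𝕜)) = (((1 / 2 : ℝ) * (a.1 y + b.1 y) : ℝ) : 𝕜)
        push_cast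
        norm_num) (u : Lp 𝕜 2 (P.map Y)) ((1 + 1) ^ 2 * (h.closedForm.energy u + 1))
    (fun r hr => by
      obtain ⟨a, b, h1, h2, h3⟩ := h.exists_real_near_comp hF F0 hu one_pos
        (r := min r 1) (by positivity)
      refine ⟨h.toDomain (toAlg b), ⟨b, fun y => ?_, rfl⟩, ?_, ?_⟩
      · have h4 := h1 y
        have h5 : |min (max (a.1 y) (-C)) C| ≤ C :=
          abs_le.2 ⟨le_min (le_max_right _ _) (by linarith), min_le_right _ _⟩
        have h6 := abs_sub_abs_le_abs_sub (b.1 y) (min (max (a.1 y) (-C)) C)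
        linarith [min_le_right r 1]
      · rw [hFu] at h2
        exact h2.trans (min_le_left _ _)
      · rw [h.energy_toDomain]
        simpa using h3)
  choose a ha1 ha2 using hvK
  exact ⟨a, ha1, by simpa only [← ha2] using hv⟩

/-- Bounded elements of the domain have uniformly bounded approximations. -/
lemma exists_bounded_seq {u : h.closedForm.domain} (hu : h.closedForm.IsBdd u) :
    ∃ (φ : ℕ → D) (C : ℝ), (∀ n y, ‖(φ n).1 y‖ ≤ C) ∧
      SymmForm.Approximates (fun n => h.toDomain (φ n)) (u : Lp 𝕜 2 (P.map Y)) := by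
  obtain ⟨C₀, hC₀⟩ := hu
  set C := |C₀|
  have hC : ∀ᵐ x ∂P.map Y, ‖(u : Lp 𝕜 2 (P.map Y)) x‖ ≤ C :=
    hC₀.mono fun x hx => hx.trans (le_abs_self _)
  set ub := h.closedForm.conj u
  have hub : ∀ᵐ x ∂P.map Y, ‖(ub : Lp 𝕜 2 (P.map Y)) x‖ ≤ C := by
    filter_upwards [hC, Lp.coeFn_star (u : Lp 𝕜 2 (P.map Y))] with x h1 h2
    rw [SymmForm.coe_conj, h2]
    simpa using h1
  have hI1 : ‖(RCLike.I : 𝕜)‖ ≤ 1 := by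
    rcases RCLike.I_mul_I_ax (K := 𝕜) with hI | hI
    · simp [hI]
    · exact (RCLike.norm_I_of_ne_zero fun h0 => by simp [h0] at hI).le
  have hbd : ∀ (c c' : 𝕜), ‖c‖ ≤ 1 → ‖c'‖ ≤ 1 → ∀ᵐ x ∂P.map Y,
      ‖((c • u + c' • ub : h.closedForm.domain) : Lp 𝕜 2 (P.map Y)) x‖ ≤ 2 * C := by
    intro c c' hc hc'
    filter_upwards [hC, hub, Lp.coeFn_add (c • (u : Lp 𝕜 2 (P.map Y))) (c' • (ub : Lp 𝕜 2 (P.map Y))),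
      Lp.coeFn_smul c (u : Lp 𝕜 2 (P.map Y)), Lp.coeFn_smul c' (ub : Lp 𝕜 2 (P.map Y))]
      with x h1 h2 h3 h4 h5
    rw [Submodule.coe_add, Submodule.coe_smul, Submodule.coe_smul, h3, Pi.add_apply, h4, h5,
      Pi.smul_apply, Pi.smul_apply]
    refine (norm_add_le _ _).trans ?_
    rw [norm_smul, norm_smul]
    nlinarith [norm_nonneg ((u : Lp 𝕜 2 (P.map Y)) x), norm_nonneg ((ub : Lp 𝕜 2 (P.map Y)) x)]
  have hn2 : ‖(2⁻¹ : 𝕜)‖ ≤ 1 := by simp; norm_num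
  have hnI : ‖(-RCLike.I / 2 : 𝕜)‖ ≤ 1 := by
    rw [norm_div, norm_neg]; simp only [RCLike.norm_ofNat]; linarith
  -- The real and imaginary parts of `u` are approximated separately, then recombined by
  -- `add_I_smul_eq`.
  obtain ⟨a, ha1, ha2⟩ := h.exists_bounded_seq_real (u := (2⁻¹ : 𝕜) • u + (2⁻¹ : 𝕜) • ub)
    (by
      have : h.closedForm.conj ((2⁻¹ : 𝕜) • u + (2⁻¹ : 𝕜) • ub) = (2⁻¹ : 𝕜) • u + (2⁻¹ : 𝕜) • ub := by
        rw [SymmForm.conj_add, SymmForm.conj_smul, SymmForm.conj_smul, SymmForm.conj_conj, add_comm]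
        simp [ub]
      exact congrArg Subtype.val this) (C := 2 * C) (by positivity) (hbd _ _ hn2 hn2)
  obtain ⟨b, hb1, hb2⟩ := h.exists_bounded_seq_real
    (u := (-RCLike.I / 2 : 𝕜) • u + (-(-RCLike.I / 2) : 𝕜) • ub)
    (by
      have : h.closedForm.conj ((-RCLike.I / 2 : 𝕜) • u + (-(-RCLike.I / 2) : 𝕜) • ub)
          = (-RCLike.I / 2 : 𝕜) • u + (-(-RCLike.I / 2) : 𝕜) • ub := by
        rw [SymmForm.conj_add, SymmForm.conj_smul, SymmForm.conj_smul, SymmForm.conj_conj, add_comm]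
        simp [ub, neg_div]
      exact congrArg Subtype.val this) (C := 2 * C) (by positivity)
      (hbd _ _ hnI (by rwa [norm_neg]))
  refine ⟨fun n => (toAlg (a n)) + (RCLike.I : 𝕜) • (toAlg (b n)), (2 * C + 1) + (2 * C + 1),
    fun n y => ?_, ?_⟩
  · change ‖((a n).1 y : 𝕜) + RCLike.I * ((b n).1 y : 𝕜)‖ ≤ _
    refine (norm_add_le _ _).trans (add_le_add ?_ ?_)
    · rw [RCLike.norm_ofReal]; exact ha1 n y
    · rw [norm_mul, RCLike.norm_ofReal]
      nlinarith [hb1 n y, abs_nonneg ((b n).1 y), norm_nonneg (RCLike.I : 𝕜)]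
  · have h1 := ha2.add (hb2.smul (RCLike.I : 𝕜))
    simp only [← map_smul, ← map_add] at h1
    convert h1 using 1
    rw [← add_I_smul_eq (f := (u : Lp 𝕜 2 (P.map Y))) (g := (ub : Lp 𝕜 2 (P.map Y))) rfl]
    simp only [Submodule.coe_add, Submodule.coe_smul]
    module

lemma exists_subseq_ae {φ : ℕ → D} {f : Lp 𝕜 2 (P.map Y)}
    (hφ : Tendsto (fun n => h.cls (φ n)) atTop (𝓝 f)) :
    ∃ ns : ℕ → ℕ, StrictMono ns ∧
      ∀ᵐ y ∂P.map Y, Tendsto (fun k => (φ (ns k)).1 y) atTop (𝓝 (f y)) := by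
  obtain ⟨ns, hns, hae⟩ := (tendstoInMeasure_of_tendsto_Lp hφ).exists_seq_tendsto_ae
  refine ⟨ns, hns, ?_⟩
  filter_upwards [hae, ae_all_iff.2 fun n => h.coeFn_cls (φ n)] with y h1 h2
  simpa only [h2] using h1

end SymmetricBias

/-! ### Limits of integrals and L¹ norm estimates. -/

section Limits

variable {𝕜 : Type*} [RCLike 𝕜] {E : Type*} [MeasurableSpace E] {μ : Measure E}

/-- Replacing `G k` by `G₀` costs at most `C ‖G k - G₀‖`, after which dominated convergence applies.
-/
lemma tendsto_integral_mul {G : ℕ → Lp 𝕜 1 μ} {G₀ : Lp 𝕜 1 μ} (hG : Tendsto G atTop (𝓝 G₀))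
    {b : ℕ → E → 𝕜} {b₀ : E → 𝕜} {C : ℝ} (hm : ∀ k, AEStronglyMeasurable (b k) μ)
    (hb : ∀ k, ∀ᵐ x ∂μ, ‖b k x‖ ≤ C) (hlim : ∀ᵐ x ∂μ, Tendsto (fun k => b k x) atTop (𝓝 (b₀ x))) :
    Tendsto (fun k => ∫ x, b k x * G k x ∂μ) atTop (𝓝 (∫ x, b₀ x * G₀ x ∂μ)) := by
  have hi : ∀ (k : ℕ) (H : Lp 𝕜 1 μ), Integrable (fun x => b k x * H x) μ := fun k H =>
    (L1.integrable_coeFn H).bdd_mul (hm k) (hb k)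
  have h1 : Tendsto (fun k => ∫ x, b k x * G₀ x ∂μ) atTop (𝓝 (∫ x, b₀ x * G₀ x ∂μ)) := by
    refine tendsto_integral_of_dominated_convergence (fun x => C * ‖G₀ x‖)
      (fun k => (hi k G₀).aestronglyMeasurable) ((L1.integrable_coeFn G₀).norm.const_mul C) ?_ ?_
    · intro k
      filter_upwards [hb k] with x hx
      rw [norm_mul]
      gcongr
    · filter_upwards [hlim] with x hx
      exact hx.mul_const _
  have h2 : Tendsto (fun k => ∫ x, b k x * G k x ∂μ - ∫ x, b k x * G₀ x ∂μ) atTop (𝓝 0) := by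
    have h3 : Tendsto (fun k => C * ‖G k - G₀‖) atTop (𝓝 0) := by
      simpa using (tendsto_iff_norm_sub_tendsto_zero.1 hG).const_mul C
    refine squeeze_zero_norm (fun k => ?_) h3
    rw [← integral_sub (hi k _) (hi k _), L1.norm_eq_integral_norm, ← integral_const_mul]
    refine norm_integral_le_of_norm_le ((L1.integrable_coeFn _).norm.const_mul C) ?_
    filter_upwards [hb k, Lp.coeFn_sub (G k) G₀] with x hx hs
    rw [hs, Pi.sub_apply, ← mul_sub, norm_mul]
    gcongr
  simpa using h2.add h1

/-- The factor `4` counts the positive and negative parts of the real and imaginary parts, each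
integrated over the set where it lives. -/
lemma norm_le_of_forall_setIntegral_le (G : Lp 𝕜 1 μ) {K : ℝ}
    (hK : ∀ s, MeasurableSet s → ‖∫ x in s, G x ∂μ‖ ≤ K) : ‖G‖ ≤ 4 * K := by
  have hG := L1.integrable_coeFn G
  have key : ∀ f : E → ℝ, Integrable f μ → StronglyMeasurable f →
      (∀ s, MeasurableSet s → |∫ x in s, f x ∂μ| ≤ K) → ∫ x, ‖f x‖ ∂μ ≤ 2 * K := by
    intro f hf hfm h
    rw [integral_norm_eq_pos_sub_neg hf]
    have h1 := abs_le.1 (h {x | 0 ≤ f x} (hfm.measurable measurableSet_Ici))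
    have h2 := abs_le.1 (h {x | f x ≤ 0} (hfm.measurable measurableSet_Iic))
    linarith [h1.2, h2.1]
  have hm := (Lp.stronglyMeasurable G)
  have h1 := key (fun x => RCLike.re (G x)) hG.re
    (RCLike.continuous_re.comp_stronglyMeasurable hm) fun s hs => by
      have : ∫ x in s, RCLike.re (G x) ∂μ = RCLike.re (∫ x in s, G x ∂μ) :=
        integral_re hG.integrableOn
      rw [this]
      exact (RCLike.abs_re_le_norm _).trans (hK s hs)
  have h2 := key (fun x => RCLike.im (G x)) hG.im
    (RCLike.continuous_im.comp_stronglyMeasurable hm) fun s hs => by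
      have : ∫ x in s, RCLike.im (G x) ∂μ = RCLike.im (∫ x in s, G x ∂μ) :=
        integral_im hG.integrableOn
      rw [this]
      exact (RCLike.abs_im_le_norm _).trans (hK s hs)
  rw [L1.norm_eq_integral_norm]
  have h3 : ∫ x, ‖G x‖ ∂μ ≤ ∫ x, (‖RCLike.re (G x)‖ + ‖RCLike.im (G x)‖) ∂μ := by
    refine integral_mono hG.norm (hG.re.norm.add hG.im.norm) fun x => ?_
    change ‖G x‖ ≤ ‖RCLike.re (G x)‖ + ‖RCLike.im (G x)‖
    conv_lhs => rw [← RCLike.re_add_im (G x)]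
    refine (norm_add_le _ _).trans ?_
    rw [norm_mul, RCLike.norm_ofReal, RCLike.norm_ofReal, Real.norm_eq_abs, Real.norm_eq_abs]
    have : ‖(RCLike.I : 𝕜)‖ ≤ 1 := by rw [RCLike.norm_I]; split_ifs <;> norm_num
    nlinarith [abs_nonneg (RCLike.im (G x))]
  rw [integral_add hG.re.norm hG.im.norm] at h3
  linarith

/-- The optimal choice is `t² = b / a`; both numbers are shifted by `δ > 0` to allow zeros, and then
`δ → 0`. -/
lemma le_two_mul_of_forall_scaling {x a b c : ℝ} (ha : 0 ≤ a) (hb : 0 ≤ b) (hc : 0 ≤ c)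
    (h : ∀ t > 0, x ≤ c * (t ^ 2 * a ^ 2 + t⁻¹ ^ 2 * b ^ 2)) : x ≤ 2 * c * a * b := by
  have key : ∀ δ > 0, x ≤ 2 * c * (a + δ) * (b + δ) := by
    intro δ hδ
    have hq : 0 < (b + δ) / (a + δ) := by positivity
    have h1 := h (√((b + δ) / (a + δ))) (Real.sqrt_pos.2 hq)
    rw [inv_pow, Real.sq_sqrt hq.le] at h1
    have h2 : (b + δ) / (a + δ) * (a + δ) ^ 2 + ((b + δ) / (a + δ))⁻¹ * (b + δ) ^ 2
        = 2 * ((a + δ) * (b + δ)) := by field_simp; ring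
    have h3 : (b + δ) / (a + δ) * a ^ 2 + ((b + δ) / (a + δ))⁻¹ * b ^ 2
        ≤ (b + δ) / (a + δ) * (a + δ) ^ 2 + ((b + δ) / (a + δ))⁻¹ * (b + δ) ^ 2 := by
      gcongr <;> linarith
    calc x ≤ _ := h1
      _ ≤ c * (2 * ((a + δ) * (b + δ))) := by rw [← h2]; gcongr
      _ = _ := by ring
  have hlim : Tendsto (fun δ : ℝ => 2 * c * (a + δ) * (b + δ)) (𝓝[>] 0) (𝓝 (2 * c * a * b)) := by
    have : Continuous fun δ : ℝ => 2 * c * (a + δ) * (b + δ) := by fun_prop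
    simpa using (this.tendsto 0).mono_left nhdsWithin_le_nhds
  refine ge_of_tendsto hlim ?_
  filter_upwards [self_mem_nhdsWithin] with δ hδ
  exact key δ hδ

lemma exists_lp_mul (f : Lp 𝕜 2 μ) {b : E → 𝕜} (hbm : AEStronglyMeasurable b μ) {C : ℝ}
    (hb : ∀ᵐ x ∂μ, ‖b x‖ ≤ C) : ∃ g : Lp 𝕜 2 μ, g =ᵐ[μ] fun x => b x * f x := by
  have hf := Lp.memLp f
  have : MemLp (fun x => b x * f x) 2 μ := by
    refine hf.of_le_mul (c := C) (hbm.mul hf.aestronglyMeasurable) ?_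
    filter_upwards [hb] with x hx
    rw [norm_mul]
    gcongr
  exact ⟨this.toLp, this.coeFn_toLp⟩

end Limits

namespace SymmForm

lemma Approximates.comp {𝕜 : Type*} [RCLike 𝕜] {E : Type*} [MeasurableSpace E] {μ : Measure E}
    {S : SymmForm 𝕜 μ} {u : ℕ → S.domain} {f : Lp 𝕜 2 μ} (hu : Approximates u f) {ns : ℕ → ℕ}
    (hns : StrictMono ns) : Approximates (fun n => u (ns n)) f := by
  refine ⟨fun ε hε => ?_, hu.2.comp hns.tendsto_atTop⟩
  obtain ⟨N, hN⟩ := hu.1 ε hε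
  exact ⟨N, fun m hm n hn => hN _ (hm.le.trans (hns.le_apply)) _ (hn.le.trans hns.le_apply)⟩

end SymmForm

/-! ### The square field operator. -/

namespace SymmetricBias

variable {𝕜 : Type*} [RCLike 𝕜] {Ω E : Type*} [MeasurableSpace Ω] [MeasurableSpace E]
  {P : Measure Ω} [IsProbabilityMeasure P] {Y : Ω → E} {Yn : ℕ → Ω → E} {α : ℕ → ℝ}
  {D : FunctionStarAlgebra 𝕜 E} {A : D → Lp 𝕜 2 (P.map Y)}

variable (h : SymmetricBias P Y Yn α D A)

include h

/-- A polynomial approximation of the clamp to `[0, 1]` may be off by `r`. Adding `r` restores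
nonnegativity, and the upper bound becomes `1 + 2 r ≤ 2`. -/
lemma exists_unit_near {f : Lp 𝕜 2 (P.map Y)} {g : E → ℝ}
    (hfg : f =ᵐ[P.map Y] fun x => (g x : 𝕜)) (hg : ∀ x, g x ∈ Set.Icc 0 1) {ε : ℝ} (hε : 0 < ε) :
    ∃ a : realAlgebra D, (∀ y, 0 ≤ a.1 y ∧ a.1 y ≤ 2) ∧ ‖h.cls (toAlg a) - f‖ ≤ ε := by
  have hstar : star f = f := by
    apply Lp.ext
    filter_upwards [Lp.coeFn_star f, hfg] with x h1 h2
    rw [h1, Pi.star_apply, h2, RCLike.star_def, RCLike.conj_ofReal]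
  obtain ⟨a, ha⟩ := h.exists_real_near hstar (half_pos hε)
  obtain ⟨b, hb, -⟩ := h.exists_comp_near (lipschitzWith_clamp 0 1) a
    (r := min (ε / 4) (1 / 2)) (by positivity)
  set r := min (ε / 4) (1 / 2)
  have hr0 : 0 < r := by positivity
  have hr1 : r ≤ ε / 4 := min_le_left _ _
  have hr2 : r ≤ 1 / 2 := min_le_right _ _
  refine ⟨b + algebraMap ℝ _ r, fun y => ?_, ?_⟩
  · change 0 ≤ b.1 y + r ∧ b.1 y + r ≤ 2
    have h1 := abs_le.1 (hb y)
    have h2 : 0 ≤ min (max (a.1 y) 0) 1 := le_min (le_max_right _ _) zero_le_one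
    have h3 : min (max (a.1 y) 0) 1 ≤ 1 := min_le_right _ _
    constructor <;> linarith
  · have h1 := h.norm_cls_sub_compLp_le (lipschitzWith_clamp 0 1) (by simp) (r := 2 * r)
      (by positivity) (a := a) (b := b + algebraMap ℝ _ r) (fun y => by
        change |b.1 y + r - min (max (a.1 y) 0) 1| ≤ 2 * r
        have h1 := abs_le.1 (hb y)
        rw [abs_le]
        constructor <;> linarith) f
    have h2 : (lipschitzWith_clamp 0 1).realComp.compLp (by simp) f = f := by
      apply Lp.ext
      filter_upwards [((lipschitzWith_clamp 0 1).realComp (𝕜 := 𝕜)).coeFn_compLp (by simp) f, hfg]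
        with x h1 h2
      rw [h1, Function.comp_apply, h2, RCLike.ofReal_re, max_eq_left (hg x).1,
        min_eq_left (hg x).2]
    rw [h2] at h1
    simp only [NNReal.coe_one, one_mul] at h1
    linarith

lemma exists_unit_seq {s : Set E} (hs : MeasurableSet s) :
    ∃ a : ℕ → realAlgebra D, (∀ n y, 0 ≤ (a n).1 y ∧ (a n).1 y ≤ 2) ∧
      ∀ᵐ y ∂P.map Y, Tendsto (fun n => (((a n).1 y : ℝ) : 𝕜)) atTop (𝓝 (s.indicator 1 y)) := by
  have := h.isProbabilityMeasure
  have hind : BddMeas (s.indicator (1 : E → ℝ)) :=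
    ⟨measurable_one.indicator hs, 1, fun x => by
      by_cases hx : x ∈ s <;> simp [hx]⟩
  have hm := (hind.ofReal (𝕂 := 𝕜)).memLp (μ := P.map Y) 2
  have hex := fun n : ℕ => h.exists_unit_near hm.coeFn_toLp (fun x => by
    by_cases hx : x ∈ s <;> simp [hx]) (ε := 1 / ((n : ℝ) + 1)) (by positivity)
  choose a ha1 ha2 using hex
  have hlim : Tendsto (fun n => h.cls (toAlg (a n))) atTop (𝓝 hm.toLp) := by
    rw [tendsto_iff_norm_sub_tendsto_zero]
    exact squeeze_zero (fun n => norm_nonneg _) ha2 tendsto_one_div_add_atTop_nhds_zero_nat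
  obtain ⟨ns, -, hns⟩ := h.exists_subseq_ae hlim
  refine ⟨fun k => a (ns k), fun n y => ha1 _ y, ?_⟩
  filter_upwards [hns, hm.coeFn_toLp] with y h1 h2
  rw [h2] at h1
  have e : s.indicator (1 : E → 𝕜) y = ((s.indicator (1 : E → ℝ) y : ℝ) : 𝕜) := by
    by_cases hy : y ∈ s <;> simp [hy]
  rw [e]
  exact h1

/-- Lets nonnegative test functions from the algebra, bounded by `2`, replace indicators: signs and
L¹ norms can then be read off from integrals against the algebra. -/
lemma exists_tendsto_setIntegral (G : Lp 𝕜 1 (P.map Y)) {s : Set E} (hs : MeasurableSet s) :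
    ∃ a : ℕ → realAlgebra D, (∀ n y, 0 ≤ (a n).1 y ∧ (a n).1 y ≤ 2) ∧
      Tendsto (fun n => ∫ y, (toAlg (a n)).1 y * G y ∂P.map Y) atTop
        (𝓝 (∫ y in s, G y ∂P.map Y)) := by
  obtain ⟨a, ha1, ha2⟩ := h.exists_unit_seq hs
  refine ⟨a, ha1, ?_⟩
  have h1 := tendsto_integral_mul (tendsto_const_nhds (x := G)) (b := fun n => (toAlg (a n)).1)
    (C := 2) (fun n => (h.bddMeas _).measurable.aestronglyMeasurable)
    (fun n => .of_forall fun y => by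
      rw [toAlg_apply, RCLike.norm_ofReal, abs_of_nonneg (ha1 n y).1]
      exact (ha1 n y).2) ha2
  convert h1 using 2
  rw [← integral_indicator hs]
  congr 1
  funext y
  by_cases hy : y ∈ s <;> simp [hy]

lemma re_nonneg_of_forall_integral {G : Lp 𝕜 1 (P.map Y)}
    (hG : ∀ a : realAlgebra D, (∀ y, 0 ≤ a.1 y) →
      0 ≤ RCLike.re (∫ y, (toAlg a).1 y * G y ∂P.map Y)) :
    ∀ᵐ y ∂P.map Y, 0 ≤ RCLike.re (G y) := by
  have hi := L1.integrable_coeFn G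
  refine ae_nonneg_of_forall_setIntegral_nonneg hi.re fun s hs _ => ?_
  have h1 : ∫ y in s, RCLike.re (G y) ∂P.map Y = RCLike.re (∫ y in s, G y ∂P.map Y) :=
    integral_re hi.integrableOn
  rw [h1]
  obtain ⟨a, ha1, ha2⟩ := h.exists_tendsto_setIntegral G hs
  exact ge_of_tendsto' ((RCLike.continuous_re.tendsto _).comp ha2) fun n =>
    hG _ fun y => (ha1 n y).1

lemma norm_le_of_forall_integral {G : Lp 𝕜 1 (P.map Y)} {K : ℝ}
    (hG : ∀ a : realAlgebra D, (∀ y, 0 ≤ a.1 y ∧ a.1 y ≤ 2) →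
      ‖∫ y, (toAlg a).1 y * G y ∂P.map Y‖ ≤ K) : ‖G‖ ≤ 4 * K := by
  refine norm_le_of_forall_setIntegral_le G fun s hs => ?_
  obtain ⟨a, ha1, ha2⟩ := h.exists_tendsto_setIntegral G hs
  exact le_of_tendsto' ha2.norm fun n => hG _ (ha1 n)

lemma tendsto_energy_emb (φ : D) :
    Tendsto (fun n => 2⁻¹ * jumpMean P Y Yn α (fun z => ‖increment φ.1 z‖ ^ 2) n) atTop
      (𝓝 (h.closedForm.energy (h.emb φ))) := by
  have h1 := (RCLike.continuous_re.tendsto _).comp (h.tendsto_form_emb φ (star φ))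
  rw [SymmForm.energy, h.conj_emb]
  convert h1 using 2 with n
  have h3 : (fun z => increment φ.1 z * increment (star φ).1 z)
      = fun z => ((‖increment φ.1 z‖ ^ 2 : ℝ) : 𝕜) := by
    funext z
    have : increment (star φ).1 z = star (increment φ.1 z) := by
      simp [increment]
    rw [this, ← starRingEnd_apply, RCLike.mul_conj]
    norm_cast
  have h5 : (2⁻¹ : 𝕜) = ((2⁻¹ : ℝ) : 𝕜) := by rw [RCLike.ofReal_inv, RCLike.ofReal_ofNat]
  rw [Function.comp_apply, h3, jumpMean_ofReal, h5, ← RCLike.ofReal_mul, RCLike.ofReal_re]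

/-- The square field operator on the algebra. -/
noncomputable def sqFieldAlg : D →ₗ[𝕜] D →ₗ[𝕜] Lp 𝕜 1 (P.map Y) :=
  -- Multiplication by the class of `1` moves `A (φ * ψ)` from L² to L¹.
  LinearMap.mk₂ 𝕜 (fun φ ψ => lpMul _ (h.cls 1) (h.biasₗ (φ * ψ)) - lpMul _ (h.cls φ) (h.biasₗ ψ)
      - lpMul _ (h.cls ψ) (h.biasₗ φ))
    (fun φ φ' ψ => by
      rw [add_mul]
      simp only [map_add, _root_.add_apply]
      abel)
    (fun c φ ψ => by
      rw [smul_mul_assoc]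
      simp only [map_smul, _root_.smul_apply, smul_sub])
    (fun φ ψ ψ' => by
      rw [mul_add]
      simp only [map_add, _root_.add_apply]
      abel)
    (fun c φ ψ => by
      rw [mul_smul_comm]
      simp only [map_smul, _root_.smul_apply, smul_sub])

lemma sqFieldAlg_apply (φ ψ : D) : h.sqFieldAlg φ ψ = lpMul _ (h.cls 1) (A (φ * ψ))
    - lpMul _ (h.cls φ) (A ψ) - lpMul _ (h.cls ψ) (A φ) := rfl

lemma coeFn_sqFieldAlg (φ ψ : D) : h.sqFieldAlg φ ψ =ᵐ[P.map Y]
    fun y => A (φ * ψ) y - φ.1 y * A ψ y - ψ.1 y * A φ y := by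
  rw [sqFieldAlg_apply]
  filter_upwards [Lp.coeFn_sub (lpMul _ (h.cls 1) (A (φ * ψ)) - lpMul _ (h.cls φ) (A ψ))
      (lpMul _ (h.cls ψ) (A φ)), Lp.coeFn_sub (lpMul _ (h.cls 1) (A (φ * ψ)))
      (lpMul _ (h.cls φ) (A ψ)), coeFn_lpMul (h.cls 1) (A (φ * ψ)), coeFn_lpMul (h.cls φ) (A ψ),
    coeFn_lpMul (h.cls ψ) (A φ), h.coeFn_cls 1, h.coeFn_cls φ, h.coeFn_cls ψ]
    with y h1 h2 h3 h4 h5 h6 h7 h8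
  rw [h1, Pi.sub_apply, h2, Pi.sub_apply, h3, h4, h5, h6, h7, h8]
  have : (1 : D).1 y = 1 := rfl
  rw [this, one_mul]

lemma integral_mul_sqFieldAlg (φ ψ χ : D) :
    ∫ y, χ.1 y * h.sqFieldAlg φ ψ y ∂P.map Y = lpPair _ (A (φ * ψ)) (h.cls χ)
      - lpPair _ (A ψ) (h.cls (φ * χ)) - lpPair _ (A φ) (h.cls (ψ * χ)) := by
  have hi : ∀ f g : Lp 𝕜 2 (P.map Y), Integrable (fun y => f y * g y) (P.map Y) := fun f g =>
    (L1.integrable_coeFn (lpMul _ f g)).congr (coeFn_lpMul f g)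
  have hi' : Integrable (fun y => A (φ * ψ) y * h.cls χ y - A ψ y * h.cls (φ * χ) y) (P.map Y) :=
    (hi _ _).sub (hi _ _)
  simp only [lpPair_eq_integral]
  rw [← integral_sub (hi _ _) (hi _ _), ← integral_sub hi' (hi _ _)]
  refine integral_congr_ae ?_
  filter_upwards [h.coeFn_sqFieldAlg φ ψ, h.coeFn_cls χ, h.coeFn_cls (φ * χ), h.coeFn_cls (ψ * χ)]
    with y h1 h2 h3 h4
  rw [h1, h2, h3, h4]
  change _ = _ - _ * (φ.1 y * χ.1 y) - _ * (ψ.1 y * χ.1 y)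
  ring

omit [IsProbabilityMeasure P] in
lemma bddMeas_average (χ : D) : BddMeas (fun z : E × E => (χ.1 z.2 + χ.1 z.1) / 2) := by
  have h1 := (((h.bddMeas χ).comp measurable_snd).add ((h.bddMeas χ).comp measurable_fst)).mul
    (BddMeas.const (X := E × E) (2⁻¹ : 𝕜))
  simpa only [div_eq_mul_inv] using h1

/-- Rests on the pointwise identity `Δψ Δ(φχ) + Δφ Δ(ψχ) - Δ(φψ) Δχ = Δφ Δψ (χ(y) + χ(x))` for a
jump from `x` to `y`. The average of the endpoints appears without any symmetry of the law of `(Y,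
Yₙ)`. -/
lemma tendsto_sqFieldAlg (φ ψ χ : D) :
    Tendsto (jumpMean P Y Yn α fun z =>
        increment φ.1 z * increment ψ.1 z * ((χ.1 z.2 + χ.1 z.1) / 2)) atTop
      (𝓝 (∫ y, χ.1 y * h.sqFieldAlg φ ψ y ∂P.map Y)) := by
  have h1 := (((h.tendsto_half_jumpMean ψ (φ * χ)).add (h.tendsto_half_jumpMean φ (ψ * χ))).sub
    (h.tendsto_half_jumpMean (φ * ψ) χ))
  rw [h.integral_mul_sqFieldAlg]
  refine (h1.congr fun n => ?_).trans (le_of_eq (by congr 1; ring))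
  have hb := fun φ : D => (h.bddMeas φ).increment
  rw [← mul_add, ← mul_sub, ← h.jumpMean_add ((hb _).mul (hb _)) ((hb _).mul (hb _)),
    ← h.jumpMean_sub (((hb _).mul (hb _)).add ((hb _).mul (hb _))) ((hb _).mul (hb _)),
    ← jumpMean_const_mul]
  congr 1
  funext z
  simp only [increment]
  change 2⁻¹ * ((_ - _) * (φ.1 z.2 * χ.1 z.2 - φ.1 z.1 * χ.1 z.1)
    + (_ - _) * (ψ.1 z.2 * χ.1 z.2 - ψ.1 z.1 * χ.1 z.1)
    - (φ.1 z.2 * ψ.1 z.2 - φ.1 z.1 * ψ.1 z.1) * (_ - _)) = _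
  ring

/-- Against a test function with values in `[0, 2]` the integrand is at most `2 |Δφ| |Δψ| ≤ |Δφ|² +
|Δψ|²`, whose means tend to twice the energies. Passing to the L¹ norm costs the factor `4`. -/
lemma norm_sqFieldAlg_le_add (φ ψ : D) :
    ‖h.sqFieldAlg φ ψ‖ ≤ 8 * (h.closedForm.energy (h.emb φ) + h.closedForm.energy (h.emb ψ)) := by
  have hb := fun φ : D => (h.bddMeas φ).increment
  have key := h.norm_le_of_forall_integral (G := h.sqFieldAlg φ ψ)
    (K := 2 * (h.closedForm.energy (h.emb φ) + h.closedForm.energy (h.emb ψ))) fun a ha => by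
      refine le_of_tendsto_of_tendsto' (h.tendsto_sqFieldAlg φ ψ (toAlg a)).norm
        (((h.tendsto_energy_emb φ).add (h.tendsto_energy_emb ψ)).const_mul 2) fun n => ?_
      rw [← mul_add, ← mul_assoc, ← h.jumpMean_add ((hb _).norm.pow 2) ((hb _).norm.pow 2)]
      rw [mul_inv_cancel₀ (by norm_num : (2 : ℝ) ≠ 0), one_mul]
      refine h.norm_jumpMean_le (((hb _).mul (hb _)).mul (h.bddMeas_average _))
        (((hb _).norm.pow 2).add ((hb _).norm.pow 2)) (fun z => ?_) n
      have h1 : ‖((toAlg a).1 z.2 + (toAlg a).1 z.1) / 2‖ ≤ 2 := by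
        rw [norm_div, RCLike.norm_ofNat, toAlg_apply, toAlg_apply, ← RCLike.ofReal_add,
          RCLike.norm_ofReal, abs_of_nonneg (add_nonneg (ha _).1 (ha _).1)]
        linarith [(ha z.1).2, (ha z.2).2]
      rw [norm_mul, norm_mul]
      have h2 : 0 ≤ ‖increment φ.1 z‖ * ‖increment ψ.1 z‖ := by positivity
      nlinarith [sq_nonneg (‖increment φ.1 z‖ - ‖increment ψ.1 z‖)]
  linarith

/-- Applying the additive bound to `t φ` and `t⁻¹ ψ` leaves the left side unchanged; optimising in
`t` turns the sum into a product. -/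
lemma norm_sqFieldAlg_le (φ ψ : D) : ‖h.sqFieldAlg φ ψ‖
    ≤ 16 * √(h.closedForm.energy (h.emb φ)) * √(h.closedForm.energy (h.emb ψ)) := by
  have := le_two_mul_of_forall_scaling (x := ‖h.sqFieldAlg φ ψ‖) (c := 8)
    (Real.sqrt_nonneg (h.closedForm.energy (h.emb φ)))
    (Real.sqrt_nonneg (h.closedForm.energy (h.emb ψ))) (by norm_num) fun t ht => by
      rw [Real.sq_sqrt (SymmForm.energy_nonneg _ _), Real.sq_sqrt (SymmForm.energy_nonneg _ _)]
      have h1 := h.norm_sqFieldAlg_le_add ((t : 𝕜) • φ) (((t⁻¹ : ℝ) : 𝕜) • ψ)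
      simp only [map_smul, LinearMap.smul_apply, SymmForm.energy_smul, smul_smul,
        RCLike.norm_ofReal, sq_abs] at h1
      rw [← RCLike.ofReal_mul, inv_mul_cancel₀ ht.ne', RCLike.ofReal_one, one_smul] at h1
      exact h1
  linarith

lemma exists_sqField : ∃ Γ : h.closedForm.domain →ₗ[𝕜] h.closedForm.domain →ₗ[𝕜] Lp 𝕜 1 (P.map Y),
    ∀ (φ ψ : ℕ → D) (u v : h.closedForm.domain),
      SymmForm.Approximates (fun n => h.toDomain (φ n)) (u : Lp 𝕜 2 (P.map Y)) →
      SymmForm.Approximates (fun n => h.toDomain (ψ n)) (v : Lp 𝕜 2 (P.map Y)) →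
      Tendsto (fun n => h.sqFieldAlg (φ n) (ψ n)) atTop (𝓝 (Γ u v)) :=
  h.form_closable.exists_extension h.toDomain h.toDomain_surjective h.sqFieldAlg 16
    (by simpa only [energy_toDomain] using h.norm_sqFieldAlg_le)

/-- The square field operator. -/
noncomputable def sqField :
    h.closedForm.domain →ₗ[𝕜] h.closedForm.domain →ₗ[𝕜] Lp 𝕜 1 (P.map Y) :=
  h.exists_sqField.choose

lemma tendsto_sqField {φ ψ : ℕ → D} {u v : h.closedForm.domain}
    (hu : SymmForm.Approximates (fun n => h.toDomain (φ n)) (u : Lp 𝕜 2 (P.map Y)))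
    (hv : SymmForm.Approximates (fun n => h.toDomain (ψ n)) (v : Lp 𝕜 2 (P.map Y))) :
    Tendsto (fun n => h.sqFieldAlg (φ n) (ψ n)) atTop (𝓝 (h.sqField u v)) :=
  h.exists_sqField.choose_spec φ ψ u v hu hv

lemma sqField_emb (φ ψ : D) : h.sqField (h.emb φ) (h.emb ψ) = h.sqFieldAlg φ ψ :=
  tendsto_nhds_unique (h.tendsto_sqField (SymmForm.Approximates.const (h.toDomain φ))
    (SymmForm.Approximates.const (h.toDomain ψ))) tendsto_const_nhds

lemma tendsto_energy_approx {φ : ℕ → D} {u : h.closedForm.domain}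
    (hu : SymmForm.Approximates (fun n => h.toDomain (φ n)) (u : Lp 𝕜 2 (P.map Y))) :
    Tendsto (fun n => h.closedForm.energy (h.emb (φ n))) atTop (𝓝 (h.closedForm.energy u)) :=
  SymmForm.tendsto_energy (h.tendsto_energy_emb_sub hu)

lemma norm_sqField_le (u v : h.closedForm.domain) :
    ‖h.sqField u v‖ ≤ 16 * √(h.closedForm.energy u) * √(h.closedForm.energy v) := by
  obtain ⟨φ, hφ⟩ := h.exists_seq_emb u
  obtain ⟨ψ, hψ⟩ := h.exists_seq_emb v
  refine le_of_tendsto_of_tendsto' (h.tendsto_sqField hφ hψ).norm ?_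
    fun n => h.norm_sqFieldAlg_le (φ n) (ψ n)
  exact (((Real.continuous_sqrt.tendsto _).comp (h.tendsto_energy_approx hφ)).const_mul 16).mul
    ((Real.continuous_sqrt.tendsto _).comp (h.tendsto_energy_approx hψ))

lemma sqFieldAlg_comm (φ ψ : D) : h.sqFieldAlg φ ψ = h.sqFieldAlg ψ φ := by
  rw [sqFieldAlg_apply, sqFieldAlg_apply, mul_comm φ ψ, sub_right_comm]

lemma sqFieldAlg_star (φ ψ : D) :
    h.sqFieldAlg (star φ) (star ψ) = star (h.sqFieldAlg φ ψ) := by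
  apply Lp.ext
  have hmul : star φ * star ψ = star (φ * ψ) := (star_mul' φ ψ).symm
  filter_upwards [h.coeFn_sqFieldAlg (star φ) (star ψ), h.coeFn_sqFieldAlg φ ψ,
    Lp.coeFn_star (h.sqFieldAlg φ ψ), Lp.coeFn_star (A (φ * ψ)), Lp.coeFn_star (A φ),
    Lp.coeFn_star (A ψ)] with y h1 h2 h3 h4 h5 h6
  rw [h1, h3, Pi.star_apply, h2, hmul, h.bias_star, h.bias_star, h.bias_star, h4, h5, h6]
  simp

lemma sqFieldAlg_nonneg (φ : D) :
    ∀ᵐ y ∂P.map Y, 0 ≤ RCLike.re (h.sqFieldAlg φ (star φ) y) := by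
  refine h.re_nonneg_of_forall_integral fun a ha => ?_
  refine ge_of_tendsto' ((RCLike.continuous_re.tendsto _).comp
    (h.tendsto_sqFieldAlg φ (star φ) (toAlg a))) fun n => ?_
  have h3 : (fun z => increment φ.1 z * increment (star φ).1 z
        * (((toAlg a).1 z.2 + (toAlg a).1 z.1) / 2))
      = fun z => ((‖increment φ.1 z‖ ^ 2 * ((a.1 z.2 + a.1 z.1) / 2) : ℝ) : 𝕜) := by
    funext z
    have : increment (star φ).1 z = star (increment φ.1 z) := by
      simp [increment]
    rw [this, ← starRingEnd_apply, RCLike.mul_conj]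
    simp only [RCLike.ofReal_mul, RCLike.ofReal_pow, RCLike.ofReal_div, RCLike.ofReal_add,
      RCLike.ofReal_ofNat, toAlg_apply]
  rw [Function.comp_apply, h3, jumpMean_ofReal, RCLike.ofReal_re]
  refine h.jumpMean_nonneg (fun z => ?_) n
  have := ha z.1
  have := ha z.2
  positivity

omit h in
lemma re_nonneg_of_tendsto {E : Type*} [MeasurableSpace E] {μ : Measure E} {G : ℕ → Lp 𝕜 1 μ}
    {G₀ : Lp 𝕜 1 μ} (hG : Tendsto G atTop (𝓝 G₀)) (h0 : ∀ n, ∀ᵐ y ∂μ, 0 ≤ RCLike.re (G n y)) :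
    ∀ᵐ y ∂μ, 0 ≤ RCLike.re (G₀ y) := by
  obtain ⟨ns, -, hae⟩ := (tendstoInMeasure_of_tendsto_Lp hG).exists_seq_tendsto_ae
  filter_upwards [hae, ae_all_iff.2 h0] with y h1 h2
  exact ge_of_tendsto' ((RCLike.continuous_re.tendsto _).comp h1) fun n => h2 _

lemma approximates_star {φ : ℕ → D} {u : h.closedForm.domain}
    (hu : SymmForm.Approximates (fun n => h.toDomain (φ n)) (u : Lp 𝕜 2 (P.map Y))) :
    SymmForm.Approximates (fun n => h.toDomain (star (φ n)))
      (h.closedForm.conj u : Lp 𝕜 2 (P.map Y)) := by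
  have h1 := hu.conj
  simp only [h.conj_toDomain] at h1
  exact h1

lemma exists_bounded_seq_ae {u : h.closedForm.domain} (hu : h.closedForm.IsBdd u) :
    ∃ (φ : ℕ → D) (C : ℝ), (∀ n y, ‖(φ n).1 y‖ ≤ C) ∧
      SymmForm.Approximates (fun n => h.toDomain (φ n)) (u : Lp 𝕜 2 (P.map Y)) ∧
      ∀ᵐ y ∂P.map Y, Tendsto (fun n => (φ n).1 y) atTop (𝓝 ((u : Lp 𝕜 2 (P.map Y)) y)) := by
  obtain ⟨φ, C, hC, hφ⟩ := h.exists_bounded_seq hu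
  obtain ⟨ns, hns, hae⟩ := h.exists_subseq_ae hφ.2
  exact ⟨fun n => φ (ns n), C, fun n => hC _, hφ.comp hns, hae⟩

/-- The increment of a product is `φ(y) Δψ + Δφ ψ(x)`, so uniform bounds on the factors keep the
energies of products bounded. -/
lemma energy_mul_le {φ ψ : D} {C : ℝ} (hφ : ∀ y, ‖φ.1 y‖ ≤ C) (hψ : ∀ y, ‖ψ.1 y‖ ≤ C) :
    h.closedForm.energy (h.emb (φ * ψ))
      ≤ 2 * C ^ 2 * (h.closedForm.energy (h.emb φ) + h.closedForm.energy (h.emb ψ)) := by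
  have hb := fun φ : D => (h.bddMeas φ).increment
  refine le_of_tendsto_of_tendsto' (h.tendsto_energy_emb (φ * ψ))
    (((h.tendsto_energy_emb φ).add (h.tendsto_energy_emb ψ)).const_mul (2 * C ^ 2)) fun n => ?_
  have h1 := h.jumpMean_mono ((hb (φ * ψ)).norm.pow 2) ((BddMeas.const (2 * C ^ 2)).mul
    (((hb φ).norm.pow 2).add ((hb ψ).norm.pow 2))) (fun z => by
      have e : increment (φ * ψ).1 z = φ.1 z.2 * increment ψ.1 z + increment φ.1 z * ψ.1 z.1 := by
        change φ.1 z.2 * ψ.1 z.2 - φ.1 z.1 * ψ.1 z.1 = _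
        simp only [increment]
        ring
      have h2 : ‖increment (φ * ψ).1 z‖ ≤ C * (‖increment φ.1 z‖ + ‖increment ψ.1 z‖) := by
        rw [e]
        refine (norm_add_le _ _).trans ?_
        rw [norm_mul, norm_mul]
        nlinarith [hφ z.2, hψ z.1, norm_nonneg (increment φ.1 z), norm_nonneg (increment ψ.1 z)]
      calc ‖increment (φ * ψ).1 z‖ ^ 2
          ≤ (C * (‖increment φ.1 z‖ + ‖increment ψ.1 z‖)) ^ 2 :=
            pow_le_pow_left₀ (norm_nonneg _) h2 2
        _ ≤ _ := by
            rw [mul_pow, mul_comm (2 : ℝ), mul_assoc]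
            refine mul_le_mul_of_nonneg_left ?_ (sq_nonneg C)
            linarith [sq_nonneg (‖increment φ.1 z‖ - ‖increment ψ.1 z‖)]) n
  rw [jumpMean_const_mul, h.jumpMean_add ((hb φ).norm.pow 2) ((hb ψ).norm.pow 2)] at h1
  linarith

/-- Products of uniformly bounded approximations. -/
lemma exists_mul_approx {u w : h.closedForm.domain} (hu : h.closedForm.IsBdd u) {φ θ : ℕ → D}
    {C : ℝ} (hφC : ∀ n y, ‖(φ n).1 y‖ ≤ C) (hθC : ∀ n y, ‖(θ n).1 y‖ ≤ C)
    (hφ : SymmForm.Approximates (fun n => h.toDomain (φ n)) (u : Lp 𝕜 2 (P.map Y)))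
    (hθ : SymmForm.Approximates (fun n => h.toDomain (θ n)) (w : Lp 𝕜 2 (P.map Y))) :
    ∃ p : h.closedForm.domain,
      ((p : Lp 𝕜 2 (P.map Y)) =ᵐ[P.map Y]
        fun x => (u : Lp 𝕜 2 (P.map Y)) x * (w : Lp 𝕜 2 (P.map Y)) x) ∧
      Tendsto (fun n => h.cls (φ n * θ n)) atTop (𝓝 (p : Lp 𝕜 2 (P.map Y))) ∧
      ∃ M, ∀ n, h.closedForm.energy (h.emb (φ n * θ n)) ≤ M := by
  obtain ⟨Cu, hCu⟩ := hu
  obtain ⟨p, hp⟩ := exists_lp_mul (w : Lp 𝕜 2 (P.map Y))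
    (Lp.aestronglyMeasurable (u : Lp 𝕜 2 (P.map Y))) hCu
  have hlim : Tendsto (fun n => h.cls (φ n * θ n)) atTop (𝓝 p) := by
    rw [tendsto_iff_norm_sub_tendsto_zero]
    have h1 := tendsto_iff_norm_sub_tendsto_zero.1 hφ.2
    have h2 := tendsto_iff_norm_sub_tendsto_zero.1 hθ.2
    refine squeeze_zero (fun n => norm_nonneg _) (fun n => ?_)
      (by simpa using (h1.const_mul C).add (h2.const_mul Cu))
    -- The intermediate product `q = u θₙ` changes one factor at a time: the bound on `θₙ` controls
    -- the first difference, the bound on `u` the second.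
    obtain ⟨q, hq⟩ := exists_lp_mul (h.cls (θ n))
      (Lp.aestronglyMeasurable (u : Lp 𝕜 2 (P.map Y))) hCu
    refine (norm_sub_le_norm_sub_add_norm_sub _ q _).trans (add_le_add ?_ ?_)
    · refine Lp.norm_le_mul_norm_of_ae_le_mul ?_
      filter_upwards [Lp.coeFn_sub (h.cls (φ n * θ n)) q, h.coeFn_cls (φ n * θ n), hq,
        h.coeFn_cls (θ n), h.coeFn_cls (φ n), Lp.coeFn_sub (h.cls (φ n)) (u : Lp 𝕜 2 (P.map Y))]
        with y h1 h2 h3 h4 h5 h6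
      rw [h1, Pi.sub_apply, h2, h3, h4]
      change _ ≤ C * ‖(h.cls (φ n) - (u : Lp 𝕜 2 (P.map Y)) : Lp 𝕜 2 (P.map Y)) y‖
      rw [h6, Pi.sub_apply, h5]
      change ‖(φ n).1 y * (θ n).1 y - _‖ ≤ _
      rw [← sub_mul, norm_mul, mul_comm]
      exact mul_le_mul_of_nonneg_right (hθC n y) (norm_nonneg _)
    · refine Lp.norm_le_mul_norm_of_ae_le_mul ?_
      filter_upwards [Lp.coeFn_sub q p, hq, hp, hCu,
        Lp.coeFn_sub (h.cls (θ n)) (w : Lp 𝕜 2 (P.map Y))] with y h1 h2 h3 h4 h5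
      rw [h1, Pi.sub_apply, h2, h3]
      change _ ≤ Cu * ‖(h.cls (θ n) - (w : Lp 𝕜 2 (P.map Y)) : Lp 𝕜 2 (P.map Y)) y‖
      rw [h5, Pi.sub_apply, ← mul_sub, norm_mul]
      exact mul_le_mul_of_nonneg_right h4 (norm_nonneg _)
  obtain ⟨M₁, hM₁⟩ := (h.tendsto_energy_approx hφ).bddAbove_range
  obtain ⟨M₂, hM₂⟩ := (h.tendsto_energy_approx hθ).bddAbove_range
  have hM : ∀ n, h.closedForm.energy (h.emb (φ n * θ n)) ≤ 2 * C ^ 2 * (M₁ + M₂) := fun n => by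
    refine (h.energy_mul_le (hφC n) (hθC n)).trans ?_
    have h1 := hM₁ (Set.mem_range_self n)
    have h2 := hM₂ (Set.mem_range_self n)
    gcongr
  -- The products have bounded energies and converge only in L², so membership of `p` comes from
  -- lower semicontinuity.
  obtain ⟨hpm, -⟩ := h.closedForm_closed.exists_energy_le p (2 * C ^ 2 * (M₁ + M₂))
    fun r hr => by
      obtain ⟨n, hn⟩ := ((tendsto_iff_norm_sub_tendsto_zero.1 hlim).eventually
        (gt_mem_nhds hr)).exists
      exact ⟨h.emb (φ n * θ n), hn.le, hM n⟩
  exact ⟨⟨p, hpm⟩, hp, hlim, _, hM⟩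

/-- Suited to the product identity, where each term pairs a product, converging only weakly, with a
single factor converging in energy. -/
lemma tendsto_form_weak_strong {f g : ℕ → h.closedForm.domain} {f₀ g₀ : h.closedForm.domain}
    {M : ℝ} (hM : ∀ k, h.closedForm.energy (f k) ≤ M)
    (hf : Tendsto (fun k => (f k : Lp 𝕜 2 (P.map Y))) atTop (𝓝 f₀))
    (hg : Tendsto (fun k => h.closedForm.energy (g k - g₀)) atTop (𝓝 0)) :
    Tendsto (fun k => h.closedForm.form (f k) (g k)) atTop (𝓝 (h.closedForm.form f₀ g₀)) := by
  have h1 := h.tendsto_form_of_bounded hM hf g₀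
  have h2 : Tendsto (fun k => h.closedForm.form (f k) (g k - g₀)) atTop (𝓝 0) := by
    refine squeeze_zero_norm (fun k => (h.closedForm.norm_form_le _ _).trans
      (mul_le_mul_of_nonneg_right (Real.sqrt_le_sqrt (hM k)) (Real.sqrt_nonneg _))) ?_
    simpa using (SymmForm.tendsto_sqrt_zero hg).const_mul (√M)
  simpa using h1.add h2

lemma form_mul_identity (φ ψ θ : D) :
    h.closedForm.form (h.emb (φ * θ)) (h.emb ψ) + h.closedForm.form (h.emb (ψ * θ)) (h.emb φ)
      - h.closedForm.form (h.emb (φ * ψ)) (h.emb θ)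
      = ∫ y, θ.1 y * h.sqFieldAlg φ ψ y ∂P.map Y := by
  rw [h.closedForm.symm (h.emb (φ * θ)), h.closedForm.symm (h.emb (ψ * θ)), h.closedForm_emb_left,
    h.closedForm_emb_left, h.closedForm_emb_left, h.integral_mul_sqFieldAlg]
  simp only [coe_emb]
  ring

lemma sqField_isSquareField : h.closedForm.IsSquareField h.sqField where
  symm u v := by
    obtain ⟨φ, hφ⟩ := h.exists_seq_emb u
    obtain ⟨ψ, hψ⟩ := h.exists_seq_emb v
    refine tendsto_nhds_unique (h.tendsto_sqField hφ hψ) ?_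
    simpa only [h.sqFieldAlg_comm] using h.tendsto_sqField hψ hφ
  real u v := by
    obtain ⟨φ, hφ⟩ := h.exists_seq_emb u
    obtain ⟨ψ, hψ⟩ := h.exists_seq_emb v
    refine tendsto_nhds_unique (h.tendsto_sqField (h.approximates_star hφ)
      (h.approximates_star hψ)) ?_
    simp only [h.sqFieldAlg_star]
    exact (SymmForm.continuous_lp_star.tendsto _).comp (h.tendsto_sqField hφ hψ)
  nonneg u := by
    obtain ⟨φ, hφ⟩ := h.exists_seq_emb u
    exact re_nonneg_of_tendsto (h.tendsto_sqField hφ (h.approximates_star hφ))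
      fun n => h.sqFieldAlg_nonneg (φ n)
  continuous := by
    refine ⟨16, fun u v => (h.norm_sqField_le u v).trans ?_⟩
    have h1 := h.closedForm.sqrt_energy_le_formNorm u
    have h2 := h.closedForm.sqrt_energy_le_formNorm v
    exact mul_le_mul (mul_le_mul_of_nonneg_left h1 (by norm_num)) h2 (Real.sqrt_nonneg _)
      (mul_nonneg (by norm_num) (Real.sqrt_nonneg _))
  identity u v w hu hv hw := by
    obtain ⟨φ, C₁, hC₁, hφ, -⟩ := h.exists_bounded_seq_ae hu
    obtain ⟨ψ, C₂, hC₂, hψ, -⟩ := h.exists_bounded_seq_ae hv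
    obtain ⟨θ, C₃, hC₃, hθ, hθae⟩ := h.exists_bounded_seq_ae hw
    set C := max C₁ (max C₂ C₃)
    have e1 : ∀ n y, ‖(φ n).1 y‖ ≤ C := fun n y => (hC₁ n y).trans (le_max_left _ _)
    have e2 : ∀ n y, ‖(ψ n).1 y‖ ≤ C := fun n y =>
      (hC₂ n y).trans ((le_max_left _ _).trans (le_max_right _ _))
    have e3 : ∀ n y, ‖(θ n).1 y‖ ≤ C := fun n y =>
      (hC₃ n y).trans ((le_max_right _ _).trans (le_max_right _ _))
    obtain ⟨uw, huw, luw, M₁, hM₁⟩ := h.exists_mul_approx hu e1 e3 hφ hθ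
    obtain ⟨vw, hvw, lvw, M₂, hM₂⟩ := h.exists_mul_approx hv e2 e3 hψ hθ
    obtain ⟨uv, huv, luv, M₃, hM₃⟩ := h.exists_mul_approx hu e1 e2 hφ hψ
    refine ⟨uw, vw, uv, huw, hvw, huv, ?_⟩
    have l1 := h.tendsto_form_weak_strong hM₁ luw (h.tendsto_energy_emb_sub hψ)
    have l2 := h.tendsto_form_weak_strong hM₂ lvw (h.tendsto_energy_emb_sub hφ)
    have l3 := h.tendsto_form_weak_strong hM₃ luv (h.tendsto_energy_emb_sub hθ)
    have l4 := tendsto_integral_mul (h.tendsto_sqField hφ hψ) (b := fun n => (θ n).1)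
      (fun n => (h.bddMeas _).measurable.aestronglyMeasurable) (fun n => .of_forall (e3 n)) hθae
    -- The weakly convergent product `uv` has to be the first argument, and the strongly convergent
    -- `w` the second.
    rw [h.closedForm.symm w uv]
    refine tendsto_nhds_unique ((l1.add l2).sub l3) ?_
    simpa only [h.form_mul_identity] using l4

end SymmetricBias

/-! ### Consequences of vanishing fourth moments: the polynomial chain rule. -/

namespace SymmetricBias

variable {𝕜 : Type*} [RCLike 𝕜] {Ω E : Type*} [MeasurableSpace Ω] [MeasurableSpace E]
  {P : Measure Ω} [IsProbabilityMeasure P] {Y : Ω → E} {Yn : ℕ → Ω → E} {α : ℕ → ℝ}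
  {D : FunctionStarAlgebra 𝕜 E} {A : D → Lp 𝕜 2 (P.map Y)}

variable (h : SymmetricBias P Y Yn α D A)

include h

/-- The majorant may depend on `η`, which leaves room to choose weights or cut-offs after the
tolerance is given. -/
lemma tendsto_jumpMean_zero_of_le {𝕂 : Type*} [RCLike 𝕂] {Φ : E × E → 𝕂} (hΦ : BddMeas Φ)
    (H : ∀ η > 0, ∃ Ψ : E × E → ℝ, BddMeas Ψ ∧ (∀ z, ‖Φ z‖ ≤ Ψ z) ∧
      ∀ᶠ n in atTop, jumpMean P Y Yn α Ψ n < η) :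
    Tendsto (jumpMean P Y Yn α Φ) atTop (𝓝 0) := by
  rw [tendsto_zero_iff_norm_tendsto_zero]
  refine Metric.tendsto_atTop.2 fun η hη => ?_
  obtain ⟨Ψ, hΨ, hle, hev⟩ := H η hη
  obtain ⟨N, hN⟩ := eventually_atTop.1 hev
  refine ⟨N, fun n hn => ?_⟩
  rw [Real.dist_eq, sub_zero, abs_norm]
  exact (h.norm_jumpMean_le hΦ hΨ hle n).trans_lt (hN n hn)

lemma tendsto_jumpMean_sq (a : realAlgebra D) :
    Tendsto (jumpMean P Y Yn α fun z => increment a.1 z ^ 2) atTop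
      (𝓝 (2 * h.closedForm.energy (h.emb (toAlg a)))) := by
  have h1 := (h.tendsto_energy_real a).const_mul 2
  simpa using h1

/-- Interpolation `s³ ≤ t s² + t⁻¹ s⁴`. The second moments have a finite limit, so `t` is chosen to
make their share smaller than `η`; the fourth moments then vanish for this fixed `t`. -/
lemma tendsto_jumpMean_cube {a b : realAlgebra D}
    (ha : Tendsto (jumpMean P Y Yn α fun z => increment a.1 z ^ 4) atTop (𝓝 0))
    (hb : Tendsto (jumpMean P Y Yn α fun z => increment b.1 z ^ 4) atTop (𝓝 0)) :
    Tendsto (jumpMean P Y Yn α fun z => (|increment a.1 z| + |increment b.1 z|) ^ 3)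
      atTop (𝓝 0) := by
  have ba := (h.bddMeas_real a).increment
  have bb := (h.bddMeas_real b).increment
  refine h.tendsto_jumpMean_zero_of_le ((ba.norm.add bb.norm).pow 3) fun η hη => ?_
  set e := h.closedForm.energy (h.emb (toAlg a)) + h.closedForm.energy (h.emb (toAlg b)) with he
  have he0 : 0 ≤ e := add_nonneg (SymmForm.energy_nonneg _ _) (SymmForm.energy_nonneg _ _)
  set t := η / (4 * (e + 1)) with ht
  have ht0 : 0 < t := by positivity
  have b2 := (BddMeas.const (X := E × E) (2 * t)).mul ((ba.pow 2).add (bb.pow 2))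
  have b4 := (BddMeas.const (X := E × E) (8 * t⁻¹)).mul ((ba.pow 4).add (bb.pow 4))
  refine ⟨_, b2.add b4, fun z => ?_, ?_⟩
  · set x := |increment a.1 z|
    set y := |increment b.1 z|
    have hx : 0 ≤ x := abs_nonneg _
    have hy : 0 ≤ y := abs_nonneg _
    rw [Real.norm_eq_abs, abs_of_nonneg (by positivity)]
    have e1 : increment a.1 z ^ 2 = x ^ 2 := (sq_abs _).symm
    have e2 : increment b.1 z ^ 2 = y ^ 2 := (sq_abs _).symm
    have e3 : increment a.1 z ^ 4 = x ^ 4 := (Even.pow_abs (by decide) _).symm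
    have e4 : increment b.1 z ^ 4 = y ^ 4 := (Even.pow_abs (by decide) _).symm
    rw [e1, e2, e3, e4]
    have q1 : (x + y) ^ 2 ≤ 2 * (x ^ 2 + y ^ 2) := add_sq_le
    have q2 : (x + y) ^ 4 ≤ 8 * (x ^ 4 + y ^ 4) := by
      have := add_pow_le hx hy 4
      norm_num at this
      exact this
    have q3 : (x + y) ^ 3 ≤ t * (x + y) ^ 2 + t⁻¹ * (x + y) ^ 4 := by
      have q4 : t * (x + y) ^ 2 + t⁻¹ * (x + y) ^ 4 - (x + y) ^ 3
          = t⁻¹ * (x + y) ^ 2 * ((t - (x + y) / 2) ^ 2 + 3 / 4 * (x + y) ^ 2) := by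
        field_simp
        ring
      have : 0 ≤ t⁻¹ * (x + y) ^ 2 * ((t - (x + y) / 2) ^ 2 + 3 / 4 * (x + y) ^ 2) := by positivity
      linarith
    have q5 : t * (x + y) ^ 2 ≤ t * (2 * (x ^ 2 + y ^ 2)) := by gcongr
    have q6 : t⁻¹ * (x + y) ^ 4 ≤ t⁻¹ * (8 * (x ^ 4 + y ^ 4)) := by gcongr
    linarith
  · have hlim : Tendsto (fun n => 2 * t * (jumpMean P Y Yn α (fun z => increment a.1 z ^ 2) n
        + jumpMean P Y Yn α (fun z => increment b.1 z ^ 2) n)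
        + 8 * t⁻¹ * (jumpMean P Y Yn α (fun z => increment a.1 z ^ 4) n
        + jumpMean P Y Yn α (fun z => increment b.1 z ^ 4) n)) atTop
        (𝓝 (2 * t * (2 * h.closedForm.energy (h.emb (toAlg a))
          + 2 * h.closedForm.energy (h.emb (toAlg b))) + 8 * t⁻¹ * (0 + 0))) :=
      (((h.tendsto_jumpMean_sq a).add (h.tendsto_jumpMean_sq b)).const_mul _).add
        ((ha.add hb).const_mul _)
    have hlt : 2 * t * (2 * h.closedForm.energy (h.emb (toAlg a))
          + 2 * h.closedForm.energy (h.emb (toAlg b))) + 8 * t⁻¹ * (0 + 0) < η := by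
      have : 4 * t * (e + 1) = η := by rw [ht]; field_simp
      rw [← this, he]
      nlinarith
    filter_upwards [hlim.eventually (gt_mem_nhds hlt)] with n hn
    rw [h.jumpMean_add b2 b4, jumpMean_const_mul, jumpMean_const_mul,
      h.jumpMean_add (ba.pow 2) (bb.pow 2), h.jumpMean_add (ba.pow 4) (bb.pow 4)]
    exact hn

-- To leading order the product of increments is `p'(a) q'(b) Δa Δb`. The Taylor remainders, and the
-- change of `p'(a) q'(b)` between the endpoint and the average, are each of third order. The
-- average is used because it is the weight in `tendsto_sqFieldAlg`.
omit [IsProbabilityMeasure P] in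
lemma exists_increment_bound (a b : realAlgebra D) (p q : Polynomial ℝ) : ∃ C, ∀ z,
    |increment (polyComp p a).1 z * increment (polyComp q b).1 z
      - increment a.1 z * increment b.1 z *
        (((polyComp p.derivative a * polyComp q.derivative b).1 z.2
          + (polyComp p.derivative a * polyComp q.derivative b).1 z.1) / 2)|
      ≤ C * (|increment a.1 z| + |increment b.1 z|) ^ 3 := by
  obtain ⟨Ca, hCa⟩ := h.exists_bound_real a
  obtain ⟨Cb, hCb⟩ := h.exists_bound_real b
  obtain ⟨Lp, hLp0, hLp⟩ := p.exists_bound_derivative Ca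
  obtain ⟨Lq, hLq0, hLq⟩ := q.exists_bound_derivative Cb
  obtain ⟨Mp, hMp0, hMp⟩ := p.derivative.exists_bound_derivative Ca
  obtain ⟨Mq, hMq0, hMq⟩ := q.derivative.exists_bound_derivative Cb
  obtain ⟨Tp, hTp0, hTp⟩ := p.exists_taylor_bound Ca
  obtain ⟨Tq, hTq0, hTq⟩ := q.exists_taylor_bound Cb
  refine ⟨Lp * Tq + Tp * Lq + (Mp * Lq + Lp * Mq), fun z => ?_⟩
  have e1 := hTp _ (hCa z.2) _ (hCa z.1)
  have e2 := hTq _ (hCb z.2) _ (hCb z.1)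
  have e3 := Polynomial.abs_eval_sub_le_of_derivative hLp (hCa z.2) (hCa z.1)
  have e4 := Polynomial.abs_eval_sub_le_of_derivative hMp (hCa z.2) (hCa z.1)
  have e5 := Polynomial.abs_eval_sub_le_of_derivative hMq (hCb z.2) (hCb z.1)
  have e6 := hLq _ (hCb z.1)
  have e7 := hLp _ (hCa z.1)
  have e8 := hLq _ (hCb z.2)
  have hpm : ∀ y, (polyComp p.derivative a * polyComp q.derivative b).1 y
      = p.derivative.eval (a.1 y) * q.derivative.eval (b.1 y) := fun y => by
    rw [← polyComp_apply p.derivative a, ← polyComp_apply q.derivative b]; rfl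
  simp only [hpm, increment, polyComp_apply]
  set x := a.1 z.2 - a.1 z.1
  set y := b.1 z.2 - b.1 z.1
  set p2 := p.eval (a.1 z.2)
  set p1 := p.eval (a.1 z.1)
  set q2 := q.eval (b.1 z.2)
  set q1 := q.eval (b.1 z.1)
  set p2' := p.derivative.eval (a.1 z.2)
  set p1' := p.derivative.eval (a.1 z.1)
  set q2' := q.derivative.eval (b.1 z.2)
  set q1' := q.derivative.eval (b.1 z.1)
  have key : (p2 - p1) * (q2 - q1) - x * y * ((p2' * q2' + p1' * q1') / 2)
      = (p2 - p1) * (q2 - q1 - q1' * y) + (p2 - p1 - p1' * x) * (q1' * y)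
        - x * y * (((p2' - p1') * q2' + p1' * (q2' - q1')) / 2) := by ring
  have f1 : |(p2 - p1) * (q2 - q1 - q1' * y)| ≤ Lp * |x| * (Tq * |y| ^ 2) := by
    rw [abs_mul, sq_abs]; gcongr
  have f2 : |(p2 - p1 - p1' * x) * (q1' * y)| ≤ Tp * |x| ^ 2 * (Lq * |y|) := by
    rw [abs_mul, abs_mul, sq_abs]; gcongr
  have f3 : |x * y * (((p2' - p1') * q2' + p1' * (q2' - q1')) / 2)|
      ≤ |x| * |y| * (Mp * |x| * Lq + Lp * (Mq * |y|)) := by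
    rw [abs_mul, abs_mul, abs_div, abs_two]
    refine mul_le_mul_of_nonneg_left ?_ (by positivity)
    have g1 : |(p2' - p1') * q2' + p1' * (q2' - q1')| ≤ Mp * |x| * Lq + Lp * (Mq * |y|) := by
      refine (abs_add_le _ _).trans ?_
      rw [abs_mul, abs_mul]
      gcongr
    linarith [abs_nonneg ((p2' - p1') * q2' + p1' * (q2' - q1'))]
  rw [key]
  refine (abs_sub _ _).trans ((add_le_add_left (abs_add_le _ _) _).trans
    ((add_le_add (add_le_add f1 f2) f3).trans ?_))
  have hx := abs_nonneg x
  have hy := abs_nonneg y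
  have k1 : |x| * |y| ^ 2 ≤ (|x| + |y|) ^ 3 := by
    have : 0 ≤ |x| ^ 3 + 3 * |x| ^ 2 * |y| + 2 * |x| * |y| ^ 2 + |y| ^ 3 := by positivity
    linarith [show (|x| + |y|) ^ 3 = |x| * |y| ^ 2 +
      (|x| ^ 3 + 3 * |x| ^ 2 * |y| + 2 * |x| * |y| ^ 2 + |y| ^ 3) by ring]
  have k2 : |x| ^ 2 * |y| ≤ (|x| + |y|) ^ 3 := by
    have : 0 ≤ |x| ^ 3 + 2 * |x| ^ 2 * |y| + 3 * |x| * |y| ^ 2 + |y| ^ 3 := by positivity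
    linarith [show (|x| + |y|) ^ 3 = |x| ^ 2 * |y| +
      (|x| ^ 3 + 2 * |x| ^ 2 * |y| + 3 * |x| * |y| ^ 2 + |y| ^ 3) by ring]
  calc _ = Lp * Tq * (|x| * |y| ^ 2) + Tp * Lq * (|x| ^ 2 * |y|)
        + (Mp * Lq * (|x| ^ 2 * |y|) + Lp * Mq * (|x| * |y| ^ 2)) := by ring
    _ ≤ Lp * Tq * (|x| + |y|) ^ 3 + Tp * Lq * (|x| + |y|) ^ 3
        + (Mp * Lq * (|x| + |y|) ^ 3 + Lp * Mq * (|x| + |y|) ^ 3) := by gcongr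
    _ = _ := by ring

/-- The chain rule for polynomials, when the fourth moments of the increments vanish. -/
lemma form_polyComp
    (H : ∀ a : realAlgebra D,
      Tendsto (jumpMean P Y Yn α fun z => increment a.1 z ^ 4) atTop (𝓝 0))
    (a b : realAlgebra D) (p q : Polynomial ℝ) :
    h.closedForm.form (h.emb (toAlg (polyComp p a))) (h.emb (toAlg (polyComp q b)))
      = 2⁻¹ * ∫ y, (toAlg (polyComp p.derivative a)).1 y * (toAlg (polyComp q.derivative b)).1 y
        * h.sqField (h.emb (toAlg a)) (h.emb (toAlg b)) y ∂P.map Y := by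
  have br := fun a : realAlgebra D => (h.bddMeas_real a).increment
  have bc := fun φ : D => (h.bddMeas φ).increment
  rw [sqField_emb]
  set χ := toAlg (polyComp p.derivative a) * toAlg (polyComp q.derivative b) with hχ
  have h1 := h.tendsto_form_emb (toAlg (polyComp p a)) (toAlg (polyComp q b))
  have h2 := (h.tendsto_sqFieldAlg (toAlg a) (toAlg b) χ).const_mul (2⁻¹ : 𝕜)
  obtain ⟨C, hC⟩ := h.exists_increment_bound a b p q
  have b1 := (bc (toAlg (polyComp p a))).mul (bc (toAlg (polyComp q b)))
  have b2 := ((bc (toAlg a)).mul (bc (toAlg b))).mul (h.bddMeas_average χ)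
  have h3 : Tendsto (jumpMean P Y Yn α fun z =>
      increment (toAlg (polyComp p a)).1 z * increment (toAlg (polyComp q b)).1 z
      - increment (toAlg a).1 z * increment (toAlg b).1 z * ((χ.1 z.2 + χ.1 z.1) / 2)) atTop
      (𝓝 0) := by
    refine h.tendsto_jumpMean_zero_of_le (b1.sub b2) fun η hη => ⟨_, (BddMeas.const C).mul
      (((br a).norm.add (br b).norm).pow 3), fun z => ?_, ?_⟩
    · refine le_trans (le_of_eq ?_) (hC z)
      rw [← RCLike.norm_ofReal (K := 𝕜)]
      congr 1
      simp only [hχ, ← toAlg_mul, increment_toAlg, toAlg_apply]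
      push_cast
      rfl
    · have h4 := (h.tendsto_jumpMean_cube (H a) (H b)).const_mul C
      rw [mul_zero] at h4
      filter_upwards [h4.eventually (gt_mem_nhds hη)] with n hn
      rw [jumpMean_const_mul]
      exact hn
  have h5 := h3.const_mul (2⁻¹ : 𝕜)
  rw [mul_zero] at h5
  refine tendsto_nhds_unique h1 ?_
  have h6 := h2.add h5
  rw [add_zero] at h6
  refine h6.congr fun n => ?_
  rw [h.jumpMean_sub b1 b2]
  ring

-- Approximating `F'` and not only `F` makes the increments of the error at most `ε |Δa|`, which is
-- closeness in energy.
omit [IsProbabilityMeasure P] in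
lemma exists_comp_near_deriv {F : ℝ → ℝ} (hF : ContDiff ℝ 1 F) (a : realAlgebra D) {ε : ℝ}
    (hε : 0 < ε) : ∃ p : Polynomial ℝ, (∀ y, |(polyComp p a).1 y - F (a.1 y)| ≤ ε) ∧
      (∀ y, |(polyComp p.derivative a).1 y - deriv F (a.1 y)| ≤ ε) ∧
      ∀ z, |increment (polyComp p a).1 z - (F (a.1 z.2) - F (a.1 z.1))|
        ≤ ε * |increment a.1 z| := by
  obtain ⟨C, hC⟩ := h.exists_bound_real a
  have hd : ∀ x, HasDerivAt F (deriv F x) x := fun x =>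
    (hF.differentiable (by norm_num) x).hasDerivAt
  obtain ⟨p, hp⟩ := Polynomial.exists_near_of_hasDerivAt hd
    (hF.continuous_deriv le_rfl) C hε
  refine ⟨p, fun y => by simpa using (hp _ (hC y)).1, fun y => by simpa using (hp _ (hC y)).2,
    fun z => ?_⟩
  have := (convex_Icc (-C) C).norm_image_sub_le_of_norm_hasDerivWithin_le
    (f := fun x => p.eval x - F x) (f' := fun x => p.derivative.eval x - deriv F x)
    (fun x _ => ((p.hasDerivAt x).sub (hd x)).hasDerivWithinAt)
    (fun x hx => (hp x hx).2) (hC z.1) (hC z.2)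
  simp only [Real.norm_eq_abs] at this
  simp only [increment, polyComp_apply]
  refine le_trans (le_of_eq ?_) this
  congr 1
  ring

end SymmetricBias

/-! ### The chain rule for `C¹` functions, and locality. -/

namespace SymmetricBias

variable {𝕜 : Type*} [RCLike 𝕜] {Ω E : Type*} [MeasurableSpace Ω] [MeasurableSpace E]
  {P : Measure Ω} [IsProbabilityMeasure P] {Y : Ω → E} {Yn : ℕ → Ω → E} {α : ℕ → ℝ}
  {D : FunctionStarAlgebra 𝕜 E} {A : D → Lp 𝕜 2 (P.map Y)}

variable (h : SymmetricBias P Y Yn α D A)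

include h

/-- The function `F ∘ u` as an element of the domain. -/
noncomputable def lipComp {F : ℝ → ℝ} {K : NNReal} (hF : LipschitzWith K F) (F0 : F 0 = 0)
    {u : h.closedForm.domain} (hu : star (u : Lp 𝕜 2 (P.map Y)) = u) : h.closedForm.domain :=
  ⟨_, (h.compLp_mem hF F0 hu).choose⟩

lemma coeFn_lipComp {F : ℝ → ℝ} {K : NNReal} (hF : LipschitzWith K F) (F0 : F 0 = 0)
    {u : h.closedForm.domain} (hu : star (u : Lp 𝕜 2 (P.map Y)) = u) :
    (h.lipComp hF F0 hu : Lp 𝕜 2 (P.map Y))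
      =ᵐ[P.map Y] fun x => (F (RCLike.re ((u : Lp 𝕜 2 (P.map Y)) x)) : 𝕜) :=
  (hF.realComp (𝕜 := 𝕜)).coeFn_compLp (by simp [F0]) (u : Lp 𝕜 2 (P.map Y))

/-- Real elements have algebra approximations whose polynomial images approximate `F ∘ u`. -/
lemma exists_poly_seq {F : ℝ → ℝ} {K : NNReal} (hF : LipschitzWith K F) (F0 : F 0 = 0)
    (hF1 : ContDiff ℝ 1 F) {u : h.closedForm.domain}
    (hu : star (u : Lp 𝕜 2 (P.map Y)) = u) :
    ∃ (a : ℕ → realAlgebra D) (p : ℕ → Polynomial ℝ) (M : ℝ),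
      Tendsto (fun k => h.closedForm.energy (h.emb (toAlg (a k)) - u)) atTop (𝓝 0) ∧
      (∀ k y, |(polyComp (p k).derivative (a k)).1 y| ≤ K + 1) ∧
      (∀ᵐ y ∂P.map Y, Tendsto (fun k => (toAlg (polyComp (p k).derivative (a k))).1 y) atTop
        (𝓝 ((deriv F (RCLike.re ((u : Lp 𝕜 2 (P.map Y)) y)) : ℝ) : 𝕜))) ∧
      (∀ k, h.closedForm.energy (h.emb (toAlg (polyComp (p k) (a k)))) ≤ M) ∧
      Tendsto (fun k => h.cls (toAlg (polyComp (p k) (a k)))) atTop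
        (𝓝 (h.lipComp hF F0 hu : Lp 𝕜 2 (P.map Y))) := by
  obtain ⟨a₀, ha1, ha2⟩ := h.exists_seq_real hu
  -- Almost everywhere convergence is needed for the weights `p'(a)` to tend to `F'(u)` pointwise.
  obtain ⟨ns, hns, hae⟩ := h.exists_subseq_ae ha2
  set a := fun k => a₀ (ns k)
  have ha1' := ha1.comp hns.tendsto_atTop
  have ha2' := ha2.comp hns.tendsto_atTop
  have hr : ∀ k : ℕ, (0 : ℝ) < 1 / ((k : ℝ) + 1) := fun k => by positivity
  have hr1 : ∀ k : ℕ, 1 / ((k : ℝ) + 1) ≤ 1 := fun k => by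
    rw [div_le_one (by positivity)]; linarith [(Nat.cast_nonneg k : (0 : ℝ) ≤ k)]
  choose p hp1 hp2 hp3 using fun k => h.exists_comp_near_deriv hF1 (a k) (hr k)
  have hdF : ∀ x, |deriv F x| ≤ K := fun x => norm_deriv_le_of_lipschitz hF
  obtain ⟨M, hM⟩ := (SymmForm.tendsto_energy ha1').bddAbove_range
  have hM' : ∀ k, h.closedForm.energy (h.emb (toAlg (a k))) ≤ M := fun k => hM ⟨k, rfl⟩
  refine ⟨a, p, (K + 1) ^ 2 * M, ha1', fun k y => ?_, ?_, fun k => ?_, ?_⟩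
  · have := abs_sub_abs_le_abs_sub ((polyComp (p k).derivative (a k)).1 y) (deriv F ((a k).1 y))
    linarith [hp2 k y, hdF ((a k).1 y), hr1 k]
  · filter_upwards [hae] with y hy
    have h1 : Tendsto (fun k => (a k).1 y) atTop (𝓝 (RCLike.re ((u : Lp 𝕜 2 (P.map Y)) y))) := by
      have := (RCLike.continuous_re.tendsto _).comp hy
      simpa [Function.comp_def] using this
    have h2 := ((hF1.continuous_deriv le_rfl).tendsto _).comp h1
    have h3 : Tendsto (fun k => (polyComp (p k).derivative (a k)).1 y - deriv F ((a k).1 y))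
        atTop (𝓝 0) :=
      squeeze_zero_norm (fun k => hp2 k y) tendsto_one_div_add_atTop_nhds_zero_nat
    have h4 := (RCLike.continuous_ofReal (K := 𝕜)).tendsto _ |>.comp (h3.add h2)
    simpa [Function.comp_def] using h4
  · refine (h.energy_le_of_increment_le (a := a k) (L := K + 1) fun z => ?_).trans ?_
    · have h1 := hF.dist_le_mul ((a k).1 z.2) ((a k).1 z.1)
      rw [Real.dist_eq, Real.dist_eq] at h1
      have h2 := abs_sub_abs_le_abs_sub (increment (polyComp (p k) (a k)).1 z)
        (F ((a k).1 z.2) - F ((a k).1 z.1))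
      have h3 : 1 / ((k : ℝ) + 1) * |increment (a k).1 z| ≤ 1 * |increment (a k).1 z| := by
        gcongr
        exact hr1 k
      have h4 := hp3 k z
      simp only [increment] at h1 h2 h3 h4 ⊢
      linarith
    · gcongr
      exact hM' k
  · rw [tendsto_iff_norm_sub_tendsto_zero]
    refine squeeze_zero (fun _ => norm_nonneg _) (fun k => h.norm_cls_sub_compLp_le hF F0
      (hr k).le (hp1 k) (u : Lp 𝕜 2 (P.map Y))) ?_
    have h1 := tendsto_one_div_add_atTop_nhds_zero_nat (𝕜 := ℝ) |>.add
      ((tendsto_iff_norm_sub_tendsto_zero.1 ha2').const_mul (K : ℝ))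
    simpa [Function.comp_def] using h1

lemma continuous_sqField_left {f : ℕ → h.closedForm.domain} {f₀ : h.closedForm.domain}
    (hf : Tendsto (fun k => h.closedForm.energy (f k - f₀)) atTop (𝓝 0))
    (g : h.closedForm.domain) :
    Tendsto (fun k => h.sqField (f k) g) atTop (𝓝 (h.sqField f₀ g)) := by
  rw [tendsto_iff_norm_sub_tendsto_zero]
  have h1 := ((SymmForm.tendsto_sqrt_zero hf).const_mul 16).mul_const (√(h.closedForm.energy g))
  rw [mul_zero, zero_mul] at h1
  refine squeeze_zero (fun _ => norm_nonneg _) (fun k => ?_) h1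
  rw [← LinearMap.sub_apply, ← map_sub]
  exact h.norm_sqField_le _ _

/-- Passage from polynomials to continuously differentiable functions in the chain rule. -/
lemma form_lipComp_of_polyComp {F : ℝ → ℝ} {K : NNReal} (hF : LipschitzWith K F) (F0 : F 0 = 0)
    (hF1 : ContDiff ℝ 1 F) {u : h.closedForm.domain}
    (hu : star (u : Lp 𝕜 2 (P.map Y)) = u) {w v : h.closedForm.domain} {g : E → 𝕜} {C : ℝ}
    (hgm : AEStronglyMeasurable g (P.map Y)) (hgC : ∀ y, ‖g y‖ ≤ C)
    (H : ∀ (a : realAlgebra D) (p : Polynomial ℝ),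
      h.closedForm.form (h.emb (toAlg (polyComp p a))) w
        = 2⁻¹ * ∫ y, (toAlg (polyComp p.derivative a)).1 y * g y
          * h.sqField (h.emb (toAlg a)) v y ∂P.map Y) :
    h.closedForm.form (h.lipComp hF F0 hu) w
      = 2⁻¹ * ∫ y, ((deriv F (RCLike.re ((u : Lp 𝕜 2 (P.map Y)) y)) : ℝ) : 𝕜) * g y
          * h.sqField u v y ∂P.map Y := by
  obtain ⟨a, p, M, h1, h2, h3, h4, h5⟩ := h.exists_poly_seq hF F0 hF1 hu
  have h6 := h.tendsto_form_of_bounded h4 h5 w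
  simp only [H] at h6
  refine tendsto_nhds_unique h6 (Tendsto.const_mul _ ?_)
  refine tendsto_integral_mul (h.continuous_sqField_left h1 v) (C := (K + 1) * C)
    (fun k => (h.bddMeas _).measurable.aestronglyMeasurable.mul hgm)
    (fun k => .of_forall fun y => ?_) ?_
  · rw [norm_mul, toAlg_apply, RCLike.norm_ofReal]
    exact mul_le_mul (h2 k y) (hgC y) (norm_nonneg _) (by positivity)
  · filter_upwards [h3] with y hy
    exact hy.mul_const _

/-- The chain rule, when the fourth moments of the increments vanish. -/
lemma form_lipComp
    (H : ∀ a : realAlgebra D,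
      Tendsto (jumpMean P Y Yn α fun z => increment a.1 z ^ 4) atTop (𝓝 0))
    {F G : ℝ → ℝ} {K L : NNReal} (hF : LipschitzWith K F) (F0 : F 0 = 0) (hF1 : ContDiff ℝ 1 F)
    (hG : LipschitzWith L G) (G0 : G 0 = 0) (hG1 : ContDiff ℝ 1 G)
    {u v : h.closedForm.domain} (hu : star (u : Lp 𝕜 2 (P.map Y)) = u)
    (hv : star (v : Lp 𝕜 2 (P.map Y)) = v) :
    h.closedForm.form (h.lipComp hF F0 hu) (h.lipComp hG G0 hv)
      = 2⁻¹ * ∫ y, ((deriv F (RCLike.re ((u : Lp 𝕜 2 (P.map Y)) y)) : ℝ) : 𝕜)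
          * ((deriv G (RCLike.re ((v : Lp 𝕜 2 (P.map Y)) y)) : ℝ) : 𝕜)
          * h.sqField u v y ∂P.map Y := by
  have hm : Measurable fun y => ((deriv G (RCLike.re ((v : Lp 𝕜 2 (P.map Y)) y)) : ℝ) : 𝕜) :=
    (RCLike.continuous_ofReal.comp ((hG1.continuous_deriv le_rfl).comp
      RCLike.continuous_re)).measurable.comp (Lp.stronglyMeasurable _).measurable
  have hsymm := h.sqField_isSquareField.symm
  -- One factor at a time: `F ∘ u` is handled with `G'(v)` as bounded weight, which reduces to a
  -- polynomial in the first slot; by symmetry the same lemma then treats `G ∘ v` with weight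
  -- `p'(a)`.
  refine h.form_lipComp_of_polyComp hF F0 hF1 hu hm.aestronglyMeasurable (C := L)
    (fun y => by rw [RCLike.norm_ofReal]; exact norm_deriv_le_of_lipschitz hG) fun a p => ?_
  obtain ⟨C, hC⟩ := (h.bddMeas (toAlg (polyComp p.derivative a))).bounded
  rw [h.closedForm.symm, h.form_lipComp_of_polyComp hG G0 hG1 hv (w := h.emb (toAlg (polyComp p a)))
    (v := h.emb (toAlg a)) (h.bddMeas (toAlg (polyComp p.derivative a))).measurable.aestronglyMeasurable
    hC fun b q => ?_]
  · congr 2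
    funext y
    rw [hsymm v, mul_comm ((deriv G _ : ℝ) : 𝕜)]
  · exact h.form_polyComp H b a q p

/-- By the chain rule the form is an integral weighted by `F'(u) G'(u)`, and a derivative is
supported in the closed support of its function, so this weight is identically zero. -/
lemma isLocal_of_tendsto_pow_four
    (H : ∀ a : realAlgebra D,
      Tendsto (jumpMean P Y Yn α fun z => increment a.1 z ^ 4) atTop (𝓝 0)) :
    h.closedForm.IsLocal := by
  intro u hu F G hF hG hFc hGc hdisj
  have aux : ∀ {F : ℝ → ℝ}, ContDiff ℝ (⊤ : ℕ∞) F → HasCompactSupport F →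
      ∃ K : NNReal, LipschitzWith K fun x => F x - F 0 := fun hF hFc => by
    obtain ⟨K, hK⟩ := hF.lipschitzWith_of_hasCompactSupport hFc (by simp)
    refine ⟨K, LipschitzWith.of_dist_le_mul fun x y => ?_⟩
    rw [dist_sub_right]
    exact hK.dist_le_mul x y
  obtain ⟨K, hK⟩ := aux hF hFc
  obtain ⟨L, hL⟩ := aux hG hGc
  refine ⟨h.lipComp hK (sub_self _) hu, h.lipComp hL (sub_self _) hu, h.coeFn_lipComp _ _ _,
    h.coeFn_lipComp _ _ _, ?_⟩
  rw [h.form_lipComp H hK _ ((hF.of_le (by simp)).sub contDiff_const) hL _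
    ((hG.of_le (by simp)).sub contDiff_const)]
  have hzero : ∀ x : ℝ, deriv (fun x => F x - F 0) x = 0 ∨ deriv (fun x => G x - G 0) x = 0 := by
    intro x
    simp only [deriv_sub_const]
    by_contra! hne
    exact hdisj.le_bot ⟨support_deriv_subset hne.1, support_deriv_subset hne.2⟩
  have : ∀ y, ((deriv (fun x => F x - F 0) (RCLike.re ((u : Lp 𝕜 2 (P.map Y)) y)) : ℝ) : 𝕜)
      * ((deriv (fun x => G x - G 0) (RCLike.re ((u : Lp 𝕜 2 (P.map Y)) y)) : ℝ) : 𝕜) = 0 := fun y => by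
    rcases hzero (RCLike.re ((u : Lp 𝕜 2 (P.map Y)) y)) with h0 | h0 <;> simp [h0]
  simp only [this, zero_mul, integral_zero, mul_zero]

end SymmetricBias

/-! ### From locality to vanishing fourth moments. -/

lemma toAlg_sub {𝕜 : Type*} [RCLike 𝕜] {E : Type*} {D : FunctionStarAlgebra 𝕜 E}
    (a b : realAlgebra D) : (toAlg (a - b)) = (toAlg a) - (toAlg b) :=
  Subtype.ext (funext fun y => by
    change ((a.1 y - b.1 y : ℝ) : 𝕜) = (a.1 y : 𝕜) - (b.1 y : 𝕜)
    push_cast; rfl)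

namespace SymmetricBias

variable {𝕜 : Type*} [RCLike 𝕜] {Ω E : Type*} [MeasurableSpace Ω] [MeasurableSpace E]
  {P : Measure Ω} [IsProbabilityMeasure P] {Y : Ω → E} {Yn : ℕ → Ω → E} {α : ℕ → ℝ}
  {D : FunctionStarAlgebra 𝕜 E} {A : D → Lp 𝕜 2 (P.map Y)}

variable (h : SymmetricBias P Y Yn α D A)

include h

lemma star_emb_toAlg (a : realAlgebra D) :
    star (h.emb (toAlg a) : Lp 𝕜 2 (P.map Y)) = h.emb (toAlg a) := by
  rw [coe_emb, star_cls, star_toAlg]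

/-- Polynomials approximate continuously differentiable functions in energy. -/
lemma exists_poly_seq_energy {F : ℝ → ℝ} {K : NNReal} (hF : LipschitzWith K F) (F0 : F 0 = 0)
    (hF1 : ContDiff ℝ 1 F) (a : realAlgebra D) :
    ∃ b : ℕ → realAlgebra D,
      (∀ k z, |increment (b k).1 z - (F (a.1 z.2) - F (a.1 z.1))|
        ≤ 1 / ((k : ℝ) + 1) * |increment a.1 z|) ∧
      Tendsto (fun k => h.closedForm.energy
        (h.emb (toAlg (b k)) - h.lipComp hF F0 (h.star_emb_toAlg a))) atTop (𝓝 0) := by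
  have hr : ∀ k : ℕ, (0 : ℝ) < 1 / ((k : ℝ) + 1) := fun k => by positivity
  choose p hp1 _ hp3 using fun k : ℕ => h.exists_comp_near_deriv hF1 a (hr k)
  set b := fun k => polyComp (p k) a
  refine ⟨b, hp3, ?_⟩
  -- Both polynomial images have increments close to those of `F ∘ a`, with error proportional to
  -- `|Δa|`; hence their difference has small energy.
  have hdiff : ∀ m n, h.closedForm.energy (h.emb (toAlg (b m)) - h.emb (toAlg (b n)))
      ≤ (1 / ((m : ℝ) + 1) + 1 / ((n : ℝ) + 1)) ^ 2 * h.closedForm.energy (h.emb (toAlg a)) := by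
    intro m n
    rw [← map_sub, ← toAlg_sub]
    refine h.energy_le_of_increment_le fun z => ?_
    have e : increment (b m - b n).1 z = (increment (b m).1 z - (F (a.1 z.2) - F (a.1 z.1)))
        - (increment (b n).1 z - (F (a.1 z.2) - F (a.1 z.1))) := by
      change ((b m).1 z.2 - (b n).1 z.2) - ((b m).1 z.1 - (b n).1 z.1) = _
      simp only [increment]
      ring
    rw [e, add_mul]
    exact (abs_sub _ _).trans (add_le_add (hp3 m z) (hp3 n z))
  have hlim := tendsto_one_div_add_atTop_nhds_zero_nat (𝕜 := ℝ)
  have hcauchy : h.closedForm.EnergyCauchy fun k => h.emb (toAlg (b k)) := by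
    intro ε hε
    set e := h.closedForm.energy (h.emb (toAlg a)) with he
    have he0 : 0 ≤ e := SymmForm.energy_nonneg _ _
    have h2 : Tendsto (fun N : ℕ => (1 / ((N : ℝ) + 1) + 1 / ((N : ℝ) + 1)) ^ 2 * e) atTop
        (𝓝 ((0 + 0) ^ 2 * e)) := ((hlim.add hlim).pow 2).mul_const e
    obtain ⟨N, hN⟩ := (h2.eventually (gt_mem_nhds (by simpa using hε))).exists
    refine ⟨N, fun m hm n hn => ((hdiff m n).trans ?_).trans_lt hN⟩
    have hm' : (N : ℝ) ≤ m := by exact_mod_cast hm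
    have hn' : (N : ℝ) ≤ n := by exact_mod_cast hn
    gcongr
  obtain ⟨hf, hfe⟩ := h.closedForm_closed _ (h.lipComp hF F0 (h.star_emb_toAlg a)) hcauchy (by
    rw [tendsto_iff_norm_sub_tendsto_zero]
    refine squeeze_zero (fun _ => norm_nonneg _) (fun k => h.norm_cls_sub_compLp_le hF F0
      (hr k).le (hp1 k) (h.emb (toAlg a))) ?_
    simpa using hlim)
  exact hfe

/-- If `F ∘ a` and `G ∘ a` are orthogonal for the form and the product of their increments is
nonpositive, then the jumps at which the product is at most `-1` are negligible. -/
lemma tendsto_jumpMean_of_form_eq_zero {F G : ℝ → ℝ} {K L : NNReal} (hF : LipschitzWith K F)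
    (F0 : F 0 = 0) (hF1 : ContDiff ℝ 1 F) (hG : LipschitzWith L G) (G0 : G 0 = 0)
    (hG1 : ContDiff ℝ 1 G) (a : realAlgebra D)
    (h0 : h.closedForm.form (h.lipComp hF F0 (h.star_emb_toAlg a))
      (h.lipComp hG G0 (h.star_emb_toAlg a)) = 0) {Φ : E × E → ℝ} (hΦ : BddMeas Φ)
    (hΦF : ∀ z, |Φ z| ≤ -((F (a.1 z.2) - F (a.1 z.1)) * (G (a.1 z.2) - G (a.1 z.1)))) :
    Tendsto (jumpMean P Y Yn α Φ) atTop (𝓝 0) := by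
  obtain ⟨b, hb1, hb2⟩ := h.exists_poly_seq_energy hF F0 hF1 a
  obtain ⟨c, hc1, hc2⟩ := h.exists_poly_seq_energy hG G0 hG1 a
  have ba := fun a : realAlgebra D => (h.bddMeas_real a).increment
  refine h.tendsto_jumpMean_zero_of_le hΦ fun η hη => ?_
  set e := h.closedForm.energy (h.emb (toAlg a)) with he
  have h1 := (RCLike.continuous_re.tendsto _).comp (SymmForm.tendsto_form hb2 hc2)
  rw [h0, map_zero] at h1
  have hlim := tendsto_one_div_add_atTop_nhds_zero_nat (𝕜 := ℝ)
  -- The mean of minus the product of increments tends to `-2 ℰ(b k, c k)`, which is small for large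
  -- `k`. With `r = 1 / (k + 1) ≤ 1`, replacing the increments of `F ∘ a`, `G ∘ a` costs at most `(K
  -- + L + 1) r |Δa|²`, whose mean tends to `(K + L + 1) r * (2 * e)`.
  have h2 := (h1.const_mul (-2)).add ((hlim.const_mul (K + L + 1 : ℝ)).mul_const (2 * e))
  rw [mul_zero, mul_zero, zero_mul, add_zero] at h2
  obtain ⟨k, hk⟩ := (h2.eventually (gt_mem_nhds hη)).exists
  set r := 1 / ((k : ℝ) + 1) with hr
  have hr0 : 0 < r := by positivity
  have hr1 : r ≤ 1 := by
    rw [hr, div_le_one (by positivity)]; linarith [(Nat.cast_nonneg k : (0 : ℝ) ≤ k)]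
  have b1 := (BddMeas.const (X := E × E) (-1 : ℝ)).mul ((ba (b k)).mul (ba (c k)))
  have b2 := (BddMeas.const (X := E × E) ((K + L + 1) * r)).mul ((ba a).pow 2)
  refine ⟨_, b1.add b2, fun z => ?_, ?_⟩
  · rw [Real.norm_eq_abs]
    refine (hΦF z).trans ?_
    have f1 := hb1 k z
    have f2 := hc1 k z
    have f3 := hF.dist_le_mul (a.1 z.2) (a.1 z.1)
    have f4 := hG.dist_le_mul (a.1 z.2) (a.1 z.1)
    rw [Real.dist_eq, Real.dist_eq] at f3 f4
    change _ ≤ K * |increment a.1 z| at f3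
    change _ ≤ L * |increment a.1 z| at f4
    set x := |increment a.1 z|
    have hx : increment a.1 z ^ 2 = x ^ 2 := (sq_abs _).symm
    have hx0 : 0 ≤ x := abs_nonneg _
    rw [hx]
    set s := F (a.1 z.2) - F (a.1 z.1)
    set t := G (a.1 z.2) - G (a.1 z.1)
    set s' := increment (b k).1 z
    set t' := increment (c k).1 z
    have e1 : s' * t' - s * t = (s' - s) * (t' - t) + (s' - s) * t + s * (t' - t) := by ring
    have e2 : |s' * t' - s * t| ≤ r * x * (r * x) + r * x * (L * x) + K * x * (r * x) := by
      rw [e1]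
      refine (abs_add_le _ _).trans (add_le_add ((abs_add_le _ _).trans (add_le_add ?_ ?_)) ?_)
      all_goals rw [abs_mul]; gcongr
    have e3 : r * x * (r * x) ≤ r * x * (1 * x) := by gcongr
    have e4 := le_abs_self (s' * t' - s * t)
    linarith [show (K + L + 1) * r * x ^ 2 = r * x * (1 * x) + r * x * (L * x) + K * x * (r * x)
      by ring]
  · have h3 := (RCLike.continuous_re.tendsto _).comp (h.tendsto_form_real (b k) (c k))
    simp only [Function.comp_def, RCLike.ofReal_re] at h3
    have h4 := (h3.const_mul (-2)).add ((h.tendsto_jumpMean_sq a).const_mul ((K + L + 1) * r))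
    filter_upwards [h4.eventually (gt_mem_nhds hk)] with n hn
    rw [h.jumpMean_add b1 b2, jumpMean_const_mul, jumpMean_const_mul]
    linarith

omit [IsProbabilityMeasure P] in
lemma bddMeas_indicator (a : realAlgebra D) {t : Set (ℝ × ℝ)} (ht : MeasurableSet t) :
    BddMeas fun z : E × E => t.indicator (1 : ℝ × ℝ → ℝ) (a.1 z.1, a.1 z.2) := by
  have hm := (h.bddMeas_real a).measurable
  refine ⟨(measurable_one.indicator ht).comp
    ((hm.comp measurable_fst).prodMk (hm.comp measurable_snd)), 1, fun z => ?_⟩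
  by_cases hz : (a.1 z.1, a.1 z.2) ∈ t <;> simp [hz]

/-- For a local form, jumps between disjoint small neighbourhoods are negligible. -/
lemma exists_nhds_tendsto_jumpMean (hloc : h.closedForm.IsLocal) (a : realAlgebra D)
    {x : ℝ × ℝ} (hx : x.1 ≠ x.2) :
    ∃ t ∈ 𝓝 x, MeasurableSet t ∧ Tendsto (jumpMean P Y Yn α fun z =>
      t.indicator (1 : ℝ × ℝ → ℝ) (a.1 z.1, a.1 z.2)) atTop (𝓝 0) := by
  set d := dist x.1 x.2 with hd
  have hd0 : 0 < d := dist_pos.2 hx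
  -- Supports of radius `d / 4` around points at distance `d` are disjoint; on the inner balls of
  -- radius `d / 8` the bumps equal `1`.
  let f : ContDiffBump x.1 := ⟨d / 8, d / 4, by linarith, by linarith⟩
  let g : ContDiffBump x.2 := ⟨d / 8, d / 4, by linarith, by linarith⟩
  have hdisj : Disjoint (Metric.closedBall x.1 (d / 4)) (Metric.closedBall x.2 (d / 4)) :=
    Metric.closedBall_disjoint_closedBall (by linarith)
  have hfg : Disjoint (tsupport f) (tsupport g) := by
    rw [f.tsupport_eq, g.tsupport_eq]
    exact hdisj
  have hprod : ∀ y, f y * g y = 0 := fun y => by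
    by_contra hne
    exact hfg.le_bot ⟨subset_tsupport _ (left_ne_zero_of_mul hne),
      subset_tsupport _ (right_ne_zero_of_mul hne)⟩
  have hsm : ∀ {c : ℝ} (f : ContDiffBump c), ∃ K, LipschitzWith K fun x => f x - f 0 := fun f => by
    obtain ⟨K, hK⟩ := (f.contDiff (n := 1)).lipschitzWith_of_hasCompactSupport
      f.hasCompactSupport (by simp)
    refine ⟨K, LipschitzWith.of_dist_le_mul fun x y => ?_⟩
    rw [dist_sub_right]
    exact hK.dist_le_mul x y
  obtain ⟨K, hK⟩ := hsm f
  obtain ⟨L, hL⟩ := hsm g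
  obtain ⟨v, w, hv, hw, hvw⟩ := hloc (h.emb (toAlg a)) (h.star_emb_toAlg a) f g f.contDiff
    g.contDiff f.hasCompactSupport g.hasCompactSupport hfg
  have hv' : v = h.lipComp hK (sub_self _) (h.star_emb_toAlg a) :=
    Subtype.ext (Lp.ext (hv.trans (h.coeFn_lipComp hK (sub_self _) (h.star_emb_toAlg a)).symm))
  have hw' : w = h.lipComp hL (sub_self _) (h.star_emb_toAlg a) :=
    Subtype.ext (Lp.ext (hw.trans (h.coeFn_lipComp hL (sub_self _) (h.star_emb_toAlg a)).symm))
  rw [hv', hw'] at hvw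
  refine ⟨Metric.closedBall x.1 (d / 8) ×ˢ Metric.closedBall x.2 (d / 8),
    prod_mem_nhds (Metric.closedBall_mem_nhds _ (by linarith))
      (Metric.closedBall_mem_nhds _ (by linarith)),
    measurableSet_closedBall.prod measurableSet_closedBall, ?_⟩
  refine h.tendsto_jumpMean_of_form_eq_zero hK (sub_self _) (f.contDiff.sub contDiff_const) hL
    (sub_self _) (g.contDiff.sub contDiff_const) a hvw
    (h.bddMeas_indicator a (measurableSet_closedBall.prod measurableSet_closedBall)) fun z => ?_
  -- Since `f g = 0` everywhere, only the cross terms survive. They are nonnegative, and one of them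
  -- equals `1` on the chosen neighbourhood.
  have e : -((f (a.1 z.2) - f 0 - (f (a.1 z.1) - f 0)) * (g (a.1 z.2) - g 0 - (g (a.1 z.1) - g 0)))
      = f (a.1 z.2) * g (a.1 z.1) + f (a.1 z.1) * g (a.1 z.2) := by
    linear_combination -(hprod (a.1 z.2)) - hprod (a.1 z.1)
  rw [e]
  have n1 := mul_nonneg (f.nonneg (x := a.1 z.2)) (g.nonneg (x := a.1 z.1))
  have n2 := mul_nonneg (f.nonneg (x := a.1 z.1)) (g.nonneg (x := a.1 z.2))
  by_cases hz : (a.1 z.1, a.1 z.2) ∈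
      Metric.closedBall x.1 (d / 8) ×ˢ Metric.closedBall x.2 (d / 8)
  · rw [Set.indicator_of_mem hz, Pi.one_apply, abs_one, f.one_of_mem_closedBall hz.1,
      g.one_of_mem_closedBall hz.2]
    rw [f.one_of_mem_closedBall hz.1, g.one_of_mem_closedBall hz.2] at n2
    linarith
  · rw [Set.indicator_of_notMem hz, abs_zero]
    linarith

/-- For a local form, large jumps are negligible. -/
lemma exists_tendsto_jumpMean_indicator (hloc : h.closedForm.IsLocal) (a : realAlgebra D)
    {s : Set (ℝ × ℝ)} (hs : IsCompact s) (hdiag : ∀ x ∈ s, x.1 ≠ x.2) :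
    ∃ t, MeasurableSet t ∧ s ⊆ t ∧ Tendsto (jumpMean P Y Yn α fun z =>
      t.indicator (1 : ℝ × ℝ → ℝ) (a.1 z.1, a.1 z.2)) atTop (𝓝 0) := by
  -- Negligibility holds near each point of `s` and is stable under finite unions, so compactness
  -- gives it on all of `s`.
  refine hs.induction_on (p := fun s => ∃ t, MeasurableSet t ∧ s ⊆ t ∧
    Tendsto (jumpMean P Y Yn α fun z =>
      t.indicator (1 : ℝ × ℝ → ℝ) (a.1 z.1, a.1 z.2)) atTop (𝓝 0)) ?_ ?_ ?_ ?_
  · exact ⟨∅, MeasurableSet.empty, le_rfl, by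
      simp only [Set.indicator_empty, funext fun n => show jumpMean P Y Yn α
        (fun _ : E × E => (0 : ℝ)) n = 0 by simp [jumpMean], tendsto_const_nhds]⟩
  · rintro s s' hss' ⟨t, ht, hst, hlim⟩
    exact ⟨t, ht, hss'.trans hst, hlim⟩
  · rintro s s' ⟨t, ht, hst, hlim⟩ ⟨t', ht', hst', hlim'⟩
    refine ⟨t ∪ t', ht.union ht', Set.union_subset_union hst hst', ?_⟩
    refine h.tendsto_jumpMean_zero_of_le (h.bddMeas_indicator a (ht.union ht')) fun η hη =>
      ⟨_, (h.bddMeas_indicator a ht).add (h.bddMeas_indicator a ht'), fun z => ?_, ?_⟩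
    · by_cases h1 : (a.1 z.1, a.1 z.2) ∈ t <;> by_cases h2 : (a.1 z.1, a.1 z.2) ∈ t' <;>
        simp [h1, h2]
    · have h1 := hlim.add hlim'
      rw [add_zero] at h1
      filter_upwards [h1.eventually (gt_mem_nhds hη)] with n hn
      rw [h.jumpMean_add (h.bddMeas_indicator a ht) (h.bddMeas_indicator a ht')]
      exact hn
  · intro x hx
    obtain ⟨t, htx, ht, hlim⟩ := h.exists_nhds_tendsto_jumpMean hloc a (hdiag x hx)
    exact ⟨t, mem_nhdsWithin_of_mem_nhds htx, t, ht, le_rfl, hlim⟩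

/-- Jumps with `|Δa| ≥ δ` form a compact set away from the diagonal, as `a` is bounded, and are
negligible. On the others `(Δa)⁴ ≤ δ² (Δa)²`, whose mean tends to `δ² * (2 * e)`, made smaller than
`η` by the choice of `δ`. -/
lemma tendsto_pow_four_real (hloc : h.closedForm.IsLocal) (a : realAlgebra D) :
    Tendsto (jumpMean P Y Yn α fun z => increment a.1 z ^ 4) atTop (𝓝 0) := by
  have ba := (h.bddMeas_real a).increment
  obtain ⟨C, hC⟩ := h.exists_bound_real a
  refine h.tendsto_jumpMean_zero_of_le (ba.pow 4) fun η hη => ?_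
  set e := h.closedForm.energy (h.emb (toAlg a)) with he
  have he0 : 0 ≤ e := SymmForm.energy_nonneg _ _
  set δ := √(η / (2 * e + 1)) with hδ
  have hδ0 : 0 < δ := Real.sqrt_pos.2 (by positivity)
  have hδ2 : δ ^ 2 * (2 * e) < η := by
    rw [hδ, Real.sq_sqrt (by positivity), div_mul_eq_mul_div, div_lt_iff₀ (by positivity)]
    linarith
  obtain ⟨t, ht, hst, hlim⟩ := h.exists_tendsto_jumpMean_indicator hloc a
    (s := (Set.Icc (-C) C ×ˢ Set.Icc (-C) C) ∩ {x : ℝ × ℝ | δ ≤ |x.2 - x.1|})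
    ((isCompact_Icc.prod isCompact_Icc).inter_right
      (isClosed_le continuous_const (by fun_prop))) (fun x hx heq => by
        have : δ ≤ |x.2 - x.1| := hx.2
        rw [heq, sub_self, abs_zero] at this
        linarith)
  have b1 := (BddMeas.const (X := E × E) (δ ^ 2)).mul (ba.pow 2)
  have b2 := (BddMeas.const (X := E × E) ((2 * C) ^ 4)).mul (h.bddMeas_indicator a ht)
  refine ⟨_, b1.add b2, fun z => ?_, ?_⟩
  · rw [Real.norm_eq_abs, abs_of_nonneg (by positivity)]
    set x := increment a.1 z with hx
    have hind : 0 ≤ t.indicator (1 : ℝ × ℝ → ℝ) (a.1 z.1, a.1 z.2) :=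
      Set.indicator_nonneg (fun _ _ => zero_le_one) _
    by_cases hz : δ ≤ |x|
    · have hmem : (a.1 z.1, a.1 z.2) ∈ t := hst ⟨⟨hC z.1, hC z.2⟩, hz⟩
      rw [Set.indicator_of_mem hmem, Pi.one_apply, mul_one]
      have h1 : |x| ≤ 2 * C := by
        have h2 := hC z.1
        have h3 := hC z.2
        rw [abs_le, hx, increment]
        constructor <;> linarith [h2.1, h2.2, h3.1, h3.2]
      have h4 : |x| ^ 4 ≤ (2 * C) ^ 4 := pow_le_pow_left₀ (abs_nonneg _) h1 4
      rw [Even.pow_abs (by decide)] at h4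
      have : 0 ≤ δ ^ 2 * x ^ 2 := by positivity
      linarith
    · have h1 : x ^ 2 ≤ δ ^ 2 := by
        rw [← sq_abs]
        exact pow_le_pow_left₀ (abs_nonneg _) (not_le.1 hz).le 2
      have h2 : x ^ 2 * x ^ 2 ≤ δ ^ 2 * x ^ 2 := by gcongr
      have h3 : 0 ≤ (2 * C) ^ 4 * t.indicator (1 : ℝ × ℝ → ℝ) (a.1 z.1, a.1 z.2) :=
        mul_nonneg (by positivity) hind
      linarith [show x ^ 4 = x ^ 2 * x ^ 2 by ring]
  · have h1 := ((h.tendsto_jumpMean_sq a).const_mul (δ ^ 2)).add (hlim.const_mul ((2 * C) ^ 4))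
    rw [mul_zero, add_zero] at h1
    filter_upwards [h1.eventually (gt_mem_nhds hδ2)] with n hn
    rw [h.jumpMean_add b1 b2, jumpMean_const_mul, jumpMean_const_mul]
    exact hn

/-- The closed form is local if and only if the fourth moments of the increments vanish. -/
lemma isLocal_iff : h.closedForm.IsLocal ↔
    ∀ φ : D, Tendsto (jumpMean P Y Yn α fun z => increment φ.1 z ^ 4) atTop (𝓝 0) := by
  refine ⟨fun hloc φ => ?_, fun H => h.isLocal_of_tendsto_pow_four fun a => ?_⟩
  · set a := algRealPart φ with ha
    -- The real part of `-I φ` is the imaginary part of `φ`, and `‖Δφ‖⁴` is at most twice the sum of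
    -- the fourth powers of the two parts.
    set b := algRealPart ((-RCLike.I : 𝕜) • φ) with hb
    have ba := (h.bddMeas_real a).increment
    have bb := (h.bddMeas_real b).increment
    refine h.tendsto_jumpMean_zero_of_le ((h.bddMeas φ).increment.pow 4) fun η hη =>
      ⟨_, (BddMeas.const (2 : ℝ)).mul ((ba.pow 4).add (bb.pow 4)), fun z => ?_, ?_⟩
    · have e1 : increment a.1 z = RCLike.re (increment φ.1 z) := by
        simp only [increment, ha, algRealPart_apply, map_sub]
      have e2 : increment b.1 z = RCLike.im (increment φ.1 z) := by
        have : ∀ y, b.1 y = RCLike.im (φ.1 y) := fun y => by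
          rw [hb, algRealPart_apply]
          change RCLike.re (-RCLike.I * φ.1 y) = _
          rw [neg_mul, map_neg, RCLike.I_mul_re, neg_neg]
        simp only [increment, this, map_sub]
      rw [norm_pow, e1, e2]
      have e3 := RCLike.norm_sq_eq_def (z := increment φ.1 z)
      set r := RCLike.re (increment φ.1 z)
      set i := RCLike.im (increment φ.1 z)
      have e4 : ‖increment φ.1 z‖ ^ 4 = (r ^ 2 + i ^ 2) ^ 2 := by
        rw [show (4 : ℕ) = 2 * 2 from rfl, pow_mul, e3]
        ring
      rw [e4]
      nlinarith [sq_nonneg (r ^ 2 - i ^ 2)]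
    · have h1 := ((h.tendsto_pow_four_real hloc a).add (h.tendsto_pow_four_real hloc b)).const_mul 2
      rw [add_zero, mul_zero] at h1
      filter_upwards [h1.eventually (gt_mem_nhds hη)] with n hn
      rw [jumpMean_const_mul, h.jumpMean_add (ba.pow 4) (bb.pow 4)]
      exact hn
  · have h1 := (RCLike.continuous_re.tendsto _).comp (H (toAlg a))
    rw [map_zero] at h1
    refine h1.congr fun n => ?_
    have : (fun z => increment (toAlg a).1 z ^ 4)
        = fun z => ((increment a.1 z ^ 4 : ℝ) : 𝕜) := by
      funext z
      rw [increment_toAlg, RCLike.ofReal_pow]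
    rw [Function.comp_apply, this, jumpMean_ofReal, RCLike.ofReal_re]

end SymmetricBias

theorem mainTheorem1 {𝕜 : Type*} [RCLike 𝕜] {Ω E : Type*} [MeasurableSpace Ω] [MeasurableSpace E]
    (P : Measure Ω) [IsProbabilityMeasure P]
    (Y : Ω → E) (hY : Measurable Y) (Yn : ℕ → Ω → E) (hYn : ∀ n, Measurable (Yn n))
    (α : ℕ → ℝ) (hα : ∀ n, 0 < α n)
    (D : StarSubalgebra 𝕜 (E → 𝕜))
    (hDmeas : ∀ φ : D, Measurable φ.1)
    (hDbdd : ∀ φ : D, ∃ C : ℝ, ∀ y, ‖φ.1 y‖ ≤ C)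
    (hDdense : Dense {f : Lp 𝕜 2 (P.map Y) | ∃ φ : D, (f : E → 𝕜) =ᵐ[P.map Y] φ.1})
    (A : D → Lp 𝕜 2 (P.map Y)) (hA : IsSymmetricBiasOperator P Y Yn α D A) :
    -- the limit form on (the classes of) `D`, which is closable
    ∃ S : SymmForm 𝕜 (P.map Y),
      (∀ f : Lp 𝕜 2 (P.map Y), f ∈ S.domain ↔ ∃ φ : D, (f : E → 𝕜) =ᵐ[P.map Y] φ.1) ∧
      (∀ (φ χ : D) (u v : S.domain),
        ((u : Lp 𝕜 2 (P.map Y)) : E → 𝕜) =ᵐ[P.map Y] φ.1 →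
        ((v : Lp 𝕜 2 (P.map Y)) : E → 𝕜) =ᵐ[P.map Y] χ.1 →
        Tendsto
          (fun n => ((α n / 2 : ℝ) : 𝕜) *
            ∫ ω, (φ.1 (Yn n ω) - φ.1 (Y ω)) * (χ.1 (Yn n ω) - χ.1 (Y ω)) ∂P)
          atTop (𝓝 (S.form u v))) ∧
      S.Closable ∧
      -- its smallest closed extension, which is a Dirichlet form
      ∃ T : SymmForm 𝕜 (P.map Y), T.IsSmallestClosedExtension S ∧
        T.IsDirichletForm ∧
        -- the square field operator
        (∃ Γ : T.domain →ₗ[𝕜] T.domain →ₗ[𝕜] Lp 𝕜 1 (P.map Y), T.IsSquareField Γ ∧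
          ∀ (φ : D) (u : T.domain), ((u : Lp 𝕜 2 (P.map Y)) : E → 𝕜) =ᵐ[P.map Y] φ.1 →
            ((Γ u u : Lp 𝕜 1 (P.map Y)) : E → 𝕜)
              =ᵐ[P.map Y] (fun y => A (φ * φ) y - 2 * φ.1 y * A φ y) ∧
            ∀ χ : D, Tendsto
              (fun n => (α n : 𝕜) *
                ∫ ω, (φ.1 (Yn n ω) - φ.1 (Y ω)) ^ 2 * ((χ.1 (Yn n ω) + χ.1 (Y ω)) / 2) ∂P)
              atTop (𝓝 (∫ y, Γ u u y * χ.1 y ∂(P.map Y)))) ∧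
        -- locality
        (T.IsLocal ↔ ∀ φ : D,
          Tendsto (fun n => (α n : 𝕜) * ∫ ω, (φ.1 (Yn n ω) - φ.1 (Y ω)) ^ 4 ∂P)
            atTop (𝓝 0)) := by
  have h : SymmetricBias P Y Yn α D A := ⟨hY, hYn, hα, fun φ => ⟨hDmeas φ, hDbdd φ⟩, hDdense, hA⟩
  refine ⟨h.form, fun f => h.mem_range_cls, fun φ χ u v hu hv => ?_, h.form_closable,
    h.closedForm, SymmForm.closure_isSmallestClosedExtension _, h.closedForm_isDirichletForm,
    ⟨h.sqField, h.sqField_isSquareField, fun φ u hu => ?_⟩, h.isLocal_iff⟩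
  · have hu' : u = h.toDomain φ := Subtype.ext (h.cls_eq_iff.2 hu).symm
    have hv' : (v : Lp 𝕜 2 (P.map Y)) = h.cls χ := (h.cls_eq_iff.2 hv).symm
    rw [hu', h.form_toDomain_left, hv']
    refine (h.tendsto_half_jumpMean φ χ).congr fun n => ?_
    rw [jumpMean, ← mul_assoc, RCLike.ofReal_div, RCLike.ofReal_ofNat, mul_comm (2⁻¹ : 𝕜),
      ← div_eq_mul_inv]
    rfl
  · have hu' : u = h.emb φ := Subtype.ext (h.cls_eq_iff.2 hu).symm
    rw [hu', h.sqField_emb]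
    refine ⟨?_, fun χ => ?_⟩
    · filter_upwards [h.coeFn_sqFieldAlg φ φ] with y hy
      rw [hy]
      ring
    · simp only [sq, mul_comm (h.sqFieldAlg φ φ _)]
      exact h.tendsto_sqFieldAlg φ φ χ
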